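/- Consider equations $i\psi_t+\psi_{xx}+S\psi=0$ for a complex-valued function $\psi$ of real variables $t,x$, where $\psi\neq0$, $\rho=|\psi|$. The class $\mathcal V$ consists of those with $S=f(\rho)+V(t,x)$, where $f$ and $V$ are complex-valued and $f_\rho\neq0$. Let $\mathcal V'\subset\mathcal V$ be the subclass in which $\rho f_{\rho\rho}/f_\rho$ is not a real constant, and for $\gamma\in\mathbb R$ let $\mathcal P_\gamma\subset\mathcal V$ be the subclass with $\rho f_{\rho\rho}/f_\rho=\gamma-1$. All functions and transformations are local and smooth (or, alternatively, all are local and real analytic); a class is a family of germs of arbitrary elements $S$ (so that conditions such as ``$\rho f_{\rho\rho}/f_\rho$ is not a real constant'' are understood near the point considered). An admissible transformation $(S,\tilde S,\varphi)$ in a class consists of elements $S,\tilde S$ of the class and a local diffeomorphism $\varphi$ of the space of $(t,x,\psi,\psi^*)$ whose second prolongation maps the equation with $S$ (as a manifold in the space of 2-jets) to the equation with $\tilde S$. The equivalence group $G^\sim$ of a class is the pseudogroup of local diffeomorphisms $\Phi$ of the space of $(t,x,\psi,\psi^*,S,S^*)$, defined for all values of $S$ and projectable to a local diffeomorphism $\varphi$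 of the space of $(t,x,\psi,\psi^*)$, such that for every $S$ in the class $\Phi S$ is in the class and $(S,\Phi S,\varphi)$ is admissible; these admissible transformations are said to be induced by $\Phi$. A class is normalized if each of its admissible transformations is induced by an element of its equivalence group. Theorem. (i) The equivalence group $G^\sim_{\mathcal V}$ is formed by the transformations that have locally the form \[ \tilde t=T,\quad \tilde x=\varepsilon x|T_t|^{1/2}+X,\quad \tilde\psi=\hat\psi\exp\Bigl(\frac i8\frac{T_{tt}}{|T_t|}x^2+\frac i2\frac{\varepsilon\varepsilon'X_t}{|T_t|^{1/2}}x+\Theta+i\Psi\Bigr), \] \[ \tilde S=\frac{\hat S}{|T_t|}+\frac{2T_{ttt}T_t-3T_{tt}^2}{16\varepsilon'T_t^3}x^2+\frac{\varepsilon\varepsilon'}{2|T_t|^{1/2}}\Bigl(\frac{X_t}{T_t}\Bigr)_t x+\frac{\Psi_t-i\Theta_t}{T_t}-\frac{X_t^2+iT_{tt}}{4T_t^2} \] with $T_{tt}=0$ and $\Theta_t=0$. Here $T,X,\Theta,\Psi$ are real-valued functions of $t$, $T_t\neq0$, $\varepsilon=\pm1$, $\varepsilon'=\operatorname{sign}T_t$,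 and $\hat\beta=\beta$ if $T_t>0$, $\hat\beta=\beta^*$ if $T_t<0$. (ii) $\mathcal V$ is not normalized. (iii) $\mathcal V'$ has the same equivalence group as $\mathcal V$ and is normalized. (iv) There are two different cases of additional (conditional) equivalence transformations in $\mathcal V$: $\mathcal P_0$, which consists of the equations with $S=\sigma\ln\rho+V(t,x)$, and $\mathcal P_\gamma$ with $\gamma\neq0$, which consists of the equations with $S=\sigma\rho^\gamma+V(t,x)$ ($\sigma\neq0$ a complex constant). That is, $G^\sim_{\mathcal P_\gamma}\not\subseteq G^\sim_{\mathcal V}$ for every $\gamma\in\mathbb R$, $G^\sim_{\mathcal P_0}\neq G^\sim_{\mathcal P_\gamma}$ for $\gamma\ne0$, and each admissible transformation in $\mathcal V$ that is not induced by $G^\sim_{\mathcal V}$ is an admissible transformation in some $\mathcal P_\gamma$. (v) $\mathcal P_\gamma$ is normalized for every $\gamma\in\mathbb R$. (vi) $\mathcal V$ is the disjoint union of the subclasses $\mathcal V'$ and $\mathcal P_\gamma$, $\gamma\in\mathbb R$, and no point transformation maps an equation from one of them to an equation from a different one. Consequently the admissible transformations in $\mathcal V$ are exactly those induced, on elements of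 one of these subclasses, by the equivalence group of that subclass. -/

import Mathlib

open scoped ContDiff Topology ComplexConjugate
open Filter

namespace NSE

/-- The space of the variables `((t, x), ψ)`. The variable `ψ*` is the complex conjugate of `ψ`,
so smooth functions of `(t, x, ψ, ψ*)` are real-smooth functions on this space. -/
abbrev Vars : Type := (ℝ × ℝ) × ℂ

/-- A locally defined point transformation of class `C^r` of the space `E`: a `C^r` diffeomorphism
between two open subsets of `E`. -/
structure PointTransf (r : WithTop ℕ∞) (E : Type) [NormedAddCommGroup E] [NormedSpace ℝ E] where
  toHomeo : OpenPartialHomeomorph E E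
  contDiffOn : ContDiffOn ℝ r toHomeo toHomeo.source
  contDiffOn_symm : ContDiffOn ℝ r toHomeo.symm toHomeo.target

/-- The function `u` of `(t, x)` satisfies, at the point `p`, the equation
`i ψ_t + ψ_xx + S ψ = 0`, where `S` is a function of `(t, x, ψ, ψ*)`. -/
def SolvesAt (S : Vars → ℂ) (u : ℝ × ℝ → ℂ) (p : ℝ × ℝ) : Prop :=
  Complex.I * deriv (fun t => u (t, p.2)) p.1
    + deriv (deriv (fun x => u (p.1, x))) p.2
    + S (p, u p) * u p = 0

/-- Near `z`, the second prolongation of `φ` maps the manifold determined by the equation with the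
arbitrary element `S` in the space of 2-jets onto the one determined by the equation with `S'`.
A 2-jet over a point `z₁` is represented by a function `u` whose graph passes through `z₁`; its
image under the prolongation of `φ` is the jet at `φ z₁` of the function `u'` whose graph is locally
the image of the graph of `u`. -/
def MapsEquation (φ : Vars → Vars) (S S' : Vars → ℂ) (z : Vars) : Prop :=
  ∀ᶠ z₁ in 𝓝 z, ∀ u u' : ℝ × ℝ → ℂ,
    ContDiffAt ℝ 2 u z₁.1 → ContDiffAt ℝ 2 u' (φ z₁).1 → u z₁.1 = z₁.2 →
    (∀ᶠ q in 𝓝 z₁.1, (φ (q, u q)).2 = u' (φ (q, u q)).1) →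
    (SolvesAt S u z₁.1 ↔ SolvesAt S' u' (φ z₁).1)

/-- A class of equations `i ψ_t + ψ_xx + S ψ = 0`: for each point `z`, the set of arbitrary elements
`S` that are admitted near `z` (a property of the germ of `S` at `z`). -/
abbrev EqClass : Type := Vars → (Vars → ℂ) → Prop

/-- `(S, S', φ)` is an admissible transformation in the class `C` near the point `z`. -/
def Admissible {r : WithTop ℕ∞} (C : EqClass) (z : Vars) (S S' : Vars → ℂ)
    (φ : PointTransf r Vars) : Prop :=
  z ∈ φ.toHomeo.source ∧ C z S ∧ C (φ.toHomeo z) S' ∧ MapsEquation φ.toHomeo S S' z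

/-- A locally defined point transformation of the space of `(t, x, ψ, ψ*, S, S*)`, `ψ ≠ 0`, that is
projectable on the space of `(t, x, ψ, ψ*)`, where `base` is the projection. It is defined for all
values of `S`, so that it can be applied to every arbitrary element near each point of its
domain. -/
structure ExtTransf (r : WithTop ℕ∞) where
  total : PointTransf r (Vars × ℂ)
  base : PointTransf r Vars
  source_ne : ∀ z ∈ base.toHomeo.source, z.2 ≠ 0
  source_eq : total.toHomeo.source = base.toHomeo.source ×ˢ Set.univ
  proj : ∀ p ∈ total.toHomeo.source, (total.toHomeo p).1 = base.toHomeo p.1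

/-- The action of `Φ` on arbitrary elements. -/
noncomputable def ExtTransf.act {r : WithTop ℕ∞} (Φ : ExtTransf r) (S : Vars → ℂ) : Vars → ℂ :=
  fun w => (Φ.total.toHomeo (Φ.base.toHomeo.symm w, S (Φ.base.toHomeo.symm w))).2

/-- The (usual) equivalence group, i.e. pseudogroup of locally defined equivalence transformations,
of the class `C`. -/
def equivGroup (r : WithTop ℕ∞) (C : EqClass) : Set (ExtTransf r) :=
  {Φ | ∀ z ∈ Φ.base.toHomeo.source, ∀ S, C z S → Admissible C z S (Φ.act S) Φ.base}

/-- Near `z`, the triple `(S, S', φ)` is induced by `Φ`, i.e. `S' = Φ S` and `φ` is the projection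
of `Φ`. -/
def Induced {r : WithTop ℕ∞} (Φ : ExtTransf r) (z : Vars) (S S' : Vars → ℂ)
    (φ : PointTransf r Vars) : Prop :=
  z ∈ Φ.base.toHomeo.source ∧ φ.toHomeo =ᶠ[𝓝 z] Φ.base.toHomeo ∧
    S' =ᶠ[𝓝 (φ.toHomeo z)] Φ.act S

/-- The class `C` is normalized: each admissible transformation is induced by an element of the
equivalence group. -/
def Normalized (r : WithTop ℕ∞) (C : EqClass) : Prop :=
  ∀ (z : Vars) (S S' : Vars → ℂ) (φ : PointTransf r Vars), Admissible C z S S' φ →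
    ∃ Φ ∈ equivGroup r C, Induced Φ z S S' φ

/-- `g` is of class `C^r` in a neighbourhood of `a`. -/
def SmoothNear (r : WithTop ℕ∞) {E F : Type} [NormedAddCommGroup E] [NormedSpace ℝ E]
    [NormedAddCommGroup F] [NormedSpace ℝ F] (g : E → F) (a : E) : Prop :=
  ∀ᶠ y in 𝓝 a, ContDiffAt ℝ r g y

/-- Near the point `z`, where `ψ ≠ 0`, one has `S = f(|ψ|) + V(t, x)` with `f_ρ ≠ 0`. -/
def Splits (r : WithTop ℕ∞) (z : Vars) (S : Vars → ℂ) (f : ℝ → ℂ) (V : ℝ × ℝ → ℂ) : Prop :=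
  z.2 ≠ 0 ∧ SmoothNear r f ‖z.2‖ ∧ SmoothNear r V z.1 ∧ (∀ᶠ ρ in 𝓝 ‖z.2‖, deriv f ρ ≠ 0) ∧
    ∀ᶠ w in 𝓝 z, S w = f ‖w.2‖ + V w.1

/-- The class `𝒱` of the equations `i ψ_t + ψ_xx + f(|ψ|) ψ + V(t, x) ψ = 0`, `f_ρ ≠ 0`. -/
def classV (r : WithTop ℕ∞) : EqClass := fun z S => ∃ f V, Splits r z S f V

/-- The value `ρ f_ρρ / f_ρ`. -/
noncomputable def ratio (f : ℝ → ℂ) (ρ : ℝ) : ℂ := (ρ : ℂ) * deriv (deriv f) ρ / deriv f ρ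

/-- The subclass `𝒱'`: `ρ f_ρρ / f_ρ` is not a real constant. -/
def classV' (r : WithTop ℕ∞) : EqClass := fun z S =>
  ∃ f V, Splits r z S f V ∧ ¬ ∃ c : ℝ, ∀ᶠ ρ in 𝓝 ‖z.2‖, ratio f ρ = (c : ℂ)

/-- The subclass `𝒫_γ`: `ρ f_ρρ / f_ρ = γ - 1`. -/
def classP (r : WithTop ℕ∞) (γ : ℝ) : EqClass := fun z S =>
  ∃ f V, Splits r z S f V ∧ ∀ᶠ ρ in 𝓝 ‖z.2‖, ratio f ρ = ((γ - 1 : ℝ) : ℂ)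

/-- The family of subclasses `𝒱'`, `𝒫_γ`, `γ ∈ ℝ`. -/
def subclass (r : WithTop ℕ∞) : Option ℝ → EqClass
  | none => classV' r
  | some γ => classP r γ

/-- `β̂ = β` if `T_t > 0` and `β̂ = β*` if `T_t < 0`. -/
noncomputable def hat (T : ℝ → ℝ) (t : ℝ) (β : ℂ) : ℂ := if 0 < deriv T t then β else conj β

/-- The transformation of `(t, x, ψ, S)` with parameters `ε = ±1` and functions `T`, `X`, `Θ`, `Ψ`
of `t`, where `ε' = sign T_t`:
`t̃ = T`, `x̃ = ε x |T_t|^{1/2} + X`,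
`ψ̃ = ψ̂ exp((i/8) (T_tt/|T_t|) x² + (i/2) (ε ε' X_t/|T_t|^{1/2}) x + Θ + i Ψ)`,
`S̃ = Ŝ/|T_t| + (2 T_ttt T_t - 3 T_tt²)/(16 ε' T_t³) x² + (ε ε'/(2 |T_t|^{1/2})) (X_t/T_t)_t x
  + (Ψ_t - i Θ_t)/T_t - (X_t² + i T_tt)/(4 T_t²)`. -/
noncomputable def formula (ε : ℝ) (T X Θ Ψ : ℝ → ℝ) (p : Vars × ℂ) : Vars × ℂ :=
  let t := p.1.1.1
  let x := p.1.1.2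
  let ψ := p.1.2
  let S := p.2
  let T₁ := deriv T t
  let T₂ := deriv (deriv T) t
  let T₃ := deriv (deriv (deriv T)) t
  let X₁ := deriv X t
  let ε' := Real.sign T₁
  (((T t, ε * x * √|T₁| + X t),
    hat T t ψ * Complex.exp
      (Complex.I * (1 / 8 * (T₂ / |T₁|) * x ^ 2 + 1 / 2 * (ε * ε' * X₁ / √|T₁|) * x + Ψ t : ℝ)
        + (Θ t : ℂ))),
    hat T t S / (|T₁| : ℝ)
      + ((2 * T₃ * T₁ - 3 * T₂ ^ 2) / (16 * ε' * T₁ ^ 3) * x ^ 2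
        + ε * ε' / (2 * √|T₁|) * deriv (fun s => deriv X s / deriv T s) t * x : ℝ)
      + ((deriv Ψ t : ℝ) - Complex.I * (deriv Θ t : ℝ)) / (T₁ : ℂ)
      - ((X₁ : ℂ) ^ 2 + Complex.I * (T₂ : ℂ)) / (4 * (T₁ : ℂ) ^ 2))

/-- Near each point of its domain, `Φ` has the form `formula` with `ε = ±1` and functions `T`, `X`,
`Θ`, `Ψ` of class `C^r` such that `T_t ≠ 0`, `T_tt = 0` and `Θ_t = 0`. -/
def HasFormV {r : WithTop ℕ∞} (Φ : ExtTransf r) : Prop :=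
  ∀ z ∈ Φ.base.toHomeo.source, ∃ (ε : ℝ) (T X Θ Ψ : ℝ → ℝ), (ε = 1 ∨ ε = -1) ∧
    SmoothNear r T z.1.1 ∧ SmoothNear r X z.1.1 ∧ SmoothNear r Θ z.1.1 ∧ SmoothNear r Ψ z.1.1 ∧
    (∀ᶠ t in 𝓝 z.1.1, deriv T t ≠ 0 ∧ deriv (deriv T) t = 0 ∧ deriv Θ t = 0) ∧
    ∀ᶠ w in 𝓝 z, ∀ s : ℂ, Φ.total.toHomeo (w, s) = formula ε T X Θ Ψ (w, s)

end NSE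

/-! ### Jets of functions and of their images under a point transformation -/

namespace NSE

/-! Everything follows from a description of all point transformations between two equations of the
class.

Necessity of the form. The 2-jet condition is tested on quadratic polynomials `u` whose second
x-derivative is eliminated by the equation (`jetRel_of_mapsEquation`). The values u_tt, u_t, u_x
remain free, so their coefficients can be separated. The u_tt terms force t̃ to depend on t only
(`JetRel.time_apply_eq_zero`). The u_t terms give x̃_x² = |T_t|, x̃_ψ = 0, and a ψ-derivative of ψ̃
that is complex linear or antilinear according to the sign of T_t (`JetRel.space_apply`). The u_x
terms give ψ̃_ψψ = 0 and a first-order equation in x for ψ̃_ψ (`JetRel.psi_apply`). Integration on a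
ball yields ψ̃ = A ψ̂ + C (`exists_affine_form`). The remaining relation between S and S̃ forces C =
0 when both nonlinearities are functions of the modulus (`shift_eq_zero`), and integrating the
equation for A gives the exponential factor (`exists_hasForm`).

Sufficiency. A transformation of this form multiplies the conjugated or unconjugated left-hand side
of the equation by a nonvanishing factor (`HasForm.residual`), so it maps S to the stated S̃ and to
nothing else (`mapsEquation_iff`).

Which parameters preserve the class. If S = f + V and S̃ = g + Ṽ, then along a ray in ψ one gets
f̂_ρ(ρ) = |T_t| e^Θ g_ρ(e^Θ ρ). Differentiation in ρ shows that ρ f_ρρ/f_ρ is only rescaled in its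
argument and possibly conjugated; hence being a given real constant is invariant and the subclasses
do not mix. Differentiation in t gives Θ_t (ρ f_ρρ/f_ρ + 1) T_t + T_tt = 0. If the ratio is not a
real constant, this says Θ_t = T_tt = 0; if it equals γ - 1, it says γ Θ_t T_t + T_tt = 0. The
condition is also sufficient (`HasForm.exists_splits`). As it depends only on the subclass and not
on the equation, each admissible transformation of a subclass extends to an equivalence
transformation of it (`normalized_subclass`).

The groups. The nonlinearities e^ρ plus a constant already force the form of the equivalence
transformations of 𝒱 and of 𝒱' (`hasFormV_of_forall_admissible`). The parameters Θ = t, T_t =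
e^(-γt) give an equivalence transformation of 𝒫_γ outside the group of 𝒱
(`exists_additional_equivalence`), whence 𝒱 is not normalized; the case γ = 0 separates the group of
𝒫_0 from the others. -/

/-- The derivative is required to vanish only in the direction of the segment. This permits
integration of partial derivatives, in particular on slices of a ball where t or (t, x) is fixed. -/
theorem eq_of_fderiv_apply_eq_zero {E F : Type*} [NormedAddCommGroup E] [NormedSpace ℝ E]
    [NormedAddCommGroup F] [NormedSpace ℝ F] {s : Set E} (hs : Convex ℝ s) {g : E → F} {a b : E}
    (ha : a ∈ s) (hb : b ∈ s) (hd : ∀ y ∈ s, DifferentiableAt ℝ g y)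
    (h0 : ∀ y ∈ s, fderiv ℝ g y (b - a) = 0) : g a = g b := by
  have hmem : ∀ τ ∈ Set.Icc (0 : ℝ) 1, a + τ • (b - a) ∈ s := fun τ hτ =>
    hs.add_smul_sub_mem ha hb hτ
  have hder : ∀ τ ∈ Set.Icc (0 : ℝ) 1, HasDerivAt (fun τ : ℝ => g (a + τ • (b - a))) 0 τ := by
    intro τ hτ
    have h1 : HasDerivAt (fun τ : ℝ => a + τ • (b - a)) (b - a) τ := by
      simpa using ((hasDerivAt_id τ).smul_const (b - a)).const_add a
    have := (hd _ (hmem τ hτ)).hasFDerivAt.comp_hasDerivAt τ h1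
    rwa [h0 _ (hmem τ hτ)] at this
  have := constant_of_has_deriv_right_zero (f := fun τ : ℝ => g (a + τ • (b - a))) (a := 0) (b := 1)
    (fun τ hτ => (hder τ hτ).continuousAt.continuousWithinAt)
    (fun τ hτ => (hder τ (Set.Ico_subset_Icc_self hτ)).hasDerivWithinAt) 1 (by simp)
  simpa using this.symm

/-- Bijectivity is transversality: the base component of `g` has a local inverse, and the fibre
component composed with it is the required function. -/
theorem exists_image_function {g : ℝ × ℝ → Vars} {q : ℝ × ℝ} (hg : ContDiffAt ℝ 2 g q)
    (hb : Function.Bijective fun v => (fderiv ℝ g q v).1) :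
    ∃ u' : ℝ × ℝ → ℂ, ContDiffAt ℝ 2 u' (g q).1 ∧ ∀ᶠ y in 𝓝 q, (g y).2 = u' (g y).1 := by
  let A : (ℝ × ℝ) →L[ℝ] (ℝ × ℝ) := (ContinuousLinearMap.fst ℝ (ℝ × ℝ) ℂ).comp (fderiv ℝ g q)
  let e : (ℝ × ℝ) ≃L[ℝ] (ℝ × ℝ) :=
    (LinearEquiv.ofBijective A.toLinearMap hb).toContinuousLinearEquiv
  have hB : ContDiffAt ℝ 2 (fun y => (g y).1) q := contDiffAt_fst.comp q hg
  have hd : HasFDerivAt (fun y => (g y).1) (e : (ℝ × ℝ) →L[ℝ] (ℝ × ℝ)) q := by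
    have h1 := (hg.differentiableAt (by norm_num)).hasFDerivAt.fst
    have he : (e : (ℝ × ℝ) →L[ℝ] (ℝ × ℝ)) = A := by ext <;> rfl
    rw [he]; exact h1
  refine ⟨fun p => (g (hB.localInverse hd (by norm_num) p)).2, ?_, ?_⟩
  · have hinv := hB.to_localInverse hd (by norm_num)
    have h0 : hB.localInverse hd (by norm_num) (g q).1 = q := hB.localInverse_apply_image hd (by norm_num)
    refine contDiffAt_snd.comp _ (ContDiffAt.comp (g := g) _ ?_ hinv)
    rwa [h0]
  · have := (hB.hasStrictFDerivAt' hd (by norm_num)).eventually_left_inverse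
    filter_upwards [this] with y hy
    have hy' : hB.localInverse hd (by norm_num) (g y).1 = y := hy
    rw [hy']

theorem deriv_fst_eq_fderiv {u : ℝ × ℝ → ℂ} {p : ℝ × ℝ} (hu : DifferentiableAt ℝ u p) :
    deriv (fun t => u (t, p.2)) p.1 = fderiv ℝ u p (1, 0) := by
  have h : HasDerivAt (fun t : ℝ => (t, p.2)) ((1 : ℝ), (0 : ℝ)) p.1 :=
    (hasDerivAt_id p.1).prodMk (hasDerivAt_const p.1 p.2)
  exact (hu.hasFDerivAt.comp_hasDerivAt (x := p.1) (f := fun t : ℝ => (t, p.2)) h).deriv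

theorem deriv_snd_eq_fderiv {u : ℝ × ℝ → ℂ} {p : ℝ × ℝ} (hu : DifferentiableAt ℝ u p) :
    deriv (fun x => u (p.1, x)) p.2 = fderiv ℝ u p (0, 1) := by
  have h : HasDerivAt (fun x : ℝ => (p.1, x)) ((0 : ℝ), (1 : ℝ)) p.2 :=
    (hasDerivAt_const p.2 p.1).prodMk (hasDerivAt_id p.2)
  exact (hu.hasFDerivAt.comp_hasDerivAt (x := p.2) (f := fun x : ℝ => (p.1, x)) h).deriv

theorem eventually_differentiableAt {E F : Type*} [NormedAddCommGroup E] [NormedSpace ℝ E]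
    [NormedAddCommGroup F] [NormedSpace ℝ F] {u : E → F} {p : E} (hu : ContDiffAt ℝ 2 u p) :
    ∀ᶠ y in 𝓝 p, DifferentiableAt ℝ u y :=
  (hu.eventually (by simp)).mono fun _ hy => hy.differentiableAt (by norm_num)

theorem differentiableAt_fderiv {E F : Type*} [NormedAddCommGroup E] [NormedSpace ℝ E]
    [NormedAddCommGroup F] [NormedSpace ℝ F] {u : E → F} {p : E} (hu : ContDiffAt ℝ 2 u p) :
    DifferentiableAt ℝ (fderiv ℝ u) p :=
  (hu.fderiv_right (m := 1) (by norm_num)).differentiableAt (by norm_num)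

theorem eventually_snd_line {p : ℝ × ℝ} {Q : ℝ × ℝ → Prop} (h : ∀ᶠ y in 𝓝 p, Q y) :
    ∀ᶠ x in 𝓝 p.2, Q (p.1, x) :=
  (show ContinuousAt (fun x : ℝ => (p.1, x)) p.2 by fun_prop).eventually h

theorem deriv_deriv_snd_eq_fderiv {u : ℝ × ℝ → ℂ} {p : ℝ × ℝ} (hu : ContDiffAt ℝ 2 u p) :
    deriv (deriv fun x => u (p.1, x)) p.2 = fderiv ℝ (fderiv ℝ u) p (0, 1) (0, 1) := by
  have h1 : deriv (fun x => u (p.1, x)) =ᶠ[𝓝 p.2] fun x => fderiv ℝ u (p.1, x) (0, 1) := by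
    filter_upwards [eventually_snd_line (eventually_differentiableAt hu)] with x hx
    exact deriv_snd_eq_fderiv (p := (p.1, x)) hx
  rw [h1.deriv_eq]
  have h : HasDerivAt (fun x : ℝ => (p.1, x)) ((0 : ℝ), (1 : ℝ)) p.2 :=
    (hasDerivAt_const p.2 p.1).prodMk (hasDerivAt_id p.2)
  have h2 := (differentiableAt_fderiv hu).hasFDerivAt.comp_hasDerivAt (x := p.2)
    (f := fun x : ℝ => (p.1, x)) h
  have h3 := h2.clm_apply (hasDerivAt_const p.2 ((0 : ℝ), (1 : ℝ)))
  simpa using h3.deriv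

theorem fderiv_fderiv_comp {E F G : Type*} [NormedAddCommGroup E] [NormedSpace ℝ E]
    [NormedAddCommGroup F] [NormedSpace ℝ F] [NormedAddCommGroup G] [NormedSpace ℝ G]
    {u : F → G} {B : E → F} {q : E} (hu : ContDiffAt ℝ 2 u (B q)) (hB : ContDiffAt ℝ 2 B q)
    (v : E) :
    fderiv ℝ (fderiv ℝ fun y => u (B y)) q v v =
      fderiv ℝ (fderiv ℝ u) (B q) (fderiv ℝ B q v) (fderiv ℝ B q v)
        + fderiv ℝ u (B q) (fderiv ℝ (fderiv ℝ B) q v v) := by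
  have h1 : fderiv ℝ (fun y => u (B y)) =ᶠ[𝓝 q] fun y => (fderiv ℝ u (B y)).comp (fderiv ℝ B y) := by
    filter_upwards [eventually_differentiableAt hB,
      hB.continuousAt.eventually (eventually_differentiableAt hu)] with y hy hy'
    exact fderiv_comp (g := u) y hy' hy
  rw [h1.fderiv_eq]
  have h2 : HasFDerivAt (fun y => fderiv ℝ u (B y)) _ q :=
    (differentiableAt_fderiv hu).hasFDerivAt.comp q (hB.differentiableAt (by norm_num)).hasFDerivAt
  have h3 := h2.clm_comp (differentiableAt_fderiv hB).hasFDerivAt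
  rw [h3.fderiv]
  simp [add_comm]

theorem fderiv_comp_graph {φ : Vars → Vars} {u : ℝ × ℝ → ℂ} {q : ℝ × ℝ}
    (hφ : DifferentiableAt ℝ φ (q, u q)) (hu : DifferentiableAt ℝ u q) (v : ℝ × ℝ) :
    fderiv ℝ (fun y => φ (y, u y)) q v = fderiv ℝ φ (q, u q) (v, fderiv ℝ u q v) := by
  have h : HasFDerivAt (fun y => (y, u y)) _ q := (hasFDerivAt_id q).prodMk hu.hasFDerivAt
  have h2 : HasFDerivAt (fun y => φ (y, u y)) _ q :=
    HasFDerivAt.comp (g := φ) (f := fun y => (y, u y)) q hφ.hasFDerivAt h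
  rw [h2.fderiv]; rfl

theorem fderiv_fderiv_comp_graph {φ : Vars → Vars} {u : ℝ × ℝ → ℂ} {q : ℝ × ℝ}
    (hφ : ContDiffAt ℝ 2 φ (q, u q)) (hu : ContDiffAt ℝ 2 u q) (v : ℝ × ℝ) :
    fderiv ℝ (fderiv ℝ fun y => φ (y, u y)) q v v =
      fderiv ℝ (fderiv ℝ φ) (q, u q) (v, fderiv ℝ u q v) (v, fderiv ℝ u q v)
        + fderiv ℝ φ (q, u q) (0, fderiv ℝ (fderiv ℝ u) q v v) := by
  have hB : ContDiffAt ℝ 2 (fun y => (y, u y)) q := contDiffAt_id.prodMk hu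
  rw [fderiv_fderiv_comp (u := φ) (B := fun y => (y, u y)) hφ hB v]
  have h1 : ∀ᶠ y in 𝓝 q, fderiv ℝ (fun y => (y, u y)) y
      = (ContinuousLinearMap.id ℝ (ℝ × ℝ)).prod (fderiv ℝ u y) := by
    filter_upwards [eventually_differentiableAt hu] with y hy
    exact ((hasFDerivAt_id y).prodMk hy.hasFDerivAt).fderiv
  have h2 : fderiv ℝ (fderiv ℝ (fun y => (y, u y))) q v v
      = ((0 : ℝ × ℝ), fderiv ℝ (fderiv ℝ u) q v v) := by
    rw [Filter.EventuallyEq.fderiv_eq h1]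
    have h3 := (differentiableAt_fderiv hu).hasFDerivAt
    have h5 : HasFDerivAt (fun y => (ContinuousLinearMap.id ℝ (ℝ × ℝ)).prod (fderiv ℝ u y))
      (((ContinuousLinearMap.compL ℝ (ℝ × ℝ) ℂ Vars (ContinuousLinearMap.inr ℝ (ℝ × ℝ) ℂ))).comp
        (fderiv ℝ (fderiv ℝ u) q)) q := by
      have h6 := ((((ContinuousLinearMap.compL ℝ (ℝ × ℝ) ℂ Vars
        (ContinuousLinearMap.inr ℝ (ℝ × ℝ) ℂ))).hasFDerivAt (x := fderiv ℝ u q)).comp q h3).const_add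
          ((ContinuousLinearMap.inl ℝ (ℝ × ℝ) ℂ))
      refine h6.congr_of_eventuallyEq (Eventually.of_forall fun y => ?_)
      ext <;> simp
    rw [h5.fderiv]
    simp
  rw [h1.self_of_nhds, h2]
  simp

/-- Both equations are evaluated on one test jet. `P` and `L` are the first derivatives of `u` and
of its image, `α` and `β` stand for u_tt and u_xx, `δ` is the vector that the base map sends to the
unit vector along x̃, and `Y` is the second derivative along `δ` of the transformed graph. -/
theorem jet_iff {φ : Vars → Vars} {S S' : Vars → ℂ} {w : Vars} (hφ : ContDiffAt ℝ 2 φ w)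
    (hM : ∀ u u' : ℝ × ℝ → ℂ, ContDiffAt ℝ 2 u w.1 → ContDiffAt ℝ 2 u' (φ w).1 → u w.1 = w.2 →
      (∀ᶠ q in 𝓝 w.1, (φ (q, u q)).2 = u' (φ (q, u q)).1) →
      (SolvesAt S u w.1 ↔ SolvesAt S' u' (φ w).1))
    (P L : ℝ × ℝ →L[ℝ] ℂ) (α β : ℂ) (δ : ℝ × ℝ)
    (hbij : Function.Bijective fun v => (fderiv ℝ φ w (v, P v)).1)
    (hL : ∀ v, (fderiv ℝ φ w (v, P v)).2 = L (fderiv ℝ φ w (v, P v)).1)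
    (hδ : (fderiv ℝ φ w (δ, P δ)).1 = (0, 1)) (Y : Vars)
    (hY : Y = fderiv ℝ (fderiv ℝ φ) w (δ, P δ) (δ, P δ)
      + fderiv ℝ φ w (0, α * (δ.1 : ℂ) ^ 2 + β * (δ.2 : ℂ) ^ 2)) :
    Complex.I * P (1, 0) + β + S w * w.2 = 0 ↔
      Complex.I * L (1, 0) + (Y.2 - L Y.1) + S' (φ w) * (φ w).2 = 0 := by
  obtain ⟨q, c⟩ := w
  -- The mixed derivative is taken to be zero; the free values `P`, `α`, `β` are enough to separate
  -- all coefficients needed later.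
  let u : ℝ × ℝ → ℂ := fun y => c + P (y - q) + (α / 2) * ((y.1 - q.1 : ℝ) : ℂ) ^ 2
    + (β / 2) * ((y.2 - q.2 : ℝ) : ℂ) ^ 2
  have huq : u q = c := by simp [u]
  have hus : ContDiff ℝ 2 u := by
    have h1 : ContDiff ℝ 2 (fun y : ℝ × ℝ => ((y.1 - q.1 : ℝ) : ℂ)) :=
      Complex.ofRealCLM.contDiff.comp (contDiff_fst.sub contDiff_const)
    have h2 : ContDiff ℝ 2 (fun y : ℝ × ℝ => ((y.2 - q.2 : ℝ) : ℂ)) :=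
      Complex.ofRealCLM.contDiff.comp (contDiff_snd.sub contDiff_const)
    exact ((contDiff_const.add (P.contDiff.comp (contDiff_id.sub contDiff_const))).add
      (contDiff_const.mul (h1.pow 2))).add (contDiff_const.mul (h2.pow 2))
  let a1 : ℝ × ℝ →L[ℝ] ℂ := Complex.ofRealCLM.comp (ContinuousLinearMap.fst ℝ ℝ ℝ)
  let a2 : ℝ × ℝ →L[ℝ] ℂ := Complex.ofRealCLM.comp (ContinuousLinearMap.snd ℝ ℝ ℝ)
  have hud : ∀ y, HasFDerivAt u (P + (α * ((y.1 - q.1 : ℝ) : ℂ)) • a1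
      + (β * ((y.2 - q.2 : ℝ) : ℂ)) • a2) y := by
    intro y
    have h0 : HasFDerivAt (fun y : ℝ × ℝ => P (y - q)) P y := by
      exact P.hasFDerivAt.comp y ((hasFDerivAt_id y).sub_const q)
    have h1 : HasFDerivAt (fun y : ℝ × ℝ => ((y.1 - q.1 : ℝ) : ℂ)) a1 y := by
      have := (a1.hasFDerivAt (x := y)).sub_const ((q.1 : ℝ) : ℂ)
      refine this.congr_of_eventuallyEq (Eventually.of_forall fun y => ?_)
      simp [a1]
    have h2 : HasFDerivAt (fun y : ℝ × ℝ => ((y.2 - q.2 : ℝ) : ℂ)) a2 y := by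
      have := (a2.hasFDerivAt (x := y)).sub_const ((q.2 : ℝ) : ℂ)
      refine this.congr_of_eventuallyEq (Eventually.of_forall fun y => ?_)
      simp [a2]
    have := ((h0.const_add c).add ((h1.pow 2).const_mul (α / 2))).add ((h2.pow 2).const_mul (β / 2))
    refine (this.congr_fderiv ?_)
    ext <;> simp <;> ring
  have hfd : fderiv ℝ u = fun y => P + (α * ((y.1 - q.1 : ℝ) : ℂ)) • a1
      + (β * ((y.2 - q.2 : ℝ) : ℂ)) • a2 := funext fun y => (hud y).fderiv
  have hPq : fderiv ℝ u q = P := by rw [hfd]; ext <;> simp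
  have hud2 : ∀ v, fderiv ℝ (fderiv ℝ u) q v v = α * (v.1 : ℂ) ^ 2 + β * (v.2 : ℂ) ^ 2 := by
    intro v
    have h1 : HasFDerivAt (fun y : ℝ × ℝ => ((y.1 - q.1 : ℝ) : ℂ)) a1 q := by
      have := (a1.hasFDerivAt (x := q)).sub_const ((q.1 : ℝ) : ℂ)
      refine this.congr_of_eventuallyEq (Eventually.of_forall fun y => ?_)
      simp [a1]
    have h2 : HasFDerivAt (fun y : ℝ × ℝ => ((y.2 - q.2 : ℝ) : ℂ)) a2 q := by
      have := (a2.hasFDerivAt (x := q)).sub_const ((q.2 : ℝ) : ℂ)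
      refine this.congr_of_eventuallyEq (Eventually.of_forall fun y => ?_)
      simp [a2]
    have h3 := (((h1.const_mul α).smul_const a1).const_add P).add ((h2.const_mul β).smul_const a2)
    have h4 : fderiv ℝ (fderiv ℝ u) q = (α • a1).smulRight a1 + (β • a2).smulRight a2 := by
      rw [hfd]; exact h3.fderiv
    rw [h4]
    simp [a1, a2]; ring
  let g : ℝ × ℝ → Vars := fun y => φ (y, u y)
  have hφ' : ContDiffAt ℝ 2 φ (q, u q) := by rw [huq]; exact hφ
  have hg : ContDiffAt ℝ 2 g q :=
    ContDiffAt.comp (g := φ) (f := fun y => (y, u y)) q hφ' (contDiffAt_id.prodMk hus.contDiffAt)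
  have hgq : g q = φ (q, c) := by simp [g, huq]
  have hDg : ∀ v, fderiv ℝ g q v = fderiv ℝ φ (q, c) (v, P v) := by
    intro v
    have := fderiv_comp_graph (hφ'.differentiableAt (by norm_num))
      (hus.contDiffAt.differentiableAt (by norm_num)) v
    rwa [hPq, huq] at this
  have hYg : Y = fderiv ℝ (fderiv ℝ g) q δ δ := by
    have := fderiv_fderiv_comp_graph hφ' hus.contDiffAt δ
    rw [hPq, huq, hud2] at this
    rw [hY]; exact this.symm
  obtain ⟨u', hu', huu⟩ := exists_image_function hg (by simpa only [hDg] using hbij)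
  have hcomp : (fun y => (g y).2) =ᶠ[𝓝 q] fun y => u' (g y).1 := huu
  have hg1 : ContDiffAt ℝ 2 (fun y => (g y).1) q := contDiffAt_fst.comp q hg
  have hDg1 : ∀ᶠ y in 𝓝 q, fderiv ℝ (fun y => (g y).1) y
      = (ContinuousLinearMap.fst ℝ (ℝ × ℝ) ℂ).comp (fderiv ℝ g y) := by
    filter_upwards [eventually_differentiableAt hg] with y hy
    exact hy.hasFDerivAt.fst.fderiv
  have hDg2 : ∀ᶠ y in 𝓝 q, fderiv ℝ (fun y => (g y).2) y
      = (ContinuousLinearMap.snd ℝ (ℝ × ℝ) ℂ).comp (fderiv ℝ g y) := by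
    filter_upwards [eventually_differentiableAt hg] with y hy
    exact hy.hasFDerivAt.snd.fderiv
  have hLu : fderiv ℝ u' (g q).1 = L := by
    have h1 : ∀ v, fderiv ℝ u' (g q).1 (fderiv ℝ g q v).1 = (fderiv ℝ g q v).2 := by
      intro v
      have h2 : fderiv ℝ (fun y => u' (g y).1) q
          = (fderiv ℝ u' (g q).1).comp (fderiv ℝ (fun y => (g y).1) q) :=
        fderiv_comp (g := u') q (hu'.differentiableAt (by norm_num))
          (hg1.differentiableAt (by norm_num))
      rw [← hcomp.fderiv_eq, hDg2.self_of_nhds, hDg1.self_of_nhds] at h2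
      exact (DFunLike.congr_fun h2 v).symm
    refine ContinuousLinearMap.ext fun m => ?_
    obtain ⟨v, rfl⟩ := hbij.2 m
    have := h1 v
    rwa [hDg, hL] at this
  -- The identity saying that the fibre component of `g` is `u'` of its base component is
  -- differentiated twice along `δ`.
  have hsec : fderiv ℝ (fderiv ℝ u') (g q).1 (0, 1) (0, 1) = Y.2 - L Y.1 := by
    have h1 := fderiv_fderiv_comp (u := u') (B := fun y => (g y).1) hu' hg1 δ
    rw [← (hcomp.fderiv).fderiv_eq, Filter.EventuallyEq.fderiv_eq hDg2,
      Filter.EventuallyEq.fderiv_eq hDg1, hDg1.self_of_nhds, hLu] at h1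
    have h2 := (((ContinuousLinearMap.compL ℝ (ℝ × ℝ) Vars ℂ
        (ContinuousLinearMap.snd ℝ (ℝ × ℝ) ℂ))).hasFDerivAt (x := fderiv ℝ g q)).comp q
        (differentiableAt_fderiv hg).hasFDerivAt
    have h3 := (((ContinuousLinearMap.compL ℝ (ℝ × ℝ) Vars (ℝ × ℝ)
        (ContinuousLinearMap.fst ℝ (ℝ × ℝ) ℂ))).hasFDerivAt (x := fderiv ℝ g q)).comp q
        (differentiableAt_fderiv hg).hasFDerivAt
    have h2' : fderiv ℝ (fun y => (ContinuousLinearMap.snd ℝ (ℝ × ℝ) ℂ).comp (fderiv ℝ g y)) q δ δ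
      = Y.2 := by
      rw [hYg]; exact DFunLike.congr_fun (DFunLike.congr_fun h2.fderiv δ) δ
    have h3' : fderiv ℝ (fun y => (ContinuousLinearMap.fst ℝ (ℝ × ℝ) ℂ).comp (fderiv ℝ g y)) q δ δ
      = Y.1 := by
      rw [hYg]; exact DFunLike.congr_fun (DFunLike.congr_fun h3.fderiv δ) δ
    rw [h2', h3'] at h1
    have h4 : ((ContinuousLinearMap.fst ℝ (ℝ × ℝ) ℂ).comp (fderiv ℝ g q)) δ = (0, 1) := by
      rw [← hδ, ← hDg]; rfl
    rw [h4] at h1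
    rw [h1]; ring
  have key := hM u u' hus.contDiffAt (by rw [← hgq]; exact hu') huq huu
  unfold SolvesAt at key
  rw [deriv_fst_eq_fderiv (hus.contDiffAt.differentiableAt (by norm_num)),
    deriv_deriv_snd_eq_fderiv hus.contDiffAt, hPq, hud2] at key
  rw [← hgq] at key ⊢
  rw [deriv_fst_eq_fderiv (hu'.differentiableAt (by norm_num)),
    deriv_deriv_snd_eq_fderiv hu', hLu, hsec] at key
  have h5 : u' (g q).1 = (g q).2 := huu.self_of_nhds.symm
  rw [h5] at key
  simpa [huq] using key

end NSE

/-! ### Determining equations at a single point -/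

namespace NSE

/-- The determining equations at a point: `D` and `H` are the first and second derivatives of a
transformation, `k = S ψ` and `k' = S̃ ψ̃`. -/
def JetRel (D : Vars →L[ℝ] Vars) (H : Vars →L[ℝ] Vars →L[ℝ] Vars) (k k' : ℂ) : Prop :=
  ∀ (p p' α : ℂ) (L : ℝ × ℝ →L[ℝ] ℂ) (δ : ℝ × ℝ),
    (D ((1, 0), p)).1.1 * (D ((0, 1), p')).1.2 - (D ((0, 1), p')).1.1 * (D ((1, 0), p)).1.2 ≠ 0 →
    L (D ((1, 0), p)).1 = (D ((1, 0), p)).2 → L (D ((0, 1), p')).1 = (D ((0, 1), p')).2 →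
    δ.1 • (D ((1, 0), p)).1 + δ.2 • (D ((0, 1), p')).1 = (0, 1) →
    ∀ Y : Vars, Y = H (δ, δ.1 • p + δ.2 • p') (δ, δ.1 • p + δ.2 • p')
      + D (0, α * (δ.1 : ℂ) ^ 2 + (-(Complex.I * p) - k) * (δ.2 : ℂ) ^ 2) →
    Complex.I * L (1, 0) + (Y.2 - L Y.1) + k' = 0

theorem map_graph_eq (D : Vars →L[ℝ] Vars) (p p' : ℂ) (v : ℝ × ℝ) :
    D (v, v.1 • p + v.2 • p') = v.1 • D ((1, 0), p) + v.2 • D ((0, 1), p') := by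
  rw [← map_smul, ← map_smul, ← map_add]
  congr 1
  ext <;> simp

/-- The value u_xx = -i p - k is dictated by the source equation, so the test jet solves it and its
image must solve the target equation. The values p = u_t, p' = u_x and α = u_tt stay arbitrary. -/
theorem jetRel_of_mapsEquation {φ : Vars → Vars} {S S' : Vars → ℂ} {w : Vars}
    (hφ : ContDiffAt ℝ 2 φ w)
    (hM : ∀ u u' : ℝ × ℝ → ℂ, ContDiffAt ℝ 2 u w.1 → ContDiffAt ℝ 2 u' (φ w).1 → u w.1 = w.2 →
      (∀ᶠ q in 𝓝 w.1, (φ (q, u q)).2 = u' (φ (q, u q)).1) →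
      (SolvesAt S u w.1 ↔ SolvesAt S' u' (φ w).1)) :
    JetRel (fderiv ℝ φ w) (fderiv ℝ (fderiv ℝ φ) w) (S w * w.2) (S' (φ w) * (φ w).2) := by
  intro p p' α L δ hdet h1 h2 hδ Y hY
  set D := fderiv ℝ φ w with hD
  let P : ℝ × ℝ →L[ℝ] ℂ := (ContinuousLinearMap.fst ℝ ℝ ℝ).smulRight p
    + (ContinuousLinearMap.snd ℝ ℝ ℝ).smulRight p'
  have hP : ∀ v, P v = v.1 • p + v.2 • p' := fun v => by simp [P]
  have hDP : ∀ v, D (v, P v) = v.1 • D ((1, 0), p) + v.2 • D ((0, 1), p') := by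
    intro v; rw [hP]; exact map_graph_eq D p p' v
  refine (jet_iff hφ hM P L α (-(Complex.I * p) - S w * w.2) δ ?_ ?_ ?_ Y ?_).1 ?_
  · rw [← hD]
    have : (fun v => (D (v, P v)).1) = ((ContinuousLinearMap.fst ℝ (ℝ × ℝ) ℂ).comp
        (D.comp ((ContinuousLinearMap.id ℝ (ℝ × ℝ)).prod P))).toLinearMap := rfl
    rw [this]
    have hinj : Function.Injective ((ContinuousLinearMap.fst ℝ (ℝ × ℝ) ℂ).comp
        (D.comp ((ContinuousLinearMap.id ℝ (ℝ × ℝ)).prod P))).toLinearMap := by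
      rw [← LinearMap.ker_eq_bot, LinearMap.ker_eq_bot']
      intro v hv
      have hv' : (D (v, P v)).1 = 0 := hv
      rw [hDP] at hv'
      have e1 := congrArg Prod.fst hv'
      have e2 := congrArg Prod.snd hv'
      simp at e1 e2
      ext
      · have : v.1 * ((D ((1, 0), p)).1.1 * (D ((0, 1), p')).1.2
            - (D ((0, 1), p')).1.1 * (D ((1, 0), p)).1.2) = 0 := by
          linear_combination (D ((0, 1), p')).1.2 * e1 - (D ((0, 1), p')).1.1 * e2
        simpa [hdet] using this
      · have : v.2 * ((D ((1, 0), p)).1.1 * (D ((0, 1), p')).1.2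
            - (D ((0, 1), p')).1.1 * (D ((1, 0), p)).1.2) = 0 := by
          linear_combination -(D ((1, 0), p)).1.2 * e1 + (D ((1, 0), p)).1.1 * e2
        simpa [hdet] using this
    exact ⟨hinj, LinearMap.injective_iff_surjective.1 hinj⟩
  · intro v
    rw [← hD, hDP]
    simp [h1, h2]
  · rw [← hD, hDP]
    exact hδ
  · rw [hP, hY]
  · rw [hP]; simp; ring

section
variable {D : Vars →L[ℝ] Vars} {H : Vars →L[ℝ] Vars →L[ℝ] Vars} {k k' : ℂ}

/-- A linear map with given values at two independent vectors. -/
theorem exists_linear_of_det_ne_zero {a b : ℝ × ℝ} (h : a.1 * b.2 - b.1 * a.2 ≠ 0) (c d : ℂ) :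
    ∃ L : ℝ × ℝ →L[ℝ] ℂ, L a = c ∧ L b = d := by
  set Δ := a.1 * b.2 - b.1 * a.2 with hΔ
  refine ⟨(ContinuousLinearMap.fst ℝ ℝ ℝ).smulRight ((b.2 / Δ) • c - (a.2 / Δ) • d)
    + (ContinuousLinearMap.snd ℝ ℝ ℝ).smulRight (-(b.1 / Δ) • c + (a.1 / Δ) • d), ?_, ?_⟩
  · have h1 : a.1 * (b.2 / Δ) - a.2 * (b.1 / Δ) = 1 := by field_simp; rw [hΔ]; ring
    have h2 : -(a.1 * (a.2 / Δ)) + a.2 * (a.1 / Δ) = 0 := by ring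
    calc _ = (a.1 * (b.2 / Δ) - a.2 * (b.1 / Δ)) • c
          + (-(a.1 * (a.2 / Δ)) + a.2 * (a.1 / Δ)) • d := by simp; ring
      _ = c := by rw [h1, h2]; simp
  · have h1 : b.1 * (b.2 / Δ) - b.2 * (b.1 / Δ) = 0 := by ring
    have h2 : -(b.1 * (a.2 / Δ)) + b.2 * (a.1 / Δ) = 1 := by field_simp; rw [hΔ]; ring
    calc _ = (b.1 * (b.2 / Δ) - b.2 * (b.1 / Δ)) • c
          + (-(b.1 * (a.2 / Δ)) + b.2 * (a.1 / Δ)) • d := by simp; ring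
      _ = d := by rw [h1, h2]; simp

theorem map_eq_add (D : Vars →L[ℝ] Vars) (a b : ℝ) (h : ℂ) :
    D ((a, b), h) = a • D ((1, 0), 0) + b • D ((0, 1), 0) + D (0, h) := by
  rw [← map_smul, ← map_smul, ← map_add, ← map_add]
  congr 1
  ext <;> simp

/-- The hypothesis `h0` places the image of the vertical vector in the graph of `L`, which is the
image of the tangent plane of the graph of `u`. By injectivity the vertical vector is itself tangent
to a graph, hence zero. -/
theorem eq_zero_of_normal_eq_zero (hD : Function.Injective D) {p p' h : ℂ}
    {L : ℝ × ℝ →L[ℝ] ℂ}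
    (hdet : (D ((1, 0), p)).1.1 * (D ((0, 1), p')).1.2
      - (D ((0, 1), p')).1.1 * (D ((1, 0), p)).1.2 ≠ 0)
    (h1 : L (D ((1, 0), p)).1 = (D ((1, 0), p)).2) (h2 : L (D ((0, 1), p')).1 = (D ((0, 1), p')).2)
    (h0 : (D (0, h)).2 - L (D (0, h)).1 = 0) : h = 0 := by
  set a := D ((1, 0), p)
  set b := D ((0, 1), p')
  set Δ := a.1.1 * b.1.2 - b.1.1 * a.1.2 with hΔ
  set m := (D (0, h)).1 with hm
  let v : ℝ × ℝ := ((m.1 * b.1.2 - m.2 * b.1.1) / Δ, (m.2 * a.1.1 - m.1 * a.1.2) / Δ)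
  have hv : D (v, v.1 • p + v.2 • p') = D (0, h) := by
    rw [map_graph_eq]
    have e1 : (v.1 • a + v.2 • b).1 = m := by
      ext
      · simp [v]; field_simp; rw [hΔ]; ring
      · simp [v]; field_simp; rw [hΔ]; ring
    refine Prod.ext e1 ?_
    rw [sub_eq_zero.1 h0, ← e1]
    simp [a, b, h1, h2]
  have h3 := hD hv
  have h4 : v = 0 := congrArg Prod.fst h3
  have h5 := congrArg Prod.snd h3
  rw [h4] at h5
  simpa using h5.symm

/-- The target equation contains α multiplied by δ.1², and the normal component of a vertical vector
is nonzero, so δ.1 = 0 for every transversal jet. If no choice of p is transversal, the image of `D`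
lies in a hyperplane, which surjectivity excludes. -/
theorem JetRel.time_apply_eq_zero (hD : Function.Bijective D) (hJ : JetRel D H k k') (p' : ℂ) :
    (D ((0, 1), p')).1.1 = 0 := by
  by_contra hne
  have hzero : ∀ p, (D ((1, 0), p)).1.1 * (D ((0, 1), p')).1.2
      - (D ((0, 1), p')).1.1 * (D ((1, 0), p)).1.2 = 0 := by
    intro p
    by_contra hdet
    obtain ⟨L, h1, h2⟩ := exists_linear_of_det_ne_zero hdet (D ((1, 0), p)).2 (D ((0, 1), p')).2
    set a := D ((1, 0), p)
    set b := D ((0, 1), p')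
    set Δ := a.1.1 * b.1.2 - b.1.1 * a.1.2 with hΔ
    have hδ : (-b.1.1 / Δ, a.1.1 / Δ).1 • a.1 + (-b.1.1 / Δ, a.1.1 / Δ).2 • b.1
        = ((0 : ℝ), (1 : ℝ)) := by
      ext
      · simp; ring
      · simp; field_simp; rw [hΔ]; ring
    have r0 := hJ p p' 0 L _ hdet h1 h2 hδ _ rfl
    have r1 := hJ p p' 1 L _ hdet h1 h2 hδ _ rfl
    -- The relations for α = 0 and α = 1 differ exactly by the normal component of this vertical
    -- vector.
    have key : ((1 : ℂ) * ((-b.1.1 / Δ : ℝ) : ℂ) ^ 2) = 0 := by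
      refine eq_zero_of_normal_eq_zero hD.1 hdet h1 h2 ?_
      have e : ∀ x y : ℂ, D ((0 : ℝ × ℝ), x + y) = D (0, x) + D (0, y) := by
        intro x y; rw [← map_add]; simp
      rw [e] at r0 r1
      simp only [zero_mul] at r0
      have e0 : D ((0 : ℝ × ℝ), (0 : ℂ)) = 0 := map_zero D
      rw [e0] at r0
      simp only [Prod.fst_add, Prod.snd_add, map_add, zero_add] at r0 r1
      linear_combination r1 - r0
    have : -b.1.1 / Δ = 0 := by simpa using key
    rw [div_eq_zero_iff] at this
    rcases this with h | h
    · exact hne (by simpa using h)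
    · exact hdet h
  -- For a preimage of this rotated vector, the expression shown to vanish identically becomes minus
  -- a sum of two squares, one of them nonzero.
  obtain ⟨z, hz⟩ := hD.2 ((-(D ((0, 1), p')).1.2, (D ((0, 1), p')).1.1), 0)
  have hz0 := hzero 0
  have hfun : ∀ z : Vars, (D z).1.1 * (D ((0, 1), p')).1.2
      - (D ((0, 1), p')).1.1 * (D z).1.2 = 0 := by
    have hψ : ∀ h, (D (0, h)).1.1 * (D ((0, 1), p')).1.2
      - (D ((0, 1), p')).1.1 * (D (0, h)).1.2 = 0 := by
      intro h
      have := hzero h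
      rw [map_eq_add D 1 0 h] at this
      simp only [Prod.fst_add, Prod.snd_add, Prod.smul_fst, Prod.smul_snd, smul_eq_mul] at this
      linear_combination this - hz0
    rintro ⟨⟨a, b⟩, h⟩
    have h1 := hψ p'
    have h2 := hψ h
    have e : D ((a, b), h) = a • D ((1, 0), 0) + b • (D ((0, 1), p') - D (0, p')) + D (0, h) := by
      rw [map_eq_add D a b h, map_eq_add D 0 1 p']; simp
    rw [e]
    simp only [Prod.fst_add, Prod.snd_add, Prod.smul_fst, Prod.smul_snd, smul_eq_mul,
      Prod.fst_sub, Prod.snd_sub]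
    linear_combination a * hz0 - b * h1 + h2
  have := hfun z
  rw [hz] at this
  simp at this
  nlinarith [sq_nonneg (D ((0, 1), p')).1.2, sq_pos_of_ne_zero hne]

/-- With `M` the normal component of the image of a vertical vector, the coefficient of p = u_t in
the relation reads i M(p)/T_t = M(ip)/x̃_x², where x̃_x is a total derivative. Taking p = 1 and p =
i gives x̃_x⁴ = T_t². The total derivative is affine in u_x, so it cannot depend on u_x; then M(ip)
= ± i M(p) with the sign of T_t. -/
theorem JetRel.space_apply (hD : Function.Bijective D) (hJ : JetRel D H k k')
    (hH : ∀ v : Vars, v.1.1 = 0 → (H v v).1.1 = 0) :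
    (D ((1, 0), 0)).1.1 ≠ 0 ∧ (D ((0, 1), 0)).1.2 ^ 2 = |(D ((1, 0), 0)).1.1| ∧
    (∀ h, (D (0, h)).1 = 0) ∧
    (∀ h, (D (0, Complex.I * h)).2
      = (Real.sign (D ((1, 0), 0)).1.1 : ℂ) * Complex.I * (D (0, h)).2) := by
  have hT2 := hJ.time_apply_eq_zero hD
  have hTψ : ∀ h, (D (0, h)).1.1 = 0 := by
    intro h
    have h1 := hT2 h
    rw [map_eq_add D 0 1 h] at h1
    simpa [hT2 0] using h1
  have hTp : ∀ p, (D ((1, 0), p)).1.1 = (D ((1, 0), 0)).1.1 := by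
    intro p
    rw [map_eq_add D 1 0 p]; simp [hTψ]
  set T1 := (D ((1, 0), 0)).1.1 with hT1
  have hT1ne : T1 ≠ 0 := by
    intro h0
    obtain ⟨⟨⟨a, b⟩, h⟩, hz⟩ := hD.2 ((1, 0), 0)
    have := congrArg (fun y : Vars => y.1.1) hz
    simp only at this
    rw [map_eq_add D a b h] at this
    simp [hT2 0, hTψ, ← hT1, h0] at this
  -- the transversal case
  have main : ∀ p', (D ((0, 1), p')).1.2 ≠ 0 → ∃ M : ℂ →L[ℝ] ℂ, M 1 ≠ 0 ∧
      (∀ h, M h = (D (0, h)).2 - ((D (0, h)).1.2 / (D ((0, 1), p')).1.2) • (D ((0, 1), p')).2) ∧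
      ∀ p, Complex.I * M p / T1 = M (Complex.I * p) / ((D ((0, 1), p')).1.2 : ℂ) ^ 2 := by
    intro p' hX
    set X2 := (D ((0, 1), p')).1.2 with hX2
    let M : ℂ →L[ℝ] ℂ := ((ContinuousLinearMap.snd ℝ (ℝ × ℝ) ℂ).comp D).comp
        (ContinuousLinearMap.inr ℝ (ℝ × ℝ) ℂ)
      - ((((ContinuousLinearMap.snd ℝ ℝ ℝ).comp (ContinuousLinearMap.fst ℝ (ℝ × ℝ) ℂ)).comp D).comp
        (ContinuousLinearMap.inr ℝ (ℝ × ℝ) ℂ)).smulRight (X2⁻¹ • (D ((0, 1), p')).2)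
    have hM : ∀ h, M h = (D (0, h)).2
        - ((D (0, h)).1.2 / X2) • (D ((0, 1), p')).2 := by
      intro h; simp [M, div_eq_mul_inv, mul_assoc]
    have hdet : ∀ p, (D ((1, 0), p)).1.1 * (D ((0, 1), p')).1.2
      - (D ((0, 1), p')).1.1 * (D ((1, 0), p)).1.2 ≠ 0 := by
      intro p
      rw [hTp, hT2, ← hX2]; simp [hT1ne, hX]
    have hL2 : ∀ L : ℝ × ℝ →L[ℝ] ℂ, L (D ((0, 1), p')).1 = (D ((0, 1), p')).2 →
        L (0, 1) = X2⁻¹ • (D ((0, 1), p')).2 := by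
      intro L h2
      rw [← h2, ← map_smul]
      congr 1
      ext
      · simp [hT2]
      · simp [← hX2, hX]
    have hLM : ∀ L : ℝ × ℝ →L[ℝ] ℂ, L (D ((0, 1), p')).1 = (D ((0, 1), p')).2 →
        ∀ h, (D (0, h)).2 - L (D (0, h)).1 = M h := by
      intro L h2 h
      have : (D (0, h)).1 = (D (0, h)).1.2 • ((0 : ℝ), (1 : ℝ)) := by
        ext
        · simp [hTψ]
        · simp
      rw [hM, this, map_smul, hL2 L h2]
      simp [div_eq_mul_inv, mul_assoc]
    have hδ : ∀ p, ((0 : ℝ), X2⁻¹).1 • (D ((1, 0), p)).1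
        + ((0 : ℝ), X2⁻¹).2 • (D ((0, 1), p')).1 = ((0 : ℝ), (1 : ℝ)) := by
      intro p
      ext
      · simp [hT2]
      · simp [← hX2, hX]
    refine ⟨M, ?_, hM, ?_⟩
    · intro h0
      obtain ⟨L, h1, h2⟩ := exists_linear_of_det_ne_zero (hdet 0) (D ((1, 0), 0)).2
        (D ((0, 1), p')).2
      have := eq_zero_of_normal_eq_zero hD.1 (hdet 0) h1 h2 (h := 1) (by rw [hLM L h2, h0])
      exact one_ne_zero this
    · intro p
      obtain ⟨L, h1, h2⟩ := exists_linear_of_det_ne_zero (hdet p) (D ((1, 0), p)).2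
        (D ((0, 1), p')).2
      obtain ⟨L0, h10, h20⟩ := exists_linear_of_det_ne_zero (hdet 0) (D ((1, 0), 0)).2
        (D ((0, 1), p')).2
      -- Subtracting the relation for p = 0 isolates the terms linear in p; by `hH` the
      -- second-derivative term is the same in both.
      have r := hJ p p' 0 L _ (hdet p) h1 h2 (hδ p) _ rfl
      have r0 := hJ 0 p' 0 L0 _ (hdet 0) h10 h20 (hδ 0) _ rfl
      have hLs : ∀ L' : ℝ × ℝ →L[ℝ] ℂ, ∀ m : ℝ × ℝ, L' m = m.1 • L' (1, 0) + m.2 • L' (0, 1) := by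
        intro L' m
        rw [← map_smul, ← map_smul, ← map_add]; congr 1; ext <;> simp
      simp only [Prod.fst_add, Prod.snd_add, map_add, zero_smul, zero_add] at r r0
      set Q := H ((0, X2⁻¹), X2⁻¹ • p') ((0, X2⁻¹), X2⁻¹ • p') with hQ
      have hQ1 : Q.1 = Q.1.2 • ((0 : ℝ), (1 : ℝ)) := by
        ext
        · simp [hQ, hH]
        · simp
      have hQL : L Q.1 = L0 Q.1 := by
        rw [hQ1, map_smul, map_smul, hL2 L h2, hL2 L0 h20]
      rw [hQL] at r
      have d : ∀ c : ℂ, (0 : ℂ) * (((0 : ℝ) : ℂ)) ^ 2 + c * ((X2⁻¹ : ℝ) : ℂ) ^ 2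
          = (X2⁻¹ ^ 2) • c := by intro c; simp; ring
      rw [d] at r r0
      have r' := hLM L h2 ((X2⁻¹ ^ 2) • (-(Complex.I * p) - k))
      have r0' := hLM L0 h20 ((X2⁻¹ ^ 2) • (-(Complex.I * 0) - k))
      rw [map_smul] at r' r0'
      have e1 : L (1, 0) - L0 (1, 0) = (T1⁻¹) • M p := by
        have f1 := h1
        have f0 := h10
        rw [hLs, hTp, hL2 L h2] at f1
        rw [hLs, hTp, hL2 L0 h20] at f0
        have g1 : (D ((1, 0), p)) = D ((1, 0), 0) + D (0, p) := by
          rw [map_eq_add D 1 0 p, map_eq_add D 1 0 0]; simp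
        rw [g1] at f1
        have : T1 • (L (1, 0) - L0 (1, 0)) = M p := by
          rw [hM]
          simp only [Prod.fst_add, Prod.snd_add] at f1
          simp only [Complex.real_smul] at f1 f0 ⊢
          push_cast at f1 f0 ⊢
          linear_combination f1 - f0
        rw [← this, smul_smul, inv_mul_cancel₀ hT1ne, one_smul]
      have e2 : M (-(Complex.I * p) - k) = -M (Complex.I * p) + M (-(Complex.I * 0) - k) := by
        rw [← map_neg, ← map_add]; congr 1; ring
      rw [e2] at r'
      rw [Complex.real_smul (z := M (-(Complex.I * 0) - k))] at r0'
      rw [Complex.real_smul (z := -M (Complex.I * p) + M (-(Complex.I * 0) - k))] at r'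
      rw [Complex.real_smul] at e1
      simp only [Complex.ofReal_pow, Complex.ofReal_inv] at r' r0' e1
      have : Complex.I * M p * (T1 : ℂ)⁻¹ = M (Complex.I * p) * ((X2 : ℂ)⁻¹) ^ 2 := by
        linear_combination r - r0 - r' + r0' - Complex.I * e1
      rw [div_eq_mul_inv, this, div_eq_mul_inv, inv_pow]
  have hsq : ∀ p', (D ((0, 1), p')).1.2 ≠ 0 → (D ((0, 1), p')).1.2 ^ 2 = |T1| := by
    intro p' hX
    obtain ⟨M, hM1, -, hM⟩ := main p' hX
    set X2 := (D ((0, 1), p')).1.2 with hX2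
    have a1 := hM 1
    have a2 := hM Complex.I
    have hX' : (X2 : ℂ) ≠ 0 := by exact_mod_cast hX
    have hT' : (T1 : ℂ) ≠ 0 := by exact_mod_cast hT1ne
    rw [mul_one] at a1
    rw [Complex.I_mul_I, map_neg] at a2
    field_simp at a1 a2
    -- Elimination of M(i) from the relations for p = 1 and p = i.
    have : M 1 * (((X2 : ℂ) ^ 2) ^ 2 - (T1 : ℂ) ^ 2) = 0 := by
      have hI := Complex.I_sq
      linear_combination (-Complex.I) * (X2 : ℂ) ^ 2 * a1 - (T1 : ℂ) * a2 + M 1 * (X2 : ℂ) ^ 4 * hI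
    have h3 := (mul_eq_zero.1 this).resolve_left hM1
    have h4 : (X2 ^ 2) ^ 2 = T1 ^ 2 := by exact_mod_cast sub_eq_zero.1 h3
    have := sq_eq_sq_iff_abs_eq_abs _ _ |>.1 h4
    rwa [abs_of_nonneg (sq_nonneg X2)] at this
  have hXs : ∀ (s : ℝ) p', (D ((0, 1), s • p')).1.2
      = (D ((0, 1), 0)).1.2 + s * (D (0, p')).1.2 := by
    intro s p'
    have : D (0, s • p') = s • D (0, p') := by rw [← map_smul]; simp
    rw [map_eq_add D 0 1 (s • p'), this]
    simp
  have hXψ : ∀ p', (D (0, p')).1.2 = 0 := by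
    intro p'
    by_contra hne
    set l := (D (0, p')).1.2
    set x0 := (D ((0, 1), 0)).1.2
    have hTpos : 0 < |T1| := abs_pos.2 hT1ne
    have hb : ∀ y : ℝ, y ≠ 0 → y ^ 2 = |T1| := by
      intro y hy
      have e := hXs ((y - x0) / l) p'
      rw [div_mul_cancel₀ _ hne] at e
      have e' : (D ((0, 1), ((y - x0) / l) • p')).1.2 = y := by rw [e]; ring
      have := hsq (((y - x0) / l) • p') (by rw [e']; exact hy)
      rwa [e'] at this
    -- A nonconstant affine function would take both values 1 and 2, whose squares cannot both equal
    -- |T_t|.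
    have := hb 1 one_ne_zero
    have := hb 2 two_ne_zero
    linarith
  have hX0 : (D ((0, 1), 0)).1.2 ≠ 0 := by
    intro h0
    obtain ⟨⟨⟨a, b⟩, h⟩, hz⟩ := hD.2 ((0, 1), 0)
    rw [map_eq_add D a b h] at hz
    have e1 := congrArg (fun y : Vars => y.1.1) hz
    have e2 := congrArg (fun y : Vars => y.1.2) hz
    simp [hT2 0, hTψ, ← hT1, hT1ne] at e1
    simp [e1, hXψ, h0] at e2
  refine ⟨hT1ne, hsq 0 hX0, fun h => Prod.ext (hTψ h) (hXψ h), fun h => ?_⟩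
  obtain ⟨M, -, hM, hM'⟩ := main 0 hX0
  have e := hM' h
  have e3 : ((D ((0, 1), 0)).1.2 : ℂ) ^ 2 = (|T1| : ℝ) := by exact_mod_cast hsq 0 hX0
  rw [e3, hM, hM, hXψ, hXψ] at e
  have hT' : (T1 : ℂ) ≠ 0 := by exact_mod_cast hT1ne
  simp only [zero_div, zero_smul, sub_zero] at e
  rcases lt_or_gt_of_ne hT1ne with hn | hp
  · rw [abs_of_neg hn] at e
    rw [Real.sign_of_neg hn]
    push_cast at e ⊢
    field_simp at e
    linear_combination e
  · rw [abs_of_pos hp] at e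
    rw [Real.sign_of_pos hp]
    push_cast at e ⊢
    field_simp at e
    linear_combination -e

/-- With p = 0 the relation is a quadratic polynomial in p' = u_x that vanishes identically; the
three conclusions are its coefficients of degree two, one and zero. -/
theorem JetRel.psi_apply (hD : Function.Bijective D) (hJ : JetRel D H k k')
    (hH : ∀ v : Vars, v.1.1 = 0 → (H v v).1.1 = 0)
    (hH' : ∀ p', (H ((0, 1), p') ((0, 1), p')).1.2 = 0) (hsymm : ∀ v w, H v w = H w v) :
    (∀ h, (H (0, h) (0, h)).2 = 0) ∧
    (∀ h, 2 * (H ((0, 1), 0) (0, h)).2 = Complex.I *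
      ((D ((0, 1), 0)).1.2 * (D ((1, 0), 0)).1.2 / (D ((1, 0), 0)).1.1 : ℝ) * (D (0, h)).2) ∧
    Complex.I * ((D ((1, 0), 0)).2
        - ((D ((1, 0), 0)).1.2 / (D ((0, 1), 0)).1.2 : ℝ) * (D ((0, 1), 0)).2)
          / (D ((1, 0), 0)).1.1
      + ((H ((0, 1), 0) ((0, 1), 0)).2 - (D (0, k)).2) / (|(D ((1, 0), 0)).1.1| : ℝ) + k' = 0 := by
  have hT2 := hJ.time_apply_eq_zero hD
  obtain ⟨hT1, hsq, hψ, -⟩ := hJ.space_apply hD hH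
  set T1 := (D ((1, 0), 0)).1.1
  set X1 := (D ((1, 0), 0)).1.2
  set X2 := (D ((0, 1), 0)).1.2 with hX2
  have hX : X2 ≠ 0 := by
    intro h0; rw [h0] at hsq; simp at hsq; exact hT1 (by simpa using hsq.symm)
  have hD2 : ∀ p', D ((0, 1), p') = D ((0, 1), 0) + D (0, p') := by
    intro p'; rw [map_eq_add D 0 1 p', map_eq_add D 0 1 0]; simp
  have rel : ∀ p', Complex.I * ((D ((1, 0), 0)).2
        - ((X1 / X2 : ℝ) : ℂ) * (D ((0, 1), p')).2) / T1
      + ((H ((0, 1), p') ((0, 1), p')).2 - (D (0, k)).2) / (|T1| : ℝ) + k' = 0 := by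
    intro p'
    have hXp : (D ((0, 1), p')).1.2 = X2 := by rw [hD2]; simp [hψ, ← hX2]
    have hdet : (D ((1, 0), 0)).1.1 * (D ((0, 1), p')).1.2
      - (D ((0, 1), p')).1.1 * (D ((1, 0), 0)).1.2 ≠ 0 := by
      rw [hT2, hXp]; simp [hX]; exact hT1
    obtain ⟨L, h1, h2⟩ := exists_linear_of_det_ne_zero hdet (D ((1, 0), 0)).2 (D ((0, 1), p')).2
    have hδ : ((0 : ℝ), X2⁻¹).1 • (D ((1, 0), 0)).1
        + ((0 : ℝ), X2⁻¹).2 • (D ((0, 1), p')).1 = ((0 : ℝ), (1 : ℝ)) := by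
      ext
      · simp [hT2]
      · simp [hXp, hX]
    have r := hJ 0 p' 0 L _ hdet h1 h2 hδ _ rfl
    have hL2 : L (0, 1) = X2⁻¹ • (D ((0, 1), p')).2 := by
      rw [← h2, ← map_smul]
      congr 1
      ext
      · simp [hT2]
      · simp [hXp, hX]
    have hLs : L (D ((1, 0), 0)).1 = T1 • L (1, 0) + X1 • L (0, 1) := by
      rw [← map_smul, ← map_smul, ← map_add]; congr 1; ext <;> simp [T1, X1]
    rw [hLs, hL2] at h1
    have hv : (((0 : ℝ), X2⁻¹), ((0 : ℝ), X2⁻¹).1 • (0 : ℂ) + ((0 : ℝ), X2⁻¹).2 • p')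
        = X2⁻¹ • (((0 : ℝ), (1 : ℝ)), p') := by ext <;> simp
    have hQ1 : (H ((0, 1), p') ((0, 1), p')).1 = 0 := Prod.ext (hH _ rfl) (hH' p')
    have d : (0 : ℂ) * ((((0 : ℝ), X2⁻¹).1 : ℝ) : ℂ) ^ 2
        + (-(Complex.I * 0) - k) * ((((0 : ℝ), X2⁻¹).2 : ℝ) : ℂ) ^ 2
          = (-(X2⁻¹ ^ 2)) • k := by simp; ring
    have hDs : D (0, (-(X2⁻¹ ^ 2)) • k) = (-(X2⁻¹ ^ 2)) • D (0, k) := by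
      rw [← map_smul]; simp
    rw [hv, d, hDs, map_smul, map_smul] at r
    simp only [smul_apply, Prod.fst_add, Prod.smul_fst, hQ1, hψ, smul_zero,
      add_zero, map_zero, sub_zero, Prod.snd_add, Prod.smul_snd, Complex.real_smul] at r h1
    have hT' : (T1 : ℂ) ≠ 0 := by exact_mod_cast hT1
    have hX' : (X2 : ℂ) ≠ 0 := by exact_mod_cast hX
    have e1 : L (1, 0) = ((D ((1, 0), 0)).2
        - ((X1 / X2 : ℝ) : ℂ) * (D ((0, 1), p')).2) / T1 := by
      rw [eq_div_iff hT']
      push_cast at h1 ⊢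
      rw [← h1]; field_simp; ring
    rw [e1] at r
    rw [← hsq]
    refine Eq.trans ?_ r
    push_cast
    field_simp
    ring
  have hHexp : ∀ (s : ℝ) h, (H ((0, 1), s • h) ((0, 1), s • h)).2
      = (H ((0, 1), 0) ((0, 1), 0)).2 + (s : ℂ) * (2 * (H ((0, 1), 0) (0, h)).2)
        + (s : ℂ) ^ 2 * (H (0, h) (0, h)).2 := by
    intro s h
    have : (((0 : ℝ), (1 : ℝ)), s • h) = (((0 : ℝ), (1 : ℝ)), (0 : ℂ)) + s • ((0 : ℝ × ℝ), h) := by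
      ext <;> simp
    rw [this]
    simp only [map_add, map_smul, add_apply, smul_apply,
      hsymm (0, h) ((0, 1), 0), Prod.snd_add, Prod.smul_snd, Complex.real_smul]
    ring
  have hDexp : ∀ (s : ℝ) h, (D ((0, 1), s • h)).2 = (D ((0, 1), 0)).2 + s * (D (0, h)).2 := by
    intro s h
    have : D (0, s • h) = s • D (0, h) := by rw [← map_smul]; simp
    rw [hD2, this]; simp
  have hT' : (T1 : ℂ) ≠ 0 := by exact_mod_cast hT1
  have hX' : (X2 : ℂ) ≠ 0 := by exact_mod_cast hX
  have hA : ((|T1| : ℝ) : ℂ) ≠ 0 := by exact_mod_cast (abs_pos.2 hT1).ne'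
  have hrel : ∀ (h : ℂ), (H (0, h) (0, h)).2 = 0 ∧ 2 * (H ((0, 1), 0) (0, h)).2 = Complex.I *
      ((X2 * X1 / T1 : ℝ) : ℂ) * (D (0, h)).2 := by
    intro h
    -- The values 0, 1, -1 of the real factor separate the even and odd parts of the polynomial.
    have r0 := rel ((0 : ℝ) • h)
    have r1 := rel ((1 : ℝ) • h)
    have r2 := rel ((-1 : ℝ) • h)
    rw [hHexp, hDexp] at r0 r1 r2
    push_cast at r0 r1 r2
    constructor
    · have : (H (0, h) (0, h)).2 / ((|T1| : ℝ) : ℂ) = 0 := by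
        linear_combination (1 / 2) * r1 + (1 / 2) * r2 - r0
      simpa [hA] using this
    · have e : 2 * (H ((0, 1), 0) (0, h)).2 / ((|T1| : ℝ) : ℂ)
          = Complex.I * ((X1 : ℂ) / X2) / T1 * (D (0, h)).2 := by
        linear_combination (1 / 2) * r1 - (1 / 2) * r2
      rw [div_eq_iff hA, ← hsq] at e
      rw [e]
      push_cast
      field_simp
  exact ⟨fun h => (hrel h).1, fun h => (hrel h).2, rel 0⟩

end
end NSE

/-! ### Vanishing of the shift of ψ, and the determining equations near a point -/

namespace NSE

section
variable {r : WithTop ℕ∞}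

theorem add_one_le_of_smooth (hr : r = ∞ ∨ r = ω) : r + 1 ≤ r := by
  rcases hr with rfl | rfl <;> simp

theorem two_le_of_smooth (hr : r = ∞ ∨ r = ω) : 2 ≤ r := by
  rcases hr with rfl | rfl
  · exact WithTop.coe_le_coe.2 (le_top : (2 : ℕ∞) ≤ ⊤)
  · exact le_top

theorem ne_zero_of_smooth (hr : r = ∞ ∨ r = ω) : r ≠ 0 := by
  rcases hr with rfl | rfl <;> simp

theorem PointTransf.contDiffAt {E : Type} [NormedAddCommGroup E] [NormedSpace ℝ E]
    (φ : PointTransf r E) {z : E} (hz : z ∈ φ.toHomeo.source) : ContDiffAt ℝ r φ.toHomeo z :=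
  φ.contDiffOn.contDiffAt (φ.toHomeo.open_source.mem_nhds hz)

theorem PointTransf.contDiffAt_symm {E : Type} [NormedAddCommGroup E] [NormedSpace ℝ E]
    (φ : PointTransf r E) {z : E} (hz : z ∈ φ.toHomeo.target) :
    ContDiffAt ℝ r φ.toHomeo.symm z :=
  φ.contDiffOn_symm.contDiffAt (φ.toHomeo.open_target.mem_nhds hz)

theorem PointTransf.bijective_fderiv (hr : r = ∞ ∨ r = ω) {E : Type} [NormedAddCommGroup E]
    [NormedSpace ℝ E] (φ : PointTransf r E) {z : E} (hz : z ∈ φ.toHomeo.source) :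
    Function.Bijective (fderiv ℝ φ.toHomeo z) := by
  have h1 := ((φ.contDiffAt hz).differentiableAt (ne_zero_of_smooth hr)).hasFDerivAt
  have hz' := φ.toHomeo.map_source hz
  have h2 := ((φ.contDiffAt_symm hz').differentiableAt (ne_zero_of_smooth hr)).hasFDerivAt
  have h3 : HasFDerivAt (fun y => φ.toHomeo.symm (φ.toHomeo y)) _ z := h2.comp z h1
  have h4 : HasFDerivAt (fun y => φ.toHomeo.symm (φ.toHomeo y)) (ContinuousLinearMap.id ℝ E) z :=
    (hasFDerivAt_id z).congr_of_eventuallyEq (φ.toHomeo.eventually_left_inverse hz)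
  have e1 := h3.unique h4
  have h1' := h1
  rw [← φ.toHomeo.left_inv hz] at h1'
  have h5 : HasFDerivAt (fun y => φ.toHomeo (φ.toHomeo.symm y)) _ (φ.toHomeo z) :=
    HasFDerivAt.comp (φ.toHomeo z) h1' h2
  have h6 : HasFDerivAt (fun y => φ.toHomeo (φ.toHomeo.symm y)) (ContinuousLinearMap.id ℝ E)
      (φ.toHomeo z) :=
    (hasFDerivAt_id _).congr_of_eventuallyEq (φ.toHomeo.eventually_right_inverse hz')
  have e2 := h5.unique h6
  rw [φ.toHomeo.left_inv hz] at e2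
  refine Function.bijective_iff_has_inverse.2 ⟨fderiv ℝ φ.toHomeo.symm (φ.toHomeo z), ?_, ?_⟩
  · exact fun v => DFunLike.congr_fun e1 v
  · exact fun v => DFunLike.congr_fun e2 v

end

theorem hasDerivAt_norm {y : ℝ → ℂ} {y' : ℂ} {θ : ℝ} (hy : HasDerivAt y y' θ) (h0 : y θ ≠ 0) :
    HasDerivAt (fun s => ‖y s‖) ((conj (y θ) * y').re / ‖y θ‖) θ := by
  have h1 := hy.norm_sq
  have hp : 0 < ‖y θ‖ := norm_pos_iff.2 h0
  have h2 := h1.sqrt (by positivity)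
  simp only [Real.sqrt_sq (norm_nonneg _)] at h2
  convert h2 using 1
  rw [Complex.inner]
  field_simp

/-- If multiplication by functions of the moduli of `a y + C` and of `y` agree up to an affine
function, then `C = 0`. -/
theorem shift_eq_zero {a C y₀ k α β : ℂ} {f g : ℝ → ℂ} (ha : a ≠ 0) (hk : k ≠ 0) (hy₀ : y₀ ≠ 0)
    (hf : ∀ᶠ ρ in 𝓝 ‖y₀‖, DifferentiableAt ℝ f ρ) (hf' : deriv f ‖y₀‖ ≠ 0)
    (h : ∀ᶠ y in 𝓝 y₀, g ‖a * y + C‖ * (a * y + C) = k * f ‖y‖ * y + α * y + β) : C = 0 := by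
  set e := C / a with he
  have hC : C = a * e := by rw [he]; field_simp
  have key : ∀ᶠ y in 𝓝 y₀, Complex.I * β = k * (deriv f ‖y‖ *
      (((conj y * (Complex.I * e)).re / ‖y‖ : ℝ) : ℂ)) * y + (k * f ‖y‖ + α) * (Complex.I * e) := by
    have hne : ∀ᶠ y in 𝓝 y₀, y ≠ 0 := isOpen_ne.mem_nhds hy₀
    have hfd := continuous_norm.continuousAt.eventually hf
    filter_upwards [h.eventually_nhds, hne, hfd] with y hy hy0 hfy
    -- Rotation about the zero -e of a y + C keeps the argument of `g` fixed, so no regularity of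
    -- `g` is needed. Differentiating at θ = 0 and subtracting i times the original identity gives
    -- `key`.
    let c : ℝ → ℂ := fun θ => Complex.exp (θ * Complex.I) * (y + e) - e
    have hc0 : c 0 = y := by simp [c]
    have hcd : HasDerivAt c (Complex.I * (y + e)) 0 := by
      have h1 : HasDerivAt (fun θ : ℝ => Complex.exp (θ * Complex.I))
          (Complex.I) 0 := by
        have := ((Complex.ofRealCLM.hasDerivAt (x := (0 : ℝ))).mul_const Complex.I).cexp
        simpa using this
      exact (h1.mul_const (y + e)).sub_const e
    have hct : Tendsto c (𝓝 0) (𝓝 y) := by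
      have := hcd.continuousAt.tendsto
      rwa [hc0] at this
    have hL : HasDerivAt (fun θ => g ‖a * c θ + C‖ * (a * c θ + C))
        (Complex.I * (g ‖a * y + C‖ * (a * y + C))) 0 := by
      have e1 : ∀ θ, a * c θ + C = Complex.exp (θ * Complex.I) * (a * y + C) := by
        intro θ; simp only [c]; rw [hC]; ring
      have e2 : ∀ θ, ‖a * c θ + C‖ = ‖a * y + C‖ := by
        intro θ; rw [e1, norm_mul, Complex.norm_exp_ofReal_mul_I, one_mul]
      have h1 := ((hcd.const_mul a).add_const C).const_mul (g ‖a * y + C‖)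
      simp only [e2]
      refine h1.congr_deriv ?_
      rw [hC]; ring
    have hR : HasDerivAt (fun θ => k * f ‖c θ‖ * c θ + α * c θ + β)
        (k * (((conj (c 0) * (Complex.I * (y + e))).re / ‖c 0‖) • deriv f ‖y‖) * c 0
          + k * f ‖c 0‖ * (Complex.I * (y + e)) + α * (Complex.I * (y + e))) 0 := by
      have hn := hasDerivAt_norm hcd (by rwa [hc0])
      have hf1 : HasDerivAt f (deriv f ‖y‖) ‖c 0‖ := by rw [hc0]; exact hfy.hasDerivAt
      have h2 := HasDerivAt.scomp (0 : ℝ) hf1 hn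
      exact (((h2.const_mul k).mul hcd).add (hcd.const_mul α)).add_const β
    have heq := hL.unique (hR.congr_of_eventuallyEq (hct.eventually hy))
    have hyy := hy.self_of_nhds
    rw [hyy] at heq
    rw [hc0] at heq
    have e4 : (conj y * (Complex.I * (y + e))).re = (conj y * (Complex.I * e)).re := by
      simp; ring
    rw [e4] at heq
    simp only [Complex.real_smul] at heq
    linear_combination heq
  by_contra hCne
  have hene : e ≠ 0 := div_ne_zero hCne ha
  -- Now `key` is compared at two points of equal modulus, y₀ and its rotation about the origin by a
  -- small angle τ in (0, π).
  have hrot : Tendsto (fun τ : ℝ => Complex.exp (τ * Complex.I) * y₀) (𝓝 0) (𝓝 y₀) := by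
    have : ContinuousAt (fun τ : ℝ => Complex.exp (τ * Complex.I) * y₀) 0 := by fun_prop
    simpa [ContinuousAt] using this
  have h1 := (hrot.eventually key).filter_mono (nhdsWithin_le_nhds (s := Set.Ioi 0))
  have h2 : ∀ᶠ τ : ℝ in 𝓝[>] 0, τ < Real.pi :=
    (eventually_lt_nhds Real.pi_pos).filter_mono nhdsWithin_le_nhds
  obtain ⟨τ, hτ, hτπ, hτ0⟩ := (h1.and (h2.and self_mem_nhdsWithin)).exists
  have hτ0 : 0 < τ := hτ0
  have k0 := key.self_of_nhds
  set E := Complex.exp (τ * Complex.I) with hE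
  have hEn : ‖E‖ = 1 := Complex.norm_exp_ofReal_mul_I τ
  rw [norm_mul, hEn, one_mul] at hτ
  have hny : (‖y₀‖ : ℂ) ≠ 0 := by exact_mod_cast (norm_pos_iff.2 hy₀).ne'
  have hre : ∀ w : ℂ, 2 * ((w.re : ℝ) : ℂ) = w + conj w := fun w => by
    rw [Complex.add_conj]; push_cast; ring
  -- The terms with `f`, `α` and `β` depend only on the modulus and cancel.
  have h3 : k * deriv f ‖y₀‖ / ‖y₀‖ * ((2 * (((conj y₀ * (Complex.I * e)).re : ℝ) : ℂ)) * y₀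
      - (2 * (((conj (E * y₀) * (Complex.I * e)).re : ℝ) : ℂ)) * (E * y₀)) = 0 := by
    push_cast at k0 hτ ⊢
    linear_combination 2 * hτ - 2 * k0
  have h4 := (mul_eq_zero.1 h3).resolve_left (div_ne_zero (mul_ne_zero hk hf') hny)
  rw [hre, hre] at h4
  simp only [map_mul, Complex.conj_I, Complex.conj_conj] at h4
  have hEE : E * conj E = 1 := by rw [Complex.mul_conj, Complex.normSq_eq_norm_sq, hEn]; simp
  -- If e ≠ 0, this forces E² = 1, that is, τ is a multiple of π, contrary to its choice.
  have h5 : (E ^ 2 - 1) * (Complex.I * y₀ ^ 2 * conj e) = 0 := by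
    linear_combination h4 + Complex.I * y₀ * conj y₀ * e * hEE
  have h6 : Complex.I * y₀ ^ 2 * conj e ≠ 0 :=
    mul_ne_zero (mul_ne_zero Complex.I_ne_zero (pow_ne_zero 2 hy₀)) (by simpa using hene)
  have h7 : E ^ 2 = 1 := sub_eq_zero.1 ((mul_eq_zero.1 h5).resolve_right h6)
  rw [hE, ← Complex.exp_nat_mul, Complex.exp_eq_one_iff] at h7
  obtain ⟨n, hn⟩ := h7
  have h8 : τ = n * Real.pi := by
    have := congrArg Complex.im hn
    simp at this
    linarith
  rw [h8] at hτ0 hτπ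
  have a1 : (0 : ℝ) < n := by
    by_contra hle
    exact absurd (mul_nonpos_of_nonpos_of_nonneg (not_lt.1 hle) Real.pi_pos.le) (not_le.2 hτ0)
  have a2 : (n : ℝ) < 1 := by
    by_contra hle
    nlinarith [Real.pi_pos]
  have a3 : 0 < n := by exact_mod_cast a1
  have a4 : n < 1 := by exact_mod_cast a2
  omega

/-- The determining equations for point transformations between equations of the form
`i ψ_t + ψ_xx + S ψ = 0`, where `D` and `H` are the first and second derivatives of the
transformation. -/
structure DetEq (D : Vars →L[ℝ] Vars) (H : Vars →L[ℝ] Vars →L[ℝ] Vars) (k k' : ℂ) : Prop where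
  inj : Function.Injective D
  symm : ∀ v w, H v w = H w v
  time : ∀ v : Vars, v.1.1 = 0 → (D v).1.1 = 0
  time_ne : (D ((1, 0), 0)).1.1 ≠ 0
  space_sq : (D ((0, 1), 0)).1.2 ^ 2 = |(D ((1, 0), 0)).1.1|
  psi : ∀ h, (D (0, h)).1 = 0
  psi_I : ∀ h, (D (0, Complex.I * h)).2
      = (Real.sign (D ((1, 0), 0)).1.1 : ℂ) * Complex.I * (D (0, h)).2
  psi_psi : ∀ h, (H (0, h) (0, h)).2 = 0
  space_psi : ∀ h, 2 * (H ((0, 1), 0) (0, h)).2 = Complex.I *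
      ((D ((0, 1), 0)).1.2 * (D ((1, 0), 0)).1.2 / (D ((1, 0), 0)).1.1 : ℝ) * (D (0, h)).2
  rest : Complex.I * ((D ((1, 0), 0)).2
        - ((D ((1, 0), 0)).1.2 / (D ((0, 1), 0)).1.2 : ℝ) * (D ((0, 1), 0)).2)
          / (D ((1, 0), 0)).1.1
      + ((H ((0, 1), 0) ((0, 1), 0)).2 - (D (0, k)).2) / (|(D ((1, 0), 0)).1.1| : ℝ) + k' = 0

theorem fderiv_apply_const {E F G : Type*} [NormedAddCommGroup E] [NormedSpace ℝ E]
    [NormedAddCommGroup F] [NormedSpace ℝ F] [NormedAddCommGroup G] [NormedSpace ℝ G]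
    {g : E → F} {w : E} (hg : ContDiffAt ℝ 2 g w) (L : F →L[ℝ] G) (u v : E) :
    HasFDerivAt (fun y => L (fderiv ℝ g y u))
      ((L.comp (ContinuousLinearMap.apply ℝ F u)).comp (fderiv ℝ (fderiv ℝ g) w)) w ∧
    fderiv ℝ (fun y => L (fderiv ℝ g y u)) w v = L (fderiv ℝ (fderiv ℝ g) w v u) := by
  have h : HasFDerivAt (fun y => L (fderiv ℝ g y u))
      ((L.comp (ContinuousLinearMap.apply ℝ F u)).comp (fderiv ℝ (fderiv ℝ g) w)) w :=
    (L.comp (ContinuousLinearMap.apply ℝ F u)).hasFDerivAt.comp w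
      (differentiableAt_fderiv hg).hasFDerivAt
  exact ⟨h, by rw [h.fderiv]; rfl⟩

/-- The pointwise results are used in turn. That t̃ has no x- or ψ-derivative holds near `z`, so it
can be differentiated and supplies the hypothesis of `JetRel.space_apply`; the result for x̃, again
valid near `z`, is differentiated to supply that of `JetRel.psi_apply`. -/
theorem eventually_detEq {r : WithTop ℕ∞} (hr : r = ∞ ∨ r = ω) {φ : PointTransf r Vars} {z : Vars}
    (hz : z ∈ φ.toHomeo.source) {S S' : Vars → ℂ} (hM : MapsEquation φ.toHomeo S S' z) :
    ∀ᶠ w in 𝓝 z, DetEq (fderiv ℝ φ.toHomeo w) (fderiv ℝ (fderiv ℝ φ.toHomeo) w)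
      (S w * w.2) (S' (φ.toHomeo w) * (φ.toHomeo w).2) := by
  set F := φ.toHomeo
  have hsrc : ∀ᶠ w in 𝓝 z, w ∈ F.source := F.open_source.mem_nhds hz
  have hsm : ∀ w ∈ F.source, ContDiffAt ℝ 2 F w := fun w hw =>
    (φ.contDiffAt hw).of_le (two_le_of_smooth hr)
  have hJ : ∀ᶠ w in 𝓝 z, w ∈ F.source ∧ JetRel (fderiv ℝ F w) (fderiv ℝ (fderiv ℝ F) w)
      (S w * w.2) (S' (F w) * (F w).2) := by
    filter_upwards [hsrc, hM] with w hw hMw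
    exact ⟨hw, jetRel_of_mapsEquation (hsm w hw) hMw⟩
  have htime : ∀ᶠ w in 𝓝 z, ∀ v : Vars, v.1.1 = 0 → (fderiv ℝ F w v).1.1 = 0 := by
    filter_upwards [hJ] with w ⟨hw, hJw⟩
    have hT := hJw.time_apply_eq_zero (φ.bijective_fderiv hr hw)
    rintro ⟨⟨a, b⟩, h⟩ (rfl : a = 0)
    have h1 := hT 0
    have h2 := hT h
    rw [map_eq_add _ 0 1 h] at h2
    rw [map_eq_add _ 0 b h]
    have h3 : (fderiv ℝ F w ((0, 1), 0)).1.1 = 0 := h1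
    simp only [zero_smul, one_smul, zero_add, Prod.fst_add, Prod.smul_fst] at h2 ⊢
    rw [h3] at h2 ⊢
    simpa using h2
  have hsymm : ∀ w ∈ F.source, ∀ u v, fderiv ℝ (fderiv ℝ F) w u v = fderiv ℝ (fderiv ℝ F) w v u :=
    fun w hw => ((hsm w hw).isSymmSndFDerivAt (by simp)).eq
  let LT : Vars →L[ℝ] ℝ := (ContinuousLinearMap.fst ℝ ℝ ℝ).comp (ContinuousLinearMap.fst ℝ (ℝ × ℝ) ℂ)
  let LX : Vars →L[ℝ] ℝ := (ContinuousLinearMap.snd ℝ ℝ ℝ).comp (ContinuousLinearMap.fst ℝ (ℝ × ℝ) ℂ)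
  have htime2 : ∀ᶠ w in 𝓝 z, ∀ u v : Vars, v.1.1 = 0 →
      (fderiv ℝ (fderiv ℝ F) w u v).1.1 = 0 := by
    filter_upwards [htime.eventually_nhds, hsrc] with w hw hws u v hv
    have h1 := (fderiv_apply_const (hsm w hws) LT v u).2
    have h2 : (fun y => LT (fderiv ℝ F y v)) =ᶠ[𝓝 w] fun _ => 0 := by
      filter_upwards [hw] with y hy using hy v hv
    rw [h2.fderiv_eq, fderiv_fun_const] at h1
    exact h1.symm
  have hspace : ∀ᶠ w in 𝓝 z, (fderiv ℝ F w ((1, 0), 0)).1.1 ≠ 0 ∧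
      (fderiv ℝ F w ((0, 1), 0)).1.2 ^ 2 = |(fderiv ℝ F w ((1, 0), 0)).1.1| ∧
      (∀ h, (fderiv ℝ F w (0, h)).1 = 0) ∧ (∀ h, (fderiv ℝ F w (0, Complex.I * h)).2
      = (Real.sign (fderiv ℝ F w ((1, 0), 0)).1.1 : ℂ) * Complex.I * (fderiv ℝ F w (0, h)).2) := by
    filter_upwards [hJ, htime2] with w ⟨hw, hJw⟩ h2
    exact hJw.space_apply (φ.bijective_fderiv hr hw) fun v hv => h2 v v hv
  filter_upwards [hJ, htime, htime2, hspace, hspace.eventually_nhds] with w ⟨hw, hJw⟩ h1 h2 h3 h4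
  have hHX : ∀ p', (fderiv ℝ (fderiv ℝ F) w ((0, 1), p') ((0, 1), p')).1.2 = 0 := by
    intro p'
    set v : Vars := ((0, 1), p') with hv
    have hX := fderiv_apply_const (hsm w hw) LX v v
    have hT := fderiv_apply_const (hsm w hw) LT ((1, 0), 0) v
    have hXv : ∀ᶠ y in 𝓝 w, LX (fderiv ℝ F y v) = (fderiv ℝ F y ((0, 1), 0)).1.2 := by
      filter_upwards [h4] with y hy
      rw [hv, map_eq_add _ 0 1 p', map_eq_add _ 0 1 0]
      simp [LX, hy.2.2.1]
    -- Squaring once more removes the absolute value, so the identity can be differentiated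
    -- directly.
    have hq : (fun y => (LX (fderiv ℝ F y v) ^ 2) ^ 2) =ᶠ[𝓝 w]
        fun y => (LT (fderiv ℝ F y ((1, 0), 0))) ^ 2 := by
      filter_upwards [h4, hXv] with y hy hy'
      rw [hy', hy.2.1, sq_abs]; rfl
    have hd1 := (hX.1.pow 2).pow 2
    have hd2 := (hT.1.pow 2).congr_of_eventuallyEq hq
    have := DFunLike.congr_fun (hd1.unique hd2) v
    have hz0 : LT (fderiv ℝ (fderiv ℝ F) w v ((1, 0), 0)) = 0 := by
      rw [hsymm w hw]; exact h2 _ _ rfl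
    simp only [smul_apply, ContinuousLinearMap.comp_apply,
      ContinuousLinearMap.apply_apply, hz0, smul_zero] at this
    have hne : LX (fderiv ℝ F w v) ≠ 0 := by
      rw [hXv.self_of_nhds]
      intro h0
      have := h3.2.1
      rw [h0] at this
      simp at this
      exact h3.1 (by simpa using this.symm)
    have h6 : LX (fderiv ℝ (fderiv ℝ F) w v v) = 0 := by simpa [hne] using this
    exact h6
  have h5 := hJw.psi_apply (φ.bijective_fderiv hr hw) (fun v hv => h2 v v hv) hHX (hsymm w hw)
  exact ⟨(φ.bijective_fderiv hr hw).1, hsymm w hw, h1, h3.1, h3.2.1, h3.2.2.1, h3.2.2.2, h5.1,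
    h5.2.1, h5.2.2⟩

end NSE

/-! ### Integration of the determining equations -/

namespace NSE

/-- The identity if `0 < σ` and the complex conjugation otherwise. -/
noncomputable def hatL (σ : ℝ) : ℂ →L[ℝ] ℂ :=
  if 0 < σ then ContinuousLinearMap.id ℝ ℂ else (Complex.conjCLE : ℂ →L[ℝ] ℂ)

theorem hatL_apply (σ : ℝ) (β : ℂ) : hatL σ β = if 0 < σ then β else conj β := by
  unfold hatL; split_ifs <;> simp

theorem hatL_mul (σ : ℝ) (a b : ℂ) : hatL σ (a * b) = hatL σ a * hatL σ b := by
  simp only [hatL_apply]; split_ifs <;> simp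

theorem hatL_one (σ : ℝ) : hatL σ 1 = 1 := by
  simp only [hatL_apply]; split_ifs <;> simp

theorem hatL_ofReal (σ : ℝ) (a : ℝ) : hatL σ a = a := by
  simp only [hatL_apply]; split_ifs <;> simp

theorem norm_hatL (σ : ℝ) (a : ℂ) : ‖hatL σ a‖ = ‖a‖ := by
  simp only [hatL_apply]; split_ifs <;> simp

theorem hatL_hatL (σ : ℝ) (a : ℂ) : hatL σ (hatL σ a) = a := by
  simp only [hatL_apply]; split_ifs <;> simp

theorem hat_eq_hatL (T : ℝ → ℝ) (t : ℝ) (β : ℂ) : hat T t β = hatL (deriv T t) β := by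
  rw [hatL_apply]; rfl

theorem hatL_congr {σ τ : ℝ} (h : Real.sign σ = Real.sign τ) : hatL σ = hatL τ := by
  have : 0 < σ ↔ 0 < τ := by
    rcases lt_trichotomy σ 0 with h1 | h1 | h1 <;> rcases lt_trichotomy τ 0 with h2 | h2 | h2 <;>
      simp [h1, h2, Real.sign_of_neg, Real.sign_of_pos, not_lt.2 h1.le, not_lt.2 h2.le] at h ⊢ <;>
      norm_num at h
  ext x
  rw [hatL_apply, hatL_apply]; simp only [this]

theorem eventually_sign_eq {E : Type*} [TopologicalSpace E] {g : E → ℝ} {z : E}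
    (hg : ContinuousAt g z) (h0 : g z ≠ 0) : ∀ᶠ w in 𝓝 z, Real.sign (g w) = Real.sign (g z) := by
  rcases lt_or_gt_of_ne h0 with h | h
  · filter_upwards [hg.eventually_lt continuousAt_const h] with w hw
    rw [Real.sign_of_neg hw, Real.sign_of_neg h]
  · filter_upwards [continuousAt_const.eventually_lt hg h] with w hw
    rw [Real.sign_of_pos hw, Real.sign_of_pos h]

theorem sign_mul_abs (a : ℝ) : Real.sign a * |a| = a := by
  rcases lt_trichotomy a 0 with h | h | h
  · rw [Real.sign_of_neg h, abs_of_neg h]; ring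
  · simp [h]
  · rw [Real.sign_of_pos h, abs_of_pos h]; ring

theorem sign_eq_of_ne {a : ℝ} (h : a ≠ 0) : Real.sign a = 1 ∨ Real.sign a = -1 := by
  rcases lt_or_gt_of_ne h with h | h
  · exact Or.inr (Real.sign_of_neg h)
  · exact Or.inl (Real.sign_of_pos h)

theorem fderiv_mul_add {a b : ℝ × ℝ → ℂ} (c : ℂ →L[ℝ] ℂ) {w : Vars}
    (ha : DifferentiableAt ℝ a w.1) (hb : DifferentiableAt ℝ b w.1) (v : ℝ × ℝ) :
    fderiv ℝ (fun y : Vars => a y.1 * c y.2 + b y.1) w (v, 0)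
      = fderiv ℝ a w.1 v * c w.2 + fderiv ℝ b w.1 v := by
  have h1 : HasFDerivAt (fun y : Vars => a y.1) _ w := ha.hasFDerivAt.comp w hasFDerivAt_fst
  have h2 : HasFDerivAt (fun y : Vars => b y.1) _ w := hb.hasFDerivAt.comp w hasFDerivAt_fst
  have h3 : HasFDerivAt (fun y : Vars => c y.2) _ w := c.hasFDerivAt.comp w hasFDerivAt_snd
  have h4 : fderiv ℝ (fun y : Vars => a y.1 * c y.2 + b y.1) w = _ := ((h1.mul h3).add h2).fderiv
  rw [h4]
  simp
  ring

section
variable {r : WithTop ℕ∞}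

theorem SmoothNear.deriv (hr : r = ∞ ∨ r = ω) {F : Type} [NormedAddCommGroup F]
    [NormedSpace ℝ F] {g : ℝ → F} {a : ℝ} (hg : SmoothNear r g a) : SmoothNear r (_root_.deriv g) a :=
  hg.mono fun y hy => by
    have h1 := hy.fderiv_right (m := r) (add_one_le_of_smooth hr)
    have h2 : _root_.deriv g = fun y => fderiv ℝ g y 1 := rfl
    rw [h2]
    exact h1.clm_apply contDiffAt_const

theorem contDiffAt_sqrt_abs {E : Type*} [NormedAddCommGroup E] [NormedSpace ℝ E] {g : E → ℝ} {a : E}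
    (hg : ContDiffAt ℝ r g a) (h0 : g a ≠ 0) : ContDiffAt ℝ r (fun t => √|g t|) a := by
  refine ContDiffAt.sqrt ?_ (abs_pos.2 h0).ne'
  rcases lt_or_gt_of_ne h0 with h | h
  · refine hg.neg.congr_of_eventuallyEq ?_
    filter_upwards [hg.continuousAt.eventually_lt continuousAt_const h] with w hw
      using abs_of_neg hw
  · refine hg.congr_of_eventuallyEq ?_
    filter_upwards [continuousAt_const.eventually_lt hg.continuousAt h] with w hw
      using abs_of_pos hw

theorem SmoothNear.sqrt_abs {g : ℝ → ℝ} {a : ℝ} (hg : SmoothNear r g a)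
    (h0 : ∀ᶠ t in 𝓝 a, g t ≠ 0) : SmoothNear r (fun t => √|g t|) a := by
  filter_upwards [hg, h0] with t h1 h2 using contDiffAt_sqrt_abs h1 h2

/-- On a ball the determining equations are integrated successively for t̃, for x̃, and for ψ̃,
which is affine in ψ̂ since its second ψ-derivatives vanish. The derivative of `A` in x comes from
`DetEq.space_psi`, and the last conclusion is `DetEq.rest`, the only place where S and S̃ enter. No
structure of S or S̃ is assumed. -/
theorem exists_affine_form (hr : r = ∞ ∨ r = ω) {φ : PointTransf r Vars} {z : Vars}
    (hz : z ∈ φ.toHomeo.source) {S S' : Vars → ℂ} (hM : MapsEquation φ.toHomeo S S' z) :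
    ∃ (ε : ℝ) (T X : ℝ → ℝ) (A C α β : ℝ × ℝ → ℂ), (ε = 1 ∨ ε = -1) ∧
      SmoothNear r T z.1.1 ∧ SmoothNear r X z.1.1 ∧ SmoothNear r A z.1 ∧
      (∀ᶠ t in 𝓝 z.1.1, deriv T t ≠ 0) ∧ (∀ᶠ q in 𝓝 z.1, A q ≠ 0) ∧
      (∀ᶠ w in 𝓝 z, φ.toHomeo w = ((T w.1.1, ε * w.1.2 * √|deriv T w.1.1| + X w.1.1),
        A w.1 * hat T w.1.1 w.2 + C w.1)) ∧
      (∀ᶠ q in 𝓝 z.1, HasDerivAt (fun x => A (q.1, x)) (Complex.I *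
        (ε * √|deriv T q.1| * (ε * q.2 * deriv (fun s => √|deriv T s|) q.1 + deriv X q.1)
          / deriv T q.1 : ℝ) * A q / 2) q.2) ∧
      ∀ᶠ w in 𝓝 z, α w.1 * hat T w.1.1 w.2 + β w.1
        - A w.1 * hat T w.1.1 (S w * w.2) / (|deriv T w.1.1| : ℝ)
        + S' (φ.toHomeo w) * (φ.toHomeo w).2 = 0 := by
  have hdet := eventually_detEq hr hz hM
  set F := φ.toHomeo with hF
  have hsrc : ∀ᶠ w in 𝓝 z, w ∈ F.source := F.open_source.mem_nhds hz
  have hsm : ∀ w ∈ F.source, ContDiffAt ℝ r F w := fun w hw => φ.contDiffAt hw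
  have hsm2 : ∀ w ∈ F.source, ContDiffAt ℝ 2 F w := fun w hw =>
    (hsm w hw).of_le (two_le_of_smooth hr)
  have hcD : ContinuousAt (fderiv ℝ F) z := (differentiableAt_fderiv (hsm2 z hz)).continuousAt
  have hcD' : ∀ v, ContinuousAt (fun w => fderiv ℝ F w v) z := fun v =>
    hcD.clm_apply continuousAt_const
  have hz0 := hdet.self_of_nhds
  have hX2z : (fderiv ℝ F z ((0, 1), 0)).1.2 ≠ 0 := by
    intro h
    have := hz0.space_sq
    rw [h] at this
    simp at this
    exact hz0.time_ne (by simpa using this.symm)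
  have hs1 := eventually_sign_eq (g := fun w => (fderiv ℝ F w ((1, 0), 0)).1.1)
    ((hcD' _).fst.fst) hz0.time_ne
  have hs2 := eventually_sign_eq (g := fun w => (fderiv ℝ F w ((0, 1), 0)).1.2)
    ((hcD' _).fst.snd) hX2z
  set σ := (fderiv ℝ F z ((1, 0), 0)).1.1
  set ε := Real.sign (fderiv ℝ F z ((0, 1), 0)).1.2 with hε
  have hε1 : ε = 1 ∨ ε = -1 := sign_eq_of_ne hX2z
  -- The signs of T_t and x̃_x are made constant on the ball, so that ε and the choice between ψ and
  -- ψ* are fixed there.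
  obtain ⟨R, hR, hball⟩ := Metric.eventually_nhds_iff_ball.1 (hsrc.and (hdet.and (hs1.and hs2)))
  set Ω := Metric.ball z R with hΩ
  have hΩo : ∀ w ∈ Ω, Ω ∈ 𝓝 w := fun w hw => Metric.isOpen_ball.mem_nhds hw
  have hΩmem : ∀ w : Vars, w ∈ Ω ↔ dist w.1.1 z.1.1 < R ∧ dist w.1.2 z.1.2 < R ∧ dist w.2 z.2 < R := by
    intro w
    simp [hΩ, Metric.mem_ball, Prod.dist_eq, and_assoc]
  have hconv : Convex ℝ Ω := convex_ball z R
  obtain ⟨⟨t₀, x₀⟩, ψ₀⟩ := z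
  have hdF : ∀ w ∈ Ω, DifferentiableAt ℝ F w := fun w hw =>
    (hsm2 w (hball w hw).1).differentiableAt (by norm_num)
  let LT : Vars →L[ℝ] ℝ := (ContinuousLinearMap.fst ℝ ℝ ℝ).comp (ContinuousLinearMap.fst ℝ (ℝ × ℝ) ℂ)
  let LX : Vars →L[ℝ] ℝ := (ContinuousLinearMap.snd ℝ ℝ ℝ).comp (ContinuousLinearMap.fst ℝ (ℝ × ℝ) ℂ)
  let LW : Vars →L[ℝ] ℂ := ContinuousLinearMap.snd ℝ (ℝ × ℝ) ℂ
  have hcompL : ∀ {G : Type} [NormedAddCommGroup G] [NormedSpace ℝ G] (L : Vars →L[ℝ] G), ∀ w ∈ Ω,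
      HasFDerivAt (fun y => L (F y)) (L.comp (fderiv ℝ F w)) w := fun L w hw =>
    L.hasFDerivAt.comp w (hdF w hw).hasFDerivAt
  have htline : ∀ w ∈ Ω, ∀ {G : Type} [NormedAddCommGroup G] [NormedSpace ℝ G] (L : Vars →L[ℝ] G),
      HasDerivAt (fun t : ℝ => L (F ((t, w.1.2), w.2))) (L (fderiv ℝ F w ((1, 0), 0))) w.1.1 := by
    intro w hw G _ _ L
    have h : HasDerivAt (fun t : ℝ => (((t, w.1.2), w.2) : Vars)) ((1, 0), 0) w.1.1 :=
      ((hasDerivAt_id _).prodMk (hasDerivAt_const _ _)).prodMk (hasDerivAt_const _ _)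
    exact (hcompL L w hw).comp_hasDerivAt (x := w.1.1)
      (f := fun t : ℝ => (((t, w.1.2), w.2) : Vars)) h
  have hmemt : ∀ w ∈ Ω, ((w.1.1, x₀), ψ₀) ∈ Ω := by
    intro w hw
    rw [hΩmem] at hw ⊢
    simpa [hR] using hw.1
  have hmemq : ∀ w ∈ Ω, (w.1, ψ₀) ∈ Ω := by
    intro w hw
    rw [hΩmem] at hw ⊢
    simpa [hR] using ⟨hw.1, hw.2.1⟩
  have hlinet : ∀ w ∈ Ω, ∀ᶠ t in 𝓝 w.1.1, ((t, w.1.2), w.2) ∈ Ω := fun w hw =>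
    (show ContinuousAt (fun t : ℝ => (((t, w.1.2), w.2) : Vars)) w.1.1 by fun_prop).eventually
      (hΩo w hw)
  -- the time variable
  let T : ℝ → ℝ := fun t => (F ((t, x₀), ψ₀)).1.1
  have hT : ∀ w ∈ Ω, (F w).1.1 = T w.1.1 := by
    intro w hw
    refine eq_of_fderiv_apply_eq_zero (g := fun y => LT (F y)) hconv hw (hmemt w hw)
      (fun y hy => (hcompL LT y hy).differentiableAt) fun y hy => ?_
    rw [(hcompL LT y hy).fderiv]
    exact (hball y hy).2.1.time _ (by simp)
  have hT1 : ∀ w ∈ Ω, (fderiv ℝ F w ((1, 0), 0)).1.1 = deriv T w.1.1 := by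
    intro w hw
    have h1 := htline w hw LT
    refine (HasDerivAt.deriv (h1.congr_of_eventuallyEq ?_)).symm
    filter_upwards [hlinet w hw] with t ht using (hT _ ht).symm
  have hmem0 : ∀ᶠ t in 𝓝 t₀, ((t, x₀), ψ₀) ∈ Ω :=
    hlinet ((t₀, x₀), ψ₀) (Metric.mem_ball_self hR)
  have hTne : ∀ᶠ t in 𝓝 t₀, deriv T t ≠ 0 := by
    filter_upwards [hmem0] with t ht
    rw [← hT1 _ ht]
    exact (hball _ ht).2.1.time_ne
  have hFt : ∀ᶠ t in 𝓝 t₀, ContDiffAt ℝ r (fun t => F ((t, x₀), ψ₀)) t := by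
    filter_upwards [hmem0] with t ht
    exact ContDiffAt.comp (g := F) (f := fun t : ℝ => (((t, x₀), ψ₀) : Vars)) t
      (hsm _ (hball _ ht).1) (by fun_prop)
  have hTs : SmoothNear r T t₀ := hFt.mono fun t ht => ht.fst.fst
  have hsq : SmoothNear r (fun t => √|deriv T t|) t₀ := (hTs.deriv hr).sqrt_abs hTne
  -- the space variable
  have hX2 : ∀ w ∈ Ω, (fderiv ℝ F w ((0, 1), 0)).1.2 = ε * √|deriv T w.1.1| := by
    intro w hw
    rw [← hT1 w hw, ← (hball w hw).2.1.space_sq, Real.sqrt_sq_eq_abs,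
      ← (hball w hw).2.2.2, sign_mul_abs]
  -- Chosen so that the formula for x̃ holds at x = x₀; the known x-derivative extends it to the
  -- slice.
  let X : ℝ → ℝ := fun t => (F ((t, x₀), ψ₀)).1.2 - ε * x₀ * √|deriv T t|
  have hX : ∀ w ∈ Ω, (F w).1.2 = ε * w.1.2 * √|deriv T w.1.1| + X w.1.1 := by
    intro w hw
    have h1 : ∀ y ∈ Ω ∩ {y : Vars | y.1.1 = w.1.1}, HasFDerivAt
        (fun y : Vars => LX (F y) - (ε * √|deriv T w.1.1|) * LX y)
        (LX.comp (fderiv ℝ F y) - (ε * √|deriv T w.1.1|) • LX) y :=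
      fun y hy => (hcompL LX y hy.1).sub (LX.hasFDerivAt.const_mul _)
    have h2 := eq_of_fderiv_apply_eq_zero (a := w) (b := ((w.1.1, x₀), ψ₀))
      (s := Ω ∩ {y : Vars | y.1.1 = w.1.1})
      (g := fun y : Vars => LX (F y) - (ε * √|deriv T w.1.1|) * LX y)
      (hconv.inter (by
        intro a ha b hb s t hs ht hst
        simp only [Set.mem_ofPred_eq] at ha hb ⊢
        simp [ha, hb, ← add_mul, hst])) ⟨hw, rfl⟩ ⟨hmemt w hw, rfl⟩
      (fun y hy => (h1 y hy).differentiableAt) (fun y hy => by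
        rw [(h1 y hy).fderiv]
        have e : (((w.1.1, x₀), ψ₀) : Vars) - w = ((0, x₀ - w.1.2), ψ₀ - w.2) := by
          ext <;> simp
        have hd := (hball y hy.1).2.1
        rw [e]
        have e2 : (fderiv ℝ F y ((0, x₀ - w.1.2), ψ₀ - w.2)).1.2
            = (x₀ - w.1.2) * (fderiv ℝ F y ((0, 1), 0)).1.2 := by
          rw [map_eq_add]; simp [hd.psi]
        have e3 : y.1.1 = w.1.1 := hy.2
        change (fderiv ℝ F y ((0, x₀ - w.1.2), ψ₀ - w.2)).1.2
          - (ε * √|deriv T w.1.1|) * (x₀ - w.1.2) = 0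
        rw [e2, hX2 y hy.1, e3]; ring)
    have h3 : (F w).1.2 - ε * √|deriv T w.1.1| * w.1.2
        = (F ((w.1.1, x₀), ψ₀)).1.2 - ε * √|deriv T w.1.1| * x₀ := h2
    simp only [X]
    linear_combination h3
  have hXs : SmoothNear r X t₀ := by
    filter_upwards [hFt, hsq] with t h1 h2
    exact h1.fst.snd.sub (contDiffAt_const.mul h2)
  have hX1 : ∀ w ∈ Ω, (fderiv ℝ F w ((1, 0), 0)).1.2
      = ε * w.1.2 * deriv (fun s => √|deriv T s|) w.1.1 + deriv X w.1.1 := by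
    intro w hw
    have h1 := htline w hw LX
    have hd0 : HasDerivAt T (deriv T w.1.1) w.1.1 := by
      have h2 := htline _ (hmemt w hw) LT
      exact h2.differentiableAt.hasDerivAt
    have hFw : ContDiffAt ℝ r (fun t => F ((t, x₀), ψ₀)) w.1.1 :=
      ContDiffAt.comp (g := F) (f := fun t : ℝ => (((t, x₀), ψ₀) : Vars)) w.1.1
        (hsm _ (hball _ (hmemt w hw)).1) (by fun_prop)
    have hne : deriv T w.1.1 ≠ 0 := by rw [← hT1 w hw]; exact (hball _ hw).2.1.time_ne
    have hdT : ContDiffAt ℝ r (deriv T) w.1.1 := by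
      have h2 : deriv T = fun y => fderiv ℝ T y 1 := rfl
      rw [h2]
      exact (hFw.fst.fst.fderiv_right (add_one_le_of_smooth hr)).clm_apply contDiffAt_const
    have hq := contDiffAt_sqrt_abs hdT hne
    have hX' : ContDiffAt ℝ r X w.1.1 := hFw.fst.snd.sub (contDiffAt_const.mul hq)
    have h2 := ((hq.differentiableAt (ne_zero_of_smooth hr)).hasDerivAt.const_mul (ε * w.1.2)).add
      (hX'.differentiableAt (ne_zero_of_smooth hr)).hasDerivAt
    refine h1.unique (h2.congr_of_eventuallyEq ?_)
    filter_upwards [hlinet w hw] with t ht using hX _ ht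
  -- the dependent variable
  let c := hatL σ
  have hsign : ∀ w ∈ Ω, Real.sign (deriv T w.1.1) = Real.sign σ := fun w hw => by
    rw [← hT1 w hw]; exact (hball w hw).2.2.1
  have hhat : ∀ w ∈ Ω, ∀ b, hat T w.1.1 b = c b := fun w hw b => by
    rw [hat_eq_hatL, hatL_congr (hsign w hw)]
  let A : ℝ × ℝ → ℂ := fun q => (fderiv ℝ F (q, ψ₀) (0, 1)).2
  -- A real-linear map is determined by its values at 1 and i, and `DetEq.psi_I` gives the second
  -- from the first.
  have hDψ : ∀ w ∈ Ω, ∀ h, (fderiv ℝ F w (0, h)).2 = (fderiv ℝ F w (0, 1)).2 * c h := by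
    intro w hw h
    have hd := (hball w hw).2.1
    have e : fderiv ℝ F w (0, h) = h.re • fderiv ℝ F w (0, 1) + h.im • fderiv ℝ F w (0, Complex.I * 1) := by
      rw [← map_smul, ← map_smul, ← map_add]
      congr 1
      ext <;> simp
    rw [e]
    simp only [Prod.snd_add, Prod.smul_snd, hd.psi_I, Complex.real_smul]
    rw [(hball w hw).2.2.1, hatL_apply]
    rcases lt_or_gt_of_ne hz0.time_ne with hs | hs
    · rw [Real.sign_of_neg hs, if_neg (not_lt.2 hs.le)]
      have : conj h = h.re - h.im * Complex.I := by
        apply Complex.ext <;> simp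
      rw [this]; push_cast; ring
    · rw [Real.sign_of_pos hs, if_pos hs]
      nth_rw 3 [← Complex.re_add_im h]
      push_cast; ring
  have hconvq : ∀ q : ℝ × ℝ, Convex ℝ (Ω ∩ {y : Vars | y.1 = q}) := fun q => hconv.inter (by
    intro a ha b hb s t hs ht hst
    simp only [Set.mem_ofPred_eq] at ha hb ⊢
    simp [ha, hb, ← add_smul, hst])
  have hA : ∀ w ∈ Ω, (fderiv ℝ F w (0, 1)).2 = A w.1 := by
    intro w hw
    refine eq_of_fderiv_apply_eq_zero (a := w) (b := (w.1, ψ₀)) (s := Ω ∩ {y : Vars | y.1 = w.1})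
      (g := fun y : Vars => LW (fderiv ℝ F y (0, 1))) (hconvq _) ⟨hw, rfl⟩ ⟨hmemq w hw, rfl⟩
      (fun y hy => (fderiv_apply_const (hsm2 y (hball y hy.1).1) LW _ 0).1.differentiableAt)
      (fun y hy => ?_)
    rw [(fderiv_apply_const (hsm2 y (hball y hy.1).1) LW _ _).2]
    have hd := (hball y hy.1).2.1
    have e : ((w.1, ψ₀) : Vars) - w = (0, ψ₀ - w.2) := by ext <;> simp
    rw [e]
    set k := ψ₀ - w.2
    -- Polarization: the quadratic form vanishes at k, at 1 and at k + 1, so the mixed second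
    -- derivative vanishes.
    have h1 := hd.psi_psi (k + 1)
    have e1 : ((0, k + 1) : Vars) = (0, k) + (0, 1) := by ext <;> simp
    rw [e1] at h1
    simp only [map_add, add_apply, Prod.snd_add, hd.psi_psi, hd.symm (0, 1) (0, k)] at h1
    have h2 : 2 * (fderiv ℝ (fderiv ℝ F) y (0, k) (0, 1)).2 = 0 := by linear_combination h1
    exact (mul_eq_zero.1 h2).resolve_left two_ne_zero
  let C : ℝ × ℝ → ℂ := fun q => (F (q, ψ₀)).2 - A q * c ψ₀
  have hW : ∀ w ∈ Ω, (F w).2 = A w.1 * c w.2 + C w.1 := by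
    intro w hw
    have h1 : ∀ y ∈ Ω ∩ {y : Vars | y.1 = w.1}, HasFDerivAt
        (fun y : Vars => LW (F y) - A w.1 * c (LW y))
        (LW.comp (fderiv ℝ F y) - A w.1 • (c.comp LW)) y :=
      fun y hy => (hcompL LW y hy.1).sub
        ((HasFDerivAt.comp y c.hasFDerivAt LW.hasFDerivAt).const_mul (A w.1))
    have h2 := eq_of_fderiv_apply_eq_zero (a := w) (b := (w.1, ψ₀))
      (s := Ω ∩ {y : Vars | y.1 = w.1})
      (g := fun y : Vars => LW (F y) - A w.1 * c (LW y)) (hconvq _) ⟨hw, rfl⟩ ⟨hmemq w hw, rfl⟩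
      (fun y hy => (h1 y hy).differentiableAt) (fun y hy => by
        rw [(h1 y hy).fderiv]
        have e : ((w.1, ψ₀) : Vars) - w = (0, ψ₀ - w.2) := by ext <;> simp
        rw [e]
        change (fderiv ℝ F y (0, ψ₀ - w.2)).2 - A w.1 * c (ψ₀ - w.2) = 0
        have e3 : y.1 = w.1 := hy.2
        rw [hDψ y hy.1, hA y hy.1, e3]; ring)
    have h3 : (F w).2 - A w.1 * c w.2 = (F (w.1, ψ₀)).2 - A w.1 * c ψ₀ := h2
    simp only [C]
    linear_combination h3
  have hFq : ∀ q, (q, ψ₀) ∈ Ω → ContDiffAt ℝ r (fun q => F (q, ψ₀)) q := fun q hq =>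
    ContDiffAt.comp (g := F) (f := fun q : ℝ × ℝ => ((q, ψ₀) : Vars)) q
      (hsm _ (hball _ hq).1) (by fun_prop)
  have hAs : ∀ q, (q, ψ₀) ∈ Ω → ContDiffAt ℝ r A q := by
    intro q hq
    have h1 := (hsm _ (hball _ hq).1).fderiv_right (m := r) (add_one_le_of_smooth hr)
    have h2 : ContDiffAt ℝ r (fun q : ℝ × ℝ => fderiv ℝ F (q, ψ₀)) q :=
      ContDiffAt.comp (g := fderiv ℝ F) (f := fun q : ℝ × ℝ => ((q, ψ₀) : Vars)) q h1 (by fun_prop)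
    exact (h2.clm_apply contDiffAt_const).snd
  have hCs : ∀ q, (q, ψ₀) ∈ Ω → ContDiffAt ℝ r C q := fun q hq =>
    (hFq q hq).snd.sub ((hAs q hq).mul contDiffAt_const)
  have hmemq0 : ∀ᶠ q in 𝓝 (t₀, x₀), (q, ψ₀) ∈ Ω :=
    (show ContinuousAt (fun q : ℝ × ℝ => ((q, ψ₀) : Vars)) (t₀, x₀) by fun_prop).eventually
      (hΩo _ (Metric.mem_ball_self hR))
  have hd1 : ∀ {g : ℝ × ℝ → ℂ} {q}, ContDiffAt ℝ r g q → DifferentiableAt ℝ g q := fun h =>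
    h.differentiableAt (ne_zero_of_smooth hr)
  have hDq : ∀ w ∈ Ω, ∀ v, (fderiv ℝ F w (v, 0)).2
      = fderiv ℝ A w.1 v * c w.2 + fderiv ℝ C w.1 v := by
    intro w hw v
    rw [← fderiv_mul_add c (hd1 (hAs _ (hmemq w hw))) (hd1 (hCs _ (hmemq w hw)))]
    have e : (fun y : Vars => LW (F y)) =ᶠ[𝓝 w] fun y => A y.1 * c y.2 + C y.1 := by
      filter_upwards [hΩo w hw] with y hy using hW y hy
    rw [← e.fderiv_eq, (hcompL LW w hw).fderiv]
    rfl
  let A₁ : ℝ × ℝ → ℂ := fun q => fderiv ℝ A q (0, 1)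
  let C₁ : ℝ × ℝ → ℂ := fun q => fderiv ℝ C q (0, 1)
  have hH2 : ∀ w ∈ Ω, (fderiv ℝ (fderiv ℝ F) w ((0, 1), 0) ((0, 1), 0)).2
      = fderiv ℝ A₁ w.1 (0, 1) * c w.2 + fderiv ℝ C₁ w.1 (0, 1) := by
    intro w hw
    have hA1 : ContDiffAt ℝ r A₁ w.1 :=
      ((hAs _ (hmemq w hw)).fderiv_right (add_one_le_of_smooth hr)).clm_apply contDiffAt_const
    have hC1 : ContDiffAt ℝ r C₁ w.1 :=
      ((hCs _ (hmemq w hw)).fderiv_right (add_one_le_of_smooth hr)).clm_apply contDiffAt_const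
    rw [← fderiv_mul_add c (hd1 hA1) (hd1 hC1)]
    have e : (fun y : Vars => LW (fderiv ℝ F y ((0, 1), 0))) =ᶠ[𝓝 w]
        fun y => A₁ y.1 * c y.2 + C₁ y.1 := by
      filter_upwards [hΩo w hw] with y hy using hDq y hy _
    rw [← e.fderiv_eq, (fderiv_apply_const (hsm2 w (hball w hw).1) LW _ _).2]
    rfl
  have hH1 : ∀ w ∈ Ω, (fderiv ℝ (fderiv ℝ F) w ((0, 1), 0) (0, 1)).2 = A₁ w.1 := by
    intro w hw
    have h1 := fderiv_mul_add (a := fun _ => 0) (b := A) c (w := w) (differentiableAt_const _)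
      (hd1 (hAs _ (hmemq w hw))) (0, 1)
    have e : (fun y : Vars => LW (fderiv ℝ F y (0, 1))) =ᶠ[𝓝 w]
        fun y => (fun _ => 0) y.1 * c y.2 + A y.1 := by
      filter_upwards [hΩo w hw] with y hy
      rw [zero_mul, zero_add]
      exact hA y hy
    rw [← e.fderiv_eq, (fderiv_apply_const (hsm2 w (hball w hw).1) LW _ _).2] at h1
    rw [fderiv_fun_const, Pi.zero_apply, zero_apply, zero_mul, zero_add] at h1
    exact h1
  -- The functions α and β collect the terms of `DetEq.rest` without S and S̃, as coefficients of ψ̂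
  -- and of 1 respectively.
  refine ⟨ε, T, X, A, C,
    fun q => Complex.I * (fderiv ℝ A q (1, 0)
      - ((ε * q.2 * deriv (fun s => √|deriv T s|) q.1 + deriv X q.1) / (ε * √|deriv T q.1|) : ℝ)
        * A₁ q) / deriv T q.1 + fderiv ℝ A₁ q (0, 1) / (|deriv T q.1| : ℝ),
    fun q => Complex.I * (fderiv ℝ C q (1, 0)
      - ((ε * q.2 * deriv (fun s => √|deriv T s|) q.1 + deriv X q.1) / (ε * √|deriv T q.1|) : ℝ)
        * C₁ q) / deriv T q.1 + fderiv ℝ C₁ q (0, 1) / (|deriv T q.1| : ℝ), hε1, hTs, hXs,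
    hmemq0.mono hAs, hTne, ?_, ?_, ?_, ?_⟩
  · filter_upwards [hmemq0] with q hq h0
    have hd := (hball _ hq).2.1
    have h1 : fderiv ℝ F (q, ψ₀) (0, 1) = 0 := Prod.ext (hd.psi 1) h0
    have h2 : ((0, 1) : Vars) = 0 := hd.inj (by rw [h1, map_zero])
    exact one_ne_zero (congrArg Prod.snd h2)
  · filter_upwards [hΩo _ (Metric.mem_ball_self hR)] with w hw
    rw [hhat w hw, ← hW w hw, ← hX w hw, ← hT w hw]
  · filter_upwards [hmemq0] with q hq
    have hd := (hball _ hq).2.1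
    have h1 := hd.space_psi 1
    rw [hH1 _ hq, hX2 _ hq, hX1 _ hq, hT1 _ hq] at h1
    have h2 : HasDerivAt (fun x : ℝ => (q.1, x)) ((0 : ℝ), (1 : ℝ)) q.2 :=
      (hasDerivAt_const q.2 q.1).prodMk (hasDerivAt_id q.2)
    have h3 := (hd1 (hAs q hq)).hasFDerivAt.comp_hasDerivAt (x := q.2)
      (f := fun x : ℝ => (q.1, x)) h2
    refine h3.congr_deriv ?_
    have h4 : A₁ q = fderiv ℝ A q (0, 1) := rfl
    rw [← h4]
    linear_combination (1 / 2) * h1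
  · filter_upwards [hΩo _ (Metric.mem_ball_self hR)] with w hw
    have h1 := (hball w hw).2.1.rest
    rw [hDψ w hw, hA w hw, hDq w hw, hDq w hw, hH2 w hw, hX1 w hw, hX2 w hw, hT1 w hw] at h1
    rw [hhat w hw, hhat w hw]
    rw [← h1]
    ring

end
end NSE

/-! ### Action of a transformation of the required form on the equation -/

namespace NSE

/-- The coefficient of `x ^ 2` in the phase. -/
noncomputable def phase₂ (T : ℝ → ℝ) (t : ℝ) : ℝ := 1 / 8 * (deriv (deriv T) t / |deriv T t|)

/-- The coefficient of `x` in the phase. -/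
noncomputable def phase₁ (ε : ℝ) (T X : ℝ → ℝ) (t : ℝ) : ℝ :=
  1 / 2 * (ε * Real.sign (deriv T t) * deriv X t / √|deriv T t|)

/-- The factor by which `ψ̂` is multiplied. -/
noncomputable def amplitude (ε : ℝ) (T X Θ Ψ : ℝ → ℝ) (q : ℝ × ℝ) : ℂ :=
  Complex.exp (Complex.I * (phase₂ T q.1 * q.2 ^ 2 + phase₁ ε T X q.1 * q.2 + Ψ q.1 : ℝ)
    + (Θ q.1 : ℂ))

theorem formula_fst (ε : ℝ) (T X Θ Ψ : ℝ → ℝ) (p : Vars × ℂ) :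
    (formula ε T X Θ Ψ p).1 = ((T p.1.1.1, ε * p.1.1.2 * √|deriv T p.1.1.1| + X p.1.1.1),
      hat T p.1.1.1 p.1.2 * amplitude ε T X Θ Ψ p.1.1) := rfl

theorem amplitude_ne_zero (ε : ℝ) (T X Θ Ψ : ℝ → ℝ) (q : ℝ × ℝ) : amplitude ε T X Θ Ψ q ≠ 0 :=
  Complex.exp_ne_zero _

theorem norm_amplitude (ε : ℝ) (T X Θ Ψ : ℝ → ℝ) (q : ℝ × ℝ) :
    ‖amplitude ε T X Θ Ψ q‖ = Real.exp (Θ q.1) := by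
  rw [amplitude, Complex.norm_exp]
  simp only [Complex.add_re, Complex.mul_re, Complex.I_re, Complex.I_im, Complex.ofReal_im,
    Complex.ofReal_re, zero_mul, mul_zero, sub_zero, zero_add]

/-- Near `z`, the map `F` is the projection of the transformation `formula`. -/
structure HasForm (r : WithTop ℕ∞) (F : Vars → Vars) (z : Vars) (ε : ℝ) (T X Θ Ψ : ℝ → ℝ) :
    Prop where
  eps : ε = 1 ∨ ε = -1
  smooth_T : SmoothNear r T z.1.1
  smooth_X : SmoothNear r X z.1.1
  smooth_Θ : SmoothNear r Θ z.1.1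
  smooth_Ψ : SmoothNear r Ψ z.1.1
  deriv_ne : ∀ᶠ t in 𝓝 z.1.1, deriv T t ≠ 0
  eq : ∀ᶠ w in 𝓝 z, F w = ((T w.1.1, ε * w.1.2 * √|deriv T w.1.1| + X w.1.1),
      hat T w.1.1 w.2 * amplitude ε T X Θ Ψ w.1)

theorem eventually_time {z : Vars} {Q : ℝ → Prop} (h : ∀ᶠ t in 𝓝 z.1.1, Q t) :
    ∀ᶠ w in 𝓝 z, Q w.1.1 :=
  (show ContinuousAt (fun w : Vars => w.1.1) z by fun_prop).eventually h

section
variable {r : WithTop ℕ∞} {F : Vars → Vars} {z w : Vars} {ε : ℝ} {T X Θ Ψ : ℝ → ℝ}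

theorem HasForm.eventually (h : HasForm r F z ε T X Θ Ψ) :
    ∀ᶠ w in 𝓝 z, HasForm r F w ε T X Θ Ψ := by
  filter_upwards [eventually_time h.smooth_T.eventually_nhds,
    eventually_time h.smooth_X.eventually_nhds, eventually_time h.smooth_Θ.eventually_nhds,
    eventually_time h.smooth_Ψ.eventually_nhds, eventually_time h.deriv_ne.eventually_nhds,
    h.eq.eventually_nhds] with w h1 h2 h3 h4 h5 h6
  exact ⟨h.eps, h1, h2, h3, h4, h5, h6⟩

theorem HasForm.congr {G : Vars → Vars} (h : HasForm r F z ε T X Θ Ψ) (hG : G =ᶠ[𝓝 z] F) :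
    HasForm r G z ε T X Θ Ψ :=
  ⟨h.eps, h.smooth_T, h.smooth_X, h.smooth_Θ, h.smooth_Ψ, h.deriv_ne, by
    filter_upwards [h.eq, hG] with w h1 h2 using h2.trans h1⟩

theorem hasDerivAt_abs_comp {g : ℝ → ℝ} {g' t : ℝ} (hg : HasDerivAt g g' t) (h0 : g t ≠ 0) :
    HasDerivAt (fun s => |g s|) (Real.sign (g t) * g') t := by
  rcases lt_or_gt_of_ne h0 with h | h
  · rw [Real.sign_of_neg h, neg_one_mul]
    refine hg.neg.congr_of_eventuallyEq ?_
    filter_upwards [hg.continuousAt.eventually_lt continuousAt_const h] with w hw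
      using abs_of_neg hw
  · rw [Real.sign_of_pos h, one_mul]
    refine hg.congr_of_eventuallyEq ?_
    filter_upwards [continuousAt_const.eventually_lt hg.continuousAt h] with w hw
      using abs_of_pos hw

theorem hasDerivAt_sqrt_abs {g : ℝ → ℝ} {g' t : ℝ} (hg : HasDerivAt g g' t) (h0 : g t ≠ 0) :
    HasDerivAt (fun s => √|g s|) (Real.sign (g t) * g' / (2 * √|g t|)) t :=
  (hasDerivAt_abs_comp hg h0).sqrt (abs_pos.2 h0).ne'

theorem SmoothNear.hasDerivAt (hr : r = ∞ ∨ r = ω) {G : Type} [NormedAddCommGroup G]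
    [NormedSpace ℝ G] {g : ℝ → G} {a : ℝ} (hg : SmoothNear r g a) :
    HasDerivAt g (_root_.deriv g a) a :=
  (hg.self_of_nhds.differentiableAt (ne_zero_of_smooth hr)).hasDerivAt

theorem hasDerivAt_phase₂ (hr : r = ∞ ∨ r = ω) {t : ℝ} (hT : SmoothNear r T t)
    (h0 : deriv T t ≠ 0) :
    HasDerivAt (phase₂ T) (1 / 8 * ((deriv (deriv (deriv T)) t * |deriv T t|
      - deriv (deriv T) t * (Real.sign (deriv T t) * deriv (deriv T) t)) / |deriv T t| ^ 2)) t :=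
  ((((hT.deriv hr).deriv hr).hasDerivAt hr).div
    (hasDerivAt_abs_comp ((hT.deriv hr).hasDerivAt hr) h0) (abs_pos.2 h0).ne').const_mul _

theorem hasDerivAt_phase₁ (hr : r = ∞ ∨ r = ω) {t : ℝ} (hT : SmoothNear r T t)
    (hX : SmoothNear r X t) (h0 : deriv T t ≠ 0) :
    HasDerivAt (phase₁ ε T X) (1 / 2 * ((ε * Real.sign (deriv T t) * deriv (deriv X) t
        * √|deriv T t| - ε * Real.sign (deriv T t) * deriv X t
          * (Real.sign (deriv T t) * deriv (deriv T) t / (2 * √|deriv T t|)))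
        / √|deriv T t| ^ 2)) t := by
  have h1 := ((((hX.deriv hr).hasDerivAt hr).const_mul (ε * Real.sign (deriv T t))).div
    (hasDerivAt_sqrt_abs ((hT.deriv hr).hasDerivAt hr) h0)
    (Real.sqrt_pos.2 (abs_pos.2 h0)).ne').const_mul (1 / 2)
  refine h1.congr_of_eventuallyEq ?_
  -- The sign of T_t is locally constant and contributes nothing to the derivative.
  filter_upwards [eventually_sign_eq ((hT.deriv hr).hasDerivAt hr).continuousAt h0] with s hs
  simp only [phase₁, hs]; rfl

theorem hasDerivAt_amplitude_snd (t x : ℝ) :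
    HasDerivAt (fun y => amplitude ε T X Θ Ψ (t, y))
      (Complex.I * (2 * phase₂ T t * x + phase₁ ε T X t : ℝ) * amplitude ε T X Θ Ψ (t, x)) x := by
  have h1 : HasDerivAt (fun y : ℝ => phase₂ T t * y ^ 2 + phase₁ ε T X t * y + Ψ t)
      (2 * phase₂ T t * x + phase₁ ε T X t) x := by
    have := ((((hasDerivAt_id x).pow 2).const_mul (phase₂ T t)).add
      ((hasDerivAt_id x).const_mul (phase₁ ε T X t))).add_const (Ψ t)
    refine this.congr_deriv ?_
    simp; ring
  have h2 := ((h1.ofReal_comp.const_mul Complex.I).add_const (Θ t : ℂ)).cexp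
  exact h2.congr_deriv (mul_comm _ _)

theorem hasDerivAt_amplitude_fst {t x d₂ d₁ : ℝ} (hr : r = ∞ ∨ r = ω)
    (h2 : HasDerivAt (phase₂ T) d₂ t) (h1 : HasDerivAt (phase₁ ε T X) d₁ t)
    (hΘ : SmoothNear r Θ t) (hΨ : SmoothNear r Ψ t) :
    HasDerivAt (fun s => amplitude ε T X Θ Ψ (s, x))
      ((Complex.I * (d₂ * x ^ 2 + d₁ * x + deriv Ψ t : ℝ) + deriv Θ t)
        * amplitude ε T X Θ Ψ (t, x)) t := by
  have h3 := ((h2.mul_const (x ^ 2)).add (h1.mul_const x)).add (hΨ.hasDerivAt hr)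
  have h4 := ((h3.ofReal_comp.const_mul Complex.I).add (hΘ.hasDerivAt hr).ofReal_comp).cexp
  exact h4.congr_deriv (mul_comm _ _)

theorem hasDerivAt_hatL {σ t : ℝ} {u : ℝ → ℂ} {u' : ℂ} (hu : HasDerivAt u u' t) :
    HasDerivAt (fun s => hatL σ (u s)) (hatL σ u') t :=
  (hatL σ).hasFDerivAt.comp_hasDerivAt t hu

/-- The action of the transformation on the left-hand side of the equation. -/
theorem HasForm.residual (hr : r = ∞ ∨ r = ω) (h : HasForm r F w ε T X Θ Ψ)
    {u u' : ℝ × ℝ → ℂ} (hu : ContDiffAt ℝ 2 u w.1) (hu' : ContDiffAt ℝ 2 u' (F w).1)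
    (huw : u w.1 = w.2) (hm : ∀ᶠ q in 𝓝 w.1, (F (q, u q)).2 = u' (F (q, u q)).1) (s : ℂ) :
    Complex.I * deriv (fun t => u' (t, (F w).1.2)) (F w).1.1
      + deriv (deriv fun x => u' ((F w).1.1, x)) (F w).1.2
      + (formula ε T X Θ Ψ (w, s)).2 * u' (F w).1
    = amplitude ε T X Θ Ψ w.1 / (|deriv T w.1.1| : ℝ) * hatL (deriv T w.1.1)
      (Complex.I * deriv (fun t => u (t, w.1.2)) w.1.1
        + deriv (deriv fun x => u (w.1.1, x)) w.1.2 + s * u w.1) := by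
  obtain ⟨⟨t, x⟩, ψ⟩ := w
  simp only at huw hu hm ⊢
  have hT1 := h.deriv_ne.self_of_nhds
  have hTs := h.smooth_T
  have hXs := h.smooth_X
  have hΘs := h.smooth_Θ
  have hΨs := h.smooth_Ψ
  simp only at hT1 hTs hXs hΘs hΨs
  set c := hatL (deriv T t) with hc
  have hgraph : ContinuousAt (fun q : ℝ × ℝ => ((q, u q) : Vars)) (t, x) :=
    continuousAt_id.prodMk hu.continuousAt
  have hgt : Tendsto (fun q : ℝ × ℝ => ((q, u q) : Vars)) (𝓝 (t, x)) (𝓝 ((t, x), ψ)) := by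
    have := hgraph.tendsto; rwa [huw] at this
  have hT1c : HasDerivAt (deriv T) (deriv (deriv T) t) t := (hTs.deriv hr).hasDerivAt hr
  have hsg : ∀ᶠ q : ℝ × ℝ in 𝓝 (t, x), Real.sign (deriv T q.1) = Real.sign (deriv T t) :=
    (show ContinuousAt (fun q : ℝ × ℝ => q.1) (t, x) by fun_prop).eventually
      (eventually_sign_eq hT1c.continuousAt hT1)
  set B : ℝ × ℝ → ℝ × ℝ := fun q => (T q.1, ε * q.2 * √|deriv T q.1| + X q.1) with hB
  set E := amplitude ε T X Θ Ψ with hE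
  -- All derivatives of u' below are obtained by differentiating this identity along the coordinate
  -- lines of the old variables.
  have hEq : ∀ᶠ q in 𝓝 (t, x), u' (B q) = E q * c (u q) := by
    filter_upwards [hm, hgt.eventually h.eq, hsg] with q h1 h2 h3
    rw [h2] at h1
    simp only at h1
    rw [← h1, hat_eq_hatL, hatL_congr h3, mul_comm]
  have hp : (F ((t, x), ψ)).1 = B (t, x) := by rw [h.eq.self_of_nhds]
  rw [hp] at hu' ⊢
  set a := √|deriv T t| with ha
  have ha0 : 0 < a := Real.sqrt_pos.2 (abs_pos.2 hT1)
  have ha2 : |deriv T t| = a ^ 2 := (Real.sq_sqrt (abs_nonneg _)).symm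
  set σ := Real.sign (deriv T t) with hσ
  have hTa : deriv T t = σ * a ^ 2 := by rw [← ha2, sign_mul_abs]
  have hσ1 : σ = 1 ∨ σ = -1 := sign_eq_of_ne hT1
  -- derivatives with respect to `x`
  have hline : ∀ {Q : ℝ × ℝ → Prop}, (∀ᶠ q in 𝓝 (t, x), Q q) → ∀ᶠ y in 𝓝 x, Q (t, y) := fun hQ =>
    eventually_snd_line (p := (t, x)) hQ
  set ux : ℝ → ℂ := deriv fun y => u (t, y) with hux
  have huy : ∀ᶠ y in 𝓝 x, HasDerivAt (fun y => u (t, y)) (ux y) y := by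
    filter_upwards [hline (eventually_differentiableAt hu)] with y hy
    have h2 : HasDerivAt (fun y : ℝ => (t, y)) ((0 : ℝ), (1 : ℝ)) y :=
      (hasDerivAt_const y t).prodMk (hasDerivAt_id y)
    exact (hy.hasFDerivAt.comp_hasDerivAt (x := y) (f := fun y : ℝ => (t, y)) h2).differentiableAt.hasDerivAt
  have huxx : HasDerivAt ux (deriv ux x) x := by
    have e : ux =ᶠ[𝓝 x] fun y => fderiv ℝ u (t, y) (0, 1) := by
      filter_upwards [hline (eventually_differentiableAt hu)] with y hy
      exact deriv_snd_eq_fderiv (p := (t, y)) hy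
    have h2 : HasDerivAt (fun y : ℝ => (t, y)) ((0 : ℝ), (1 : ℝ)) x :=
      (hasDerivAt_const x t).prodMk (hasDerivAt_id x)
    have h3 := ((differentiableAt_fderiv hu).hasFDerivAt.comp_hasDerivAt (x := x)
      (f := fun y : ℝ => (t, y)) h2).clm_apply (hasDerivAt_const x ((0 : ℝ), (1 : ℝ)))
    exact (h3.congr_of_eventuallyEq e).differentiableAt.hasDerivAt
  set η : ℝ → ℝ := fun y => 2 * phase₂ T t * y + phase₁ ε T X t with hη
  have hEy : ∀ y, HasDerivAt (fun y => E (t, y)) (Complex.I * η y * E (t, y)) y :=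
    fun y => hasDerivAt_amplitude_snd t y
  have hηy : ∀ y, HasDerivAt (fun y => ((η y : ℝ) : ℂ)) ((2 * phase₂ T t : ℝ) : ℂ) y := by
    intro y
    refine HasDerivAt.ofReal_comp ?_
    exact (((hasDerivAt_id y).const_mul (2 * phase₂ T t)).add_const
      (phase₁ ε T X t)).congr_deriv (mul_one _)
  have hBc : ContinuousAt (fun y => B (t, y)) x := by
    simp only [hB]; fun_prop
  set L := fderiv ℝ u' (B (t, x)) with hL
  set κ := ε * a with hκ
  have hBy : ∀ y, HasDerivAt (fun y => B (t, y)) ((0 : ℝ), κ) y := by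
    intro y
    refine (hasDerivAt_const y (T t)).prodMk ?_
    have := (((hasDerivAt_id y).const_mul ε).mul_const a).add_const (X t)
    simpa using this
  -- Needed on a neighbourhood, since it is differentiated once more in x.
  have hstep : ∀ᶠ y in 𝓝 x, fderiv ℝ u' (B (t, y)) (0, κ)
      = Complex.I * η y * E (t, y) * c (u (t, y)) + E (t, y) * c (ux y) := by
    filter_upwards [hBc.eventually (eventually_differentiableAt hu'), (hline hEq).eventually_nhds,
      huy] with y h1 h2 h3
    have h4 := h1.hasFDerivAt.comp_hasDerivAt (x := y) (f := fun y => B (t, y)) (hBy y)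
    exact h4.unique (((hEy y).mul (hasDerivAt_hatL h3)).congr_of_eventuallyEq h2)
  have hux0 := hstep.self_of_nhds
  have huxx0 : fderiv ℝ (fderiv ℝ u') (B (t, x)) (0, κ) (0, κ)
      = ((Complex.I * ((2 * phase₂ T t : ℝ) : ℂ) * E (t, x)
          + Complex.I * η x * (Complex.I * η x * E (t, x))) * c (u (t, x))
        + Complex.I * η x * E (t, x) * c (ux x))
        + (Complex.I * η x * E (t, x) * c (ux x) + E (t, x) * c (deriv ux x)) := by
    have h4 := ((differentiableAt_fderiv hu').hasFDerivAt.comp_hasDerivAt (x := x)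
      (f := fun y => B (t, y)) (hBy x)).clm_apply (hasDerivAt_const x ((0 : ℝ), κ))
    have h5 := (((((hηy x).const_mul Complex.I).mul (hEy x)).mul
      (hasDerivAt_hatL (σ := deriv T t) huy.self_of_nhds)).add
      ((hEy x).mul (hasDerivAt_hatL (σ := deriv T t) huxx)))
    have h6 := h4.unique (h5.congr_of_eventuallyEq hstep)
    simpa using h6
  -- derivatives with respect to `t`
  have hut : HasDerivAt (fun s => u (s, x)) (deriv (fun s => u (s, x)) t) t := by
    have h2 : HasDerivAt (fun s : ℝ => (s, x)) ((1 : ℝ), (0 : ℝ)) t :=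
      (hasDerivAt_id t).prodMk (hasDerivAt_const t x)
    exact ((hu.differentiableAt (by norm_num)).hasFDerivAt.comp_hasDerivAt (x := t)
      (f := fun s : ℝ => (s, x)) h2).differentiableAt.hasDerivAt
  set Xt := ε * x * (σ * deriv (deriv T) t / (2 * a)) + deriv X t with hXt
  have hBt : HasDerivAt (fun s => B (s, x)) (deriv T t, Xt) t :=
    (hTs.hasDerivAt hr).prodMk
      (((hasDerivAt_sqrt_abs hT1c hT1).const_mul (ε * x)).add (hXs.hasDerivAt hr))
  have hd2 := hasDerivAt_phase₂ hr hTs hT1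
  have hd1 := hasDerivAt_phase₁ (ε := ε) hr hTs hXs hT1
  rw [← hσ, ha2] at hd2
  rw [← hσ, ← ha] at hd1
  have hEt := hasDerivAt_amplitude_fst (x := x) hr hd2 hd1 hΘs hΨs
  have hlinet : ∀ᶠ s in 𝓝 t, u' (B (s, x)) = E (s, x) * c (u (s, x)) :=
    (show ContinuousAt (fun s : ℝ => (s, x)) t by fun_prop).eventually hEq
  have hut0 := ((hu'.differentiableAt (by norm_num)).hasFDerivAt.comp_hasDerivAt (x := t)
    (f := fun s => B (s, x)) hBt).unique
    ((hEt.mul (hasDerivAt_hatL (σ := deriv T t) hut)).congr_of_eventuallyEq hlinet)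
  -- conclusion
  have hXd : deriv (fun s => deriv X s / deriv T s) t
      = (deriv (deriv X) t * deriv T t - deriv X t * deriv (deriv T) t) / deriv T t ^ 2 :=
    (((hXs.deriv hr).hasDerivAt hr).div hT1c hT1).deriv
  rw [deriv_fst_eq_fderiv (hu'.differentiableAt (by norm_num)), deriv_deriv_snd_eq_fderiv hu']
  have e1 : ((0 : ℝ), κ) = κ • ((0 : ℝ), (1 : ℝ)) := by ext <;> simp
  have e2 : (deriv T t, Xt) = deriv T t • ((1 : ℝ), (0 : ℝ)) + Xt • ((0 : ℝ), (1 : ℝ)) := by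
    ext <;> simp
  rw [e1] at hux0 huxx0
  rw [e2] at hut0
  simp only [map_smul, map_add, smul_apply, Complex.real_smul] at hux0 huxx0 hut0
  rw [← hE, ← hc] at hut0
  rw [hEq.self_of_nhds]
  have hs' : (formula ε T X Θ Ψ (((t, x), ψ), s)).2 = c s / (|deriv T t| : ℝ)
      + ((2 * deriv (deriv (deriv T)) t * deriv T t - 3 * deriv (deriv T) t ^ 2)
          / (16 * σ * deriv T t ^ 3) * x ^ 2
        + ε * σ / (2 * a) * deriv (fun s => deriv X s / deriv T s) t * x : ℝ)
      + ((deriv Ψ t : ℝ) - Complex.I * (deriv Θ t : ℝ)) / ((deriv T t : ℝ) : ℂ)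
      - (((deriv X t : ℝ) : ℂ) ^ 2 + Complex.I * ((deriv (deriv T) t : ℝ) : ℂ)) / (4 * ((deriv T t : ℝ) : ℂ) ^ 2) := by
    simp only [formula, hat_eq_hatL, ← hσ, ← ha, ← hc]
  rw [hs', hXd]
  -- Conjugation reverses the sign of the time-derivative term; the negative T_t compensates for it.
  have hcI : c Complex.I = σ * Complex.I := by
    rw [hc, hatL_apply]
    rcases lt_or_gt_of_ne hT1 with h1 | h1
    · rw [if_neg (not_lt.2 h1.le), hσ, Real.sign_of_neg h1]; simp
    · rw [if_pos h1, hσ, Real.sign_of_pos h1]; simp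
  simp only [map_add, hc, hatL_mul]
  simp only [← hc, hcI]
  have hp2 : phase₂ T t = 1 / 8 * (deriv (deriv T) t / |deriv T t|) := rfl
  have hp1 : phase₁ ε T X t = 1 / 2 * (ε * σ * deriv X t / a) := rfl
  simp only [hη, hp2, hp1, ha2] at hux0 huxx0 hut0
  rw [ha2]
  have hκ0 : (κ : ℂ) ≠ 0 := by
    have : κ ≠ 0 := by
      rcases h.eps with h1 | h1 <;> simp [hκ, h1, ha0.ne']
    exact_mod_cast this
  have hTc : ((deriv T t : ℝ) : ℂ) ≠ 0 := by exact_mod_cast hT1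
  have hκ2 : (κ : ℂ) ^ 2 = (a : ℂ) ^ 2 := by
    have : κ ^ 2 = a ^ 2 := by rcases h.eps with h1 | h1 <;> simp [hκ, h1]
    exact_mod_cast this
  have g2 := (eq_div_iff hκ0).2 ((mul_comm _ _).trans hux0)
  have haC : (a : ℂ) ≠ 0 := by exact_mod_cast ha0.ne'
  have g22 := (eq_div_iff (pow_ne_zero 2 hκ0)).2 ((show
    fderiv ℝ (fderiv ℝ u') (B (t, x)) (0, 1) (0, 1) * (κ : ℂ) ^ 2
      = κ * (κ * fderiv ℝ (fderiv ℝ u') (B (t, x)) (0, 1) (0, 1)) by ring).trans huxx0)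
  rw [hκ2] at g22
  have g1 := (eq_div_iff hTc).2 ((mul_comm _ _).trans (eq_sub_of_add_eq hut0))
  rw [g1, g22, g2]
  simp only [hXt, hκ, hTa]
  generalize E (t, x) = e0
  generalize c (u (t, x)) = U
  generalize c (ux x) = Ux
  generalize c (deriv ux x) = Uxx
  generalize c (deriv (fun s => u (s, x)) t) = Ut
  generalize c s = cs
  generalize deriv (deriv (deriv T)) t = T3
  generalize deriv (deriv T) t = T2
  generalize deriv (deriv X) t = X2
  generalize deriv X t = X1
  generalize deriv Ψ t = P1
  generalize deriv Θ t = Q1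
  have hI := Complex.I_sq
  have hI' : Complex.I ^ 2 + 1 = 0 := by rw [hI]; ring
  -- The two sides agree as polynomials in i only modulo i² + 1. The displayed cofactor makes their
  -- difference an identity that `ring` can check with i as an indeterminate.
  refine sub_eq_zero.1 (Eq.trans (b := e0 * U * (
    (1 / 8 * ((T3 * a ^ 2 - T2 * (σ * T2)) / (a ^ 2) ^ 2) * x ^ 2
      + 1 / 2 * ((ε * σ * X2 * a - ε * σ * X1 * (σ * T2 / (2 * a))) / a ^ 2) * x + P1 : ℂ)
        / (σ * a ^ 2)
    - (ε * x * (σ * T2 / (2 * a)) + X1) * (2 * (1 / 8 * (T2 / a ^ 2)) * x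
        + 1 / 2 * (ε * σ * X1 / a)) / (ε * a) / (σ * a ^ 2)
    + (2 * (1 / 8 * (T2 / a ^ 2)) * x + 1 / 2 * (ε * σ * X1 / a)) ^ 2 / a ^ 2) * (Complex.I ^ 2 + 1)) ?_
    (by rw [hI', mul_zero]))
  push_cast
  rcases h.eps with h1 | h1 <;> rcases hσ1 with h2 | h2 <;> rw [h1, h2] <;> push_cast <;>
    field_simp <;> ring

end
end NSE

/-! ### The form of transformations between equations with modular nonlinearities -/

namespace NSE

section
variable {r : WithTop ℕ∞} {z w : Vars} {ε : ℝ} {T X Θ Ψ : ℝ → ℝ}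

theorem hatL_eq_zero_iff {σ : ℝ} {a : ℂ} : hatL σ a = 0 ↔ a = 0 := by
  rw [← norm_eq_zero, norm_hatL, norm_eq_zero]

theorem HasForm.eps_ne {F : Vars → Vars} (h : HasForm r F w ε T X Θ Ψ) : ε ≠ 0 := by
  rcases h.eps with h | h <;> simp [h]

/-- A single test function through each point, satisfying the equation there, is what makes the
target potential recoverable. Its image is the graph of a function because the base map involves
only t and x and is nondegenerate. -/
theorem HasForm.exists_solution (hr : r = ∞ ∨ r = ω) {φ : PointTransf r Vars}
    (hw : w ∈ φ.toHomeo.source) (h : HasForm r φ.toHomeo w ε T X Θ Ψ) (s : ℂ) :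
    ∃ u u' : ℝ × ℝ → ℂ, ContDiffAt ℝ 2 u w.1 ∧ ContDiffAt ℝ 2 u' (φ.toHomeo w).1 ∧ u w.1 = w.2 ∧
      (∀ᶠ q in 𝓝 w.1, (φ.toHomeo (q, u q)).2 = u' (φ.toHomeo (q, u q)).1) ∧
      Complex.I * deriv (fun t => u (t, w.1.2)) w.1.1
        + deriv (deriv fun x => u (w.1.1, x)) w.1.2 + s * u w.1 = 0 := by
  set F := φ.toHomeo
  obtain ⟨⟨t, x⟩, ψ⟩ := w
  -- Here u_t = 0 and u_xx = -s ψ.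
  let u : ℝ × ℝ → ℂ := fun q => ψ + (-(s * ψ) / 2) * ((q.2 - x : ℝ) : ℂ) ^ 2
  have hu : ContDiff ℝ 2 u := contDiff_const.add (contDiff_const.mul
    ((Complex.ofRealCLM.contDiff.comp (contDiff_snd.sub contDiff_const)).pow 2))
  have hu0 : u (t, x) = ψ := by simp [u]
  have hF : ContDiffAt ℝ 2 F ((t, x), u (t, x)) := by
    rw [hu0]; exact (φ.contDiffAt hw).of_le (two_le_of_smooth hr)
  let g : ℝ × ℝ → Vars := fun q => F (q, u q)
  have hg : ContDiffAt ℝ 2 g (t, x) :=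
    ContDiffAt.comp (g := F) (f := fun y => (y, u y)) (t, x) hF (contDiffAt_id.prodMk hu.contDiffAt)
  have hT : HasDerivAt T (deriv T t) t := h.smooth_T.hasDerivAt hr
  have hT0 : deriv T t ≠ 0 := h.deriv_ne.self_of_nhds
  have hT1 := (h.smooth_T.deriv hr).hasDerivAt hr
  have hX : HasDerivAt X (deriv X t) t := h.smooth_X.hasDerivAt hr
  have hinj : Function.Injective fun v => (fderiv ℝ g (t, x) v).1 := by
    have h1 : HasFDerivAt (fun q => (g q).1) _ (t, x) :=
      (hg.differentiableAt (by norm_num)).hasFDerivAt.fst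
    have hX2 : HasFDerivAt (fun q : ℝ × ℝ => X q.1) _ (t, x) :=
      HasDerivAt.comp_hasFDerivAt (f := Prod.fst) (t, x) hX
        (hasFDerivAt_fst (𝕜 := ℝ) (p := (t, x)))
    have h2 : HasFDerivAt (fun q : ℝ × ℝ => (T q.1, ε * q.2 * √|deriv T q.1| + X q.1)) _ (t, x) :=
      (HasDerivAt.comp_hasFDerivAt (t, x) hT hasFDerivAt_fst).prodMk
        (((hasFDerivAt_snd.const_mul ε).mul (HasDerivAt.comp_hasFDerivAt (t, x)
          (hasDerivAt_sqrt_abs hT1 hT0) hasFDerivAt_fst)).add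
          hX2)
    have h3 : (fun q => (g q).1) =ᶠ[𝓝 (t, x)]
        fun q : ℝ × ℝ => (T q.1, ε * q.2 * √|deriv T q.1| + X q.1) := by
      have hc : Tendsto (fun q : ℝ × ℝ => ((q, u q) : Vars)) (𝓝 (t, x)) (𝓝 ((t, x), ψ)) := by
        have : ContinuousAt (fun q : ℝ × ℝ => ((q, u q) : Vars)) (t, x) :=
          continuousAt_id.prodMk hu.continuous.continuousAt
        rw [ContinuousAt, hu0] at this
        exact this
      filter_upwards [hc.eventually h.eq] with q hq
      simp only [g, hq]
    have h4 := h1.unique (h2.congr_of_eventuallyEq h3)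
    have h5 : ∀ v, (fderiv ℝ g (t, x) v).1 = _ := fun v => DFunLike.congr_fun h4 v
    intro a b hab
    simp only [h5] at hab
    have e1 := congrArg Prod.fst hab
    have e2 := congrArg Prod.snd hab
    simp [hT0] at e1
    have hs : √|deriv T t| ≠ 0 := (Real.sqrt_pos.2 (abs_pos.2 hT0)).ne'
    simp [e1, hs, h.eps_ne] at e2
    exact Prod.ext e1 e2
  have hbij : Function.Bijective fun v => (fderiv ℝ g (t, x) v).1 := by
    let A : (ℝ × ℝ) →L[ℝ] (ℝ × ℝ) := (ContinuousLinearMap.fst ℝ (ℝ × ℝ) ℂ).comp (fderiv ℝ g (t, x))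
    exact ⟨hinj, LinearMap.injective_iff_surjective (f := A.toLinearMap).1 hinj⟩
  obtain ⟨u', hu', hm⟩ := exists_image_function hg hbij
  refine ⟨u, u', hu.contDiffAt, ?_, hu0, hm, ?_⟩
  · simpa [g, hu0] using hu'
  · have e1 : deriv (fun t => u (t, x)) t = 0 := by simp [u]
    have e2 : ∀ y : ℝ, HasDerivAt (fun y => u (t, y)) (-(s * ψ) * ((y - x : ℝ) : ℂ)) y := by
      intro y
      have := (((((hasDerivAt_id y).sub_const x).ofReal_comp).pow 2).const_mul
        (-(s * ψ) / 2)).const_add ψ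
      refine this.congr_deriv ?_
      simp; ring
    have e3 : deriv (fun y => u (t, y)) = fun y : ℝ => -(s * ψ) * ((y - x : ℝ) : ℂ) :=
      funext fun y => (e2 y).deriv
    have e4 : HasDerivAt (fun y : ℝ => -(s * ψ) * ((y - x : ℝ) : ℂ)) (-(s * ψ)) x := by
      have := (((hasDerivAt_id x).sub_const x).ofReal_comp).const_mul (-(s * ψ))
      exact this.congr_deriv (by simp)
    simp only [e1, e3, e4.deriv, hu0]
    ring

/-- By `HasForm.residual` the target expression with the potential of `formula` is a nonzero
multiple of the possibly conjugated source expression, which gives sufficiency. For necessity, a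
test function solving the source equation makes the target expression vanish with either potential;
since ψ̃ ≠ 0, the potentials coincide. -/
theorem mapsEquation_iff (hr : r = ∞ ∨ r = ω) {φ : PointTransf r Vars}
    (hz : z ∈ φ.toHomeo.source) (h : HasForm r φ.toHomeo z ε T X Θ Ψ) (hz0 : z.2 ≠ 0)
    {S S' : Vars → ℂ} :
    MapsEquation φ.toHomeo S S' z ↔
      ∀ᶠ w in 𝓝 z, S' (φ.toHomeo w) = (formula ε T X Θ Ψ (w, S w)).2 := by
  have hsrc : ∀ᶠ w in 𝓝 z, w ∈ φ.toHomeo.source := φ.toHomeo.open_source.mem_nhds hz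
  have hne : ∀ᶠ w : Vars in 𝓝 z, w.2 ≠ 0 := continuous_snd.continuousAt.eventually_ne hz0
  have hk : ∀ w, HasForm r φ.toHomeo w ε T X Θ Ψ →
      amplitude ε T X Θ Ψ w.1 / (|deriv T w.1.1| : ℝ) ≠ 0 := fun w hw =>
    div_ne_zero (amplitude_ne_zero _ _ _ _ _ _)
      (by exact_mod_cast (abs_pos.2 hw.deriv_ne.self_of_nhds).ne')
  constructor
  · intro hM
    filter_upwards [hM, h.eventually, hsrc, hne] with w hMw hw hws hw0
    obtain ⟨u, u', hu, hu', huw, hm, hsol⟩ := hw.exists_solution hr hws (S w)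
    have h1 := hw.residual hr hu hu' huw hm (S w)
    rw [hsol, map_zero, mul_zero] at h1
    have h2 := (hMw u u' hu hu' huw hm).1 (by
      unfold SolvesAt; rw [huw] at hsol ⊢; exact hsol)
    have h3 : u' (φ.toHomeo w).1 = (φ.toHomeo w).2 := by
      have := hm.self_of_nhds
      rw [huw] at this
      exact this.symm
    unfold SolvesAt at h2
    rw [h3] at h1 h2
    have h4 : ((φ.toHomeo w).1, (φ.toHomeo w).2) = φ.toHomeo w := rfl
    rw [h4] at h2
    have h5 : (φ.toHomeo w).2 ≠ 0 := by
      rw [hw.eq.self_of_nhds, hat_eq_hatL]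
      exact mul_ne_zero (by simpa [hatL_eq_zero_iff] using hw0) (amplitude_ne_zero _ _ _ _ _ _)
    exact mul_right_cancel₀ h5 (by linear_combination h2 - h1)
  · intro hS
    filter_upwards [hS, h.eventually] with w hSw hw u u' hu hu' huw hm
    have h1 := hw.residual hr hu hu' huw hm (S w)
    have h3 : u' (φ.toHomeo w).1 = (φ.toHomeo w).2 := by
      have := hm.self_of_nhds
      rw [huw] at this
      exact this.symm
    unfold SolvesAt
    have h4 : ((φ.toHomeo w).1, u' (φ.toHomeo w).1) = φ.toHomeo w := by rw [h3]
    have h6 : (w.1, u w.1) = w := by rw [huw]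
    rw [h4, hSw, h1, h6, mul_eq_zero, or_iff_right (hk w hw), hatL_eq_zero_iff]

theorem contDiffAt_complex_div {E : Type*} [NormedAddCommGroup E] [NormedSpace ℝ E] {g h : E → ℂ}
    {a : E} (hg : ContDiffAt ℝ r g a) (hh : ContDiffAt ℝ r h a) (h0 : h a ≠ 0) :
    ContDiffAt ℝ r (fun y => g y / h y) a := by
  simp only [div_eq_mul_inv]
  exact hg.mul (hh.inv h0)

theorem contDiffAt_sign {g : ℝ → ℝ} {a : ℝ} (hg : ContinuousAt g a) (h0 : g a ≠ 0) :
    ContDiffAt ℝ r (fun t => Real.sign (g t)) a :=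
  contDiffAt_const.congr_of_eventuallyEq (eventually_sign_eq hg h0)

theorem smoothNear_phase₂ (hr : r = ∞ ∨ r = ω) {t : ℝ} (hT : SmoothNear r T t)
    (h0 : ∀ᶠ s in 𝓝 t, deriv T s ≠ 0) : SmoothNear r (phase₂ T) t := by
  filter_upwards [(hT.deriv hr).sqrt_abs h0, (hT.deriv hr).deriv hr, h0] with s h1 h2 h3
  have h4 : (fun s => |deriv T s|) = fun s => √|deriv T s| ^ 2 := by
    ext s; exact (Real.sq_sqrt (abs_nonneg _)).symm
  have h5 : ContDiffAt ℝ r (fun s => |deriv T s|) s := by rw [h4]; exact h1.pow 2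
  exact contDiffAt_const.mul (h2.div h5 (abs_pos.2 h3).ne')

theorem smoothNear_phase₁ (hr : r = ∞ ∨ r = ω) {t : ℝ} (hT : SmoothNear r T t)
    (hX : SmoothNear r X t) (h0 : ∀ᶠ s in 𝓝 t, deriv T s ≠ 0) :
    SmoothNear r (phase₁ ε T X) t := by
  filter_upwards [(hT.deriv hr).sqrt_abs h0, hT.deriv hr, hX.deriv hr, h0] with s h1 h2 h3 h4
  exact contDiffAt_const.mul (((contDiffAt_const.mul
    (contDiffAt_sign h2.continuousAt h4)).mul h3).div h1 (Real.sqrt_pos.2 (abs_pos.2 h4)).ne')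

/-- Every point transformation between two equations with modular nonlinearities has the form
`formula`. -/
theorem exists_hasForm (hr : r = ∞ ∨ r = ω) {φ : PointTransf r Vars}
    (hz : z ∈ φ.toHomeo.source) {S S' : Vars → ℂ} {f g : ℝ → ℂ} {V V' : ℝ × ℝ → ℂ}
    (hS : Splits r z S f V) (hS' : Splits r (φ.toHomeo z) S' g V')
    (hM : MapsEquation φ.toHomeo S S' z) :
    ∃ (ε : ℝ) (T X Θ Ψ : ℝ → ℝ), HasForm r φ.toHomeo z ε T X Θ Ψ := by
  obtain ⟨ε, T, X, A, C, α, β, hε, hT, hX, hA, hT0, hA0, hF, hAx, hrest⟩ :=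
    exists_affine_form hr hz hM
  obtain ⟨⟨t₀, x₀⟩, ψ₀⟩ := z
  simp only at hT hX hA hT0 hA0 hAx
  obtain ⟨hψ₀, hfs, -, hf', hSf⟩ := hS
  obtain ⟨-, -, -, -, hSg⟩ := hS'
  simp only at hψ₀ hfs hf'
  -- the shift vanishes
  have hcF : Tendsto φ.toHomeo (𝓝 ((t₀, x₀), ψ₀)) (𝓝 (φ.toHomeo ((t₀, x₀), ψ₀))) :=
    (φ.contDiffAt hz).continuousAt
  have hall : ∀ᶠ w in 𝓝 (((t₀, x₀), ψ₀) : Vars), g ‖A w.1 * hat T w.1.1 w.2 + C w.1‖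
      * (A w.1 * hat T w.1.1 w.2 + C w.1)
      = A w.1 / (|deriv T w.1.1| : ℝ) * hatL (deriv T w.1.1) (f ‖w.2‖) * hat T w.1.1 w.2
        + (A w.1 / (|deriv T w.1.1| : ℝ) * hatL (deriv T w.1.1) (V w.1)
          - V' (T w.1.1, ε * w.1.2 * √|deriv T w.1.1| + X w.1.1) * A w.1 - α w.1) * hat T w.1.1 w.2
        + (-β w.1 - V' (T w.1.1, ε * w.1.2 * √|deriv T w.1.1| + X w.1.1) * C w.1) := by
    filter_upwards [hrest, hSf, hcF.eventually hSg, hF] with w h1 h2 h3 h4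
    rw [h3, h2, h4] at h1
    simp only at h1
    rw [hat_eq_hatL T w.1.1 (_ * w.2), hatL_mul, map_add, ← hat_eq_hatL T w.1.1 w.2] at h1
    linear_combination h1
  -- For fixed (t, x) the relation is an identity in y = ψ̂, to which `shift_eq_zero` applies; the
  -- conjugated `f` plays the role of its nonlinearity.
  have hC : ∀ᶠ q in 𝓝 (t₀, x₀), C q = 0 := by
    have hT0' : ∀ᶠ q : ℝ × ℝ in 𝓝 (t₀, x₀), deriv T q.1 ≠ 0 :=
      (show ContinuousAt (fun q : ℝ × ℝ => q.1) (t₀, x₀) by fun_prop).eventually hT0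
    filter_upwards [hall.curry_nhds, hA0, hT0'] with q hq hAq hTq
    have hn : ‖hatL (deriv T q.1) ψ₀‖ = ‖ψ₀‖ := norm_hatL _ _
    refine shift_eq_zero (a := A q) (y₀ := hatL (deriv T q.1) ψ₀) (k := A q / (|deriv T q.1| : ℝ))
      (f := fun ρ => hatL (deriv T q.1) (f ρ)) (g := g) hAq
      (div_ne_zero hAq (by exact_mod_cast (abs_pos.2 hTq).ne')) (by rwa [Ne, hatL_eq_zero_iff])
      ?_ ?_ (α := A q / (|deriv T q.1| : ℝ) * hatL (deriv T q.1) (V q)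
          - V' (T q.1, ε * q.2 * √|deriv T q.1| + X q.1) * A q - α q)
      (β := -β q - V' (T q.1, ε * q.2 * √|deriv T q.1| + X q.1) * C q) ?_
    · rw [hn]
      exact hfs.mono fun ρ hρ => ((hatL _).differentiableAt.comp ρ
        (hρ.differentiableAt (ne_zero_of_smooth hr)))
    · rw [hn, (hasDerivAt_hatL (hfs.hasDerivAt hr)).deriv, Ne, hatL_eq_zero_iff]
      exact hf'.self_of_nhds
    · have hc : Tendsto (hatL (deriv T q.1)) (𝓝 (hatL (deriv T q.1) ψ₀)) (𝓝 ψ₀) := by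
        have := (hatL (deriv T q.1)).continuous.tendsto (hatL (deriv T q.1) ψ₀)
        rwa [hatL_hatL] at this
      filter_upwards [hc.eventually hq] with y hy
      simp only [hat_eq_hatL, hatL_hatL, norm_hatL] at hy
      exact hy
  -- the amplitude
  have hp2 := smoothNear_phase₂ hr hT hT0
  have hp1 := smoothNear_phase₁ (ε := ε) hr hT hX hT0
  let E : ℝ × ℝ → ℂ := fun q =>
    Complex.exp (Complex.I * (phase₂ T q.1 * q.2 ^ 2 + phase₁ ε T X q.1 * q.2 : ℝ))
  let G : ℝ → ℂ := fun t => A (t, x₀) / E (t, x₀)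
  have hE0 : ∀ q, E q ≠ 0 := fun q => Complex.exp_ne_zero _
  have hEx : ∀ t x : ℝ, HasDerivAt (fun y => E (t, y))
      (Complex.I * (2 * phase₂ T t * x + phase₁ ε T X t : ℝ) * E (t, x)) x := by
    intro t x
    have := hasDerivAt_amplitude_snd (ε := ε) (T := T) (X := X) (Θ := fun _ => 0)
      (Ψ := fun _ => 0) t x
    simpa [amplitude, E] using this
  -- `A` and `E` satisfy the same linear first-order equation in x, so their quotient is a function
  -- of t.
  have hAE : ∀ᶠ q in 𝓝 (t₀, x₀), A q = G q.1 * E q := by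
    have hT0' : ∀ᶠ q : ℝ × ℝ in 𝓝 (t₀, x₀), deriv T q.1 ≠ 0 :=
      (show ContinuousAt (fun q : ℝ × ℝ => q.1) (t₀, x₀) by fun_prop).eventually hT0
    have hTs' : ∀ᶠ q : ℝ × ℝ in 𝓝 (t₀, x₀), SmoothNear r T q.1 :=
      (show ContinuousAt (fun q : ℝ × ℝ => q.1) (t₀, x₀) by fun_prop).eventually
        hT.eventually_nhds
    obtain ⟨R, hR, hball⟩ := Metric.eventually_nhds_iff_ball.1 (hAx.and (hT0'.and hTs'))
    filter_upwards [Metric.ball_mem_nhds _ hR] with q hq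
    obtain ⟨t, x⟩ := q
    have hmem : ∀ y ∈ Metric.ball x₀ R, (t, y) ∈ Metric.ball ((t₀, x₀) : ℝ × ℝ) R := by
      intro y hy
      simp only [Metric.mem_ball, Prod.dist_eq, max_lt_iff] at hq hy ⊢
      exact ⟨hq.1, hy⟩
    have hd : ∀ y ∈ Metric.ball x₀ R, HasDerivAt (fun y => A (t, y) / E (t, y)) 0 y := by
      intro y hy
      obtain ⟨h1, h2, h3⟩ := hball _ (hmem y hy)
      simp only at h1 h2 h3
      refine (h1.div (hEx t y) (hE0 _)).congr_deriv ?_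
      rw [(hasDerivAt_sqrt_abs ((h3.deriv hr).hasDerivAt hr) h2).deriv]
      rw [div_eq_zero_iff]; left
      have ha0 : 0 < √|deriv T t| := Real.sqrt_pos.2 (abs_pos.2 h2)
      have e : ε * √|deriv T t| * (ε * y * (Real.sign (deriv T t) * deriv (deriv T) t
          / (2 * √|deriv T t|)) + deriv X t) / deriv T t
          = 2 * (2 * phase₂ T t * y + phase₁ ε T X t) := by
        have ha2 : |deriv T t| = √|deriv T t| ^ 2 := (Real.sq_sqrt (abs_nonneg _)).symm
        have hTa : deriv T t = Real.sign (deriv T t) * √|deriv T t| ^ 2 := by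
          rw [← ha2, sign_mul_abs]
        unfold phase₂ phase₁
        set a := √|deriv T t|
        rw [ha2]
        have hσ := sign_eq_of_ne h2
        set σ := Real.sign (deriv T t)
        rw [hTa]
        rcases hε with h1 | h1 <;> rcases hσ with h2 | h2 <;> rw [h1, h2] <;> field_simp <;> ring
      rw [e]
      push_cast
      ring
    have hx₀ : x₀ ∈ Metric.ball x₀ R := Metric.mem_ball_self hR
    have hx : x ∈ Metric.ball x₀ R := by
      simp only [Metric.mem_ball, Prod.dist_eq, max_lt_iff] at hq ⊢
      exact hq.2
    have := eq_of_fderiv_apply_eq_zero (convex_ball x₀ R) hx hx₀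
      (fun y hy => (hd y hy).differentiableAt) (fun y hy => by
        rw [(hd y hy).hasFDerivAt.fderiv]; simp)
    simp only [G]
    rw [← this, div_mul_cancel₀ _ (hE0 _)]
  have hline : Tendsto (fun t : ℝ => (t, x₀)) (𝓝 t₀) (𝓝 (t₀, x₀)) :=
    (show ContinuousAt (fun t : ℝ => (t, x₀)) t₀ by fun_prop)
  have hGs : SmoothNear r G t₀ := by
    filter_upwards [hline.eventually hA, hp2, hp1] with t h1 h2 h3
    refine contDiffAt_complex_div (ContDiffAt.comp (g := A) (f := fun t : ℝ => (t, x₀)) t h1 (by fun_prop))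
      ?_ (hE0 _)
    have h4 : ContDiffAt ℝ r (fun t => phase₂ T t * x₀ ^ 2 + phase₁ ε T X t * x₀) t :=
      (h2.mul contDiffAt_const).add (h3.mul contDiffAt_const)
    have h5 : ContDiffAt ℝ r (fun t =>
        ((phase₂ T t * x₀ ^ 2 + phase₁ ε T X t * x₀ : ℝ) : ℂ)) t :=
      Complex.ofRealCLM.contDiff.contDiffAt.comp t h4
    exact (contDiffAt_const.mul h5).cexp
  have hG0 : G t₀ ≠ 0 := div_ne_zero (hline.eventually hA0).self_of_nhds (hE0 _)
  -- Dividing by G(t₀) keeps the argument near 1, away from the branch cut. The real and imaginary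
  -- parts of this logarithm are Θ and Ψ.
  let L : ℝ → ℂ := fun t => Complex.log (G t / G t₀) + Complex.log (G t₀)
  have hslit : ∀ᶠ t in 𝓝 t₀, G t / G t₀ ∈ Complex.slitPlane := by
    have hc : ContinuousAt (fun t => G t / G t₀) t₀ :=
      hGs.self_of_nhds.continuousAt.div_const _
    refine hc.eventually (Complex.isOpen_slitPlane.mem_nhds ?_)
    simp only [div_self hG0]; exact Complex.one_mem_slitPlane
  have hLs : SmoothNear r L t₀ := by
    filter_upwards [hGs, hslit] with t h1 h2
    have h3 : ContDiffAt ℝ r Complex.log (G t / G t₀) :=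
      (Complex.contDiffAt_log (n := r) h2).restrict_scalars ℝ
    exact (h3.comp t (contDiffAt_complex_div h1 contDiffAt_const hG0)).add contDiffAt_const
  have hLG : ∀ᶠ t in 𝓝 t₀, Complex.exp (L t) = G t := by
    filter_upwards [hslit] with t h
    simp only [L]
    rw [Complex.exp_add, Complex.exp_log (Complex.slitPlane_ne_zero h), Complex.exp_log hG0,
      div_mul_cancel₀ _ hG0]
  refine ⟨ε, T, X, fun t => (L t).re, fun t => (L t).im, hε, hT, hX, ?_, ?_, hT0, ?_⟩
  · filter_upwards [hLs] with t h
    exact Complex.reCLM.contDiff.contDiffAt.comp t h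
  · filter_upwards [hLs] with t h
    exact Complex.imCLM.contDiff.contDiffAt.comp t h
  · have hfst : ContinuousAt (fun w : Vars => w.1) ((t₀, x₀), ψ₀) := by fun_prop
    filter_upwards [hF, hfst.eventually hC, hfst.eventually hAE,
      eventually_time (z := ((t₀, x₀), ψ₀)) hLG] with w h1 h2 h3 h4
    have h5 : amplitude ε T X (fun t => (L t).re) (fun t => (L t).im) w.1
        = Complex.exp (L w.1.1) * E w.1 := by
      simp only [amplitude, E]
      rw [← Complex.exp_add]
      congr 1
      push_cast
      linear_combination Complex.re_add_im (L w.1.1)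
    rw [h1, h2, add_zero, h3, h5, h4, mul_comm (hat T w.1.1 w.2)]

end
end NSE

/-! ### Relations between the source and target nonlinearities -/

namespace NSE

/-- The part of the `S`-component of `formula` that does not depend on `S`. -/
noncomputable def shift (ε : ℝ) (T X Θ Ψ : ℝ → ℝ) (q : ℝ × ℝ) : ℂ :=
  ((2 * deriv (deriv (deriv T)) q.1 * deriv T q.1 - 3 * deriv (deriv T) q.1 ^ 2)
      / (16 * Real.sign (deriv T q.1) * deriv T q.1 ^ 3) * q.2 ^ 2
    + ε * Real.sign (deriv T q.1) / (2 * √|deriv T q.1|)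
      * deriv (fun s => deriv X s / deriv T s) q.1 * q.2 : ℝ)
  + ((deriv Ψ q.1 : ℝ) - Complex.I * (deriv Θ q.1 : ℝ)) / ((deriv T q.1 : ℝ) : ℂ)
  - (((deriv X q.1 : ℝ) : ℂ) ^ 2 + Complex.I * ((deriv (deriv T) q.1 : ℝ) : ℂ))
    / (4 * ((deriv T q.1 : ℝ) : ℂ) ^ 2)

theorem formula_snd (ε : ℝ) (T X Θ Ψ : ℝ → ℝ) (p : Vars × ℂ) :
    (formula ε T X Θ Ψ p).2
      = hat T p.1.1.1 p.2 / (|deriv T p.1.1.1| : ℝ) + shift ε T X Θ Ψ p.1.1 := by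
  simp only [formula, shift]
  ring

section
variable {r : WithTop ℕ∞} {F : Vars → Vars} {z w : Vars} {ε : ℝ} {T X Θ Ψ : ℝ → ℝ}
  {S S' : Vars → ℂ} {f g : ℝ → ℂ} {V V' : ℝ × ℝ → ℂ}

theorem HasForm.norm_snd (h : HasForm r F z ε T X Θ Ψ) :
    ‖(F z).2‖ = Real.exp (Θ z.1.1) * ‖z.2‖ := by
  rw [h.eq.self_of_nhds]
  simp only [norm_mul, hat_eq_hatL, norm_hatL, norm_amplitude]
  ring

theorem HasForm.eventually_hat (hr : r = ∞ ∨ r = ω) (h : HasForm r F z ε T X Θ Ψ) :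
    ∀ᶠ t in 𝓝 z.1.1, ∀ b, hat T t b = hatL (deriv T z.1.1) b := by
  filter_upwards [eventually_sign_eq ((h.smooth_T.deriv hr).hasDerivAt hr).continuousAt
    h.deriv_ne.self_of_nhds] with t ht b
  rw [hat_eq_hatL, hatL_congr ht]

/-- On a ray in ψ at fixed (t, x) the potentials are constant, so differentiation in ρ leaves only
the nonlinearities, related through |ψ̃| = e^Θ |ψ|. -/
theorem HasForm.deriv_identity (hr : r = ∞ ∨ r = ω) (h : HasForm r F z ε T X Θ Ψ)
    (hF : ContinuousAt F z) (hS : Splits r z S f V) (hS' : Splits r (F z) S' g V')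
    (hm : ∀ᶠ w in 𝓝 z, S' (F w) = (formula ε T X Θ Ψ (w, S w)).2) :
    ∀ᶠ p : ℝ × ℝ in 𝓝 (z.1.1, ‖z.2‖), hatL (deriv T z.1.1) (deriv f p.2)
      = (|deriv T p.1| * Real.exp (Θ p.1) : ℝ) * deriv g (Real.exp (Θ p.1) * p.2) := by
  obtain ⟨hz0, hf, -, -, hSe⟩ := hS
  obtain ⟨-, hg, -, -, hSe'⟩ := hS'
  have hρ0 : 0 < ‖z.2‖ := norm_pos_iff.2 hz0
  have hΘc : ContinuousAt Θ z.1.1 := (h.smooth_Θ.hasDerivAt hr).continuousAt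
  let u : ℂ := z.2 / ‖z.2‖
  have hu : ‖u‖ = 1 := by
    simp only [u, norm_div, Complex.norm_real, norm_norm, div_self hρ0.ne']
  -- The coordinate x stays fixed, but t varies, because the identity is later differentiated in t.
  let j : ℝ × ℝ → Vars := fun p => ((p.1, z.1.2), (p.2 : ℂ) * u)
  have hj : Tendsto j (𝓝 (z.1.1, ‖z.2‖)) (𝓝 z) := by
    have h1 : ContinuousAt j (z.1.1, ‖z.2‖) := by
      simp only [j]; fun_prop
    have h2 : j (z.1.1, ‖z.2‖) = z := by
      have : (‖z.2‖ : ℂ) ≠ 0 := by exact_mod_cast hρ0.ne'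
      simp only [j, u, mul_div_cancel₀ _ this]
    rwa [ContinuousAt, h2] at h1
  have hkey : ∀ᶠ p : ℝ × ℝ in 𝓝 (z.1.1, ‖z.2‖), g (Real.exp (Θ p.1) * p.2)
      = hatL (deriv T z.1.1) (f p.2) / (|deriv T p.1| : ℝ)
        + (hatL (deriv T z.1.1) (V (p.1, z.1.2)) / (|deriv T p.1| : ℝ)
          + shift ε T X Θ Ψ (p.1, z.1.2)
          - V' (T p.1, ε * z.1.2 * √|deriv T p.1| + X p.1)) := by
    have hpos : ∀ᶠ p : ℝ × ℝ in 𝓝 (z.1.1, ‖z.2‖), 0 < p.2 :=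
      (lt_mem_nhds hρ0).prod_inr_nhds _
    filter_upwards [hj.eventually hm, hj.eventually hSe, hj.eventually (hF.eventually hSe'),
      hj.eventually h.eventually, hj.eventually (eventually_time (h.eventually_hat hr)), hpos]
      with p h1 h2 h3 h4 h5 h6
    have h7 : ‖(j p).2‖ = p.2 := by
      simp only [j, norm_mul, hu, mul_one, Complex.norm_real, Real.norm_of_nonneg h6.le]
    rw [h3, h4.norm_snd, formula_snd, h2, h5, map_add, h7, h4.eq.self_of_nhds] at h1
    simp only [j] at h1
    linear_combination h1
  have hg' : ∀ᶠ p : ℝ × ℝ in 𝓝 (z.1.1, ‖z.2‖), SmoothNear r g (Real.exp (Θ p.1) * p.2) := by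
    rw [h.norm_snd] at hg
    have hc : ContinuousAt (fun p : ℝ × ℝ => Real.exp (Θ p.1) * p.2) (z.1.1, ‖z.2‖) :=
      (Real.continuous_exp.continuousAt.comp (ContinuousAt.comp (f := Prod.fst)
        (x := (z.1.1, ‖z.2‖)) hΘc continuousAt_fst)).mul continuousAt_snd
    exact hc.eventually hg.eventually_nhds
  have hf' : ∀ᶠ p : ℝ × ℝ in 𝓝 (z.1.1, ‖z.2‖), SmoothNear r f p.2 :=
    hf.eventually_nhds.prod_inr_nhds _
  have hT0 : ∀ᶠ p : ℝ × ℝ in 𝓝 (z.1.1, ‖z.2‖), deriv T p.1 ≠ 0 :=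
    h.deriv_ne.prod_inl_nhds _
  filter_upwards [hkey.eventually_nhds, hg', hf', hT0] with p h1 h2 h3 h4
  have h5 : HasDerivAt (fun ρ => g (Real.exp (Θ p.1) * ρ))
      (Real.exp (Θ p.1) • deriv g (Real.exp (Θ p.1) * p.2)) p.2 :=
    HasDerivAt.scomp (h := fun ρ : ℝ => Real.exp (Θ p.1) * ρ) p.2 (h2.hasDerivAt hr)
      (((hasDerivAt_id p.2).const_mul (Real.exp (Θ p.1))).congr_deriv (mul_one _))
  have h6 := ((hasDerivAt_hatL (σ := deriv T z.1.1) (h3.hasDerivAt hr)).div_const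
    ((|deriv T p.1| : ℝ) : ℂ)).add_const (hatL (deriv T z.1.1) (V (p.1, z.1.2)) / (|deriv T p.1| : ℝ)
          + shift ε T X Θ Ψ (p.1, z.1.2)
          - V' (T p.1, ε * z.1.2 * √|deriv T p.1| + X p.1))
  have h7 := h5.unique (h6.congr_of_eventuallyEq
    (show ∀ᶠ ρ in 𝓝 p.2, _ from
      (show ContinuousAt (fun ρ : ℝ => (p.1, ρ)) p.2 by fun_prop).eventually h1))
  have h8 : ((|deriv T p.1| : ℝ) : ℂ) ≠ 0 := by exact_mod_cast (abs_pos.2 h4).ne'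
  rw [eq_div_iff h8, Complex.real_smul] at h7
  rw [← h7]; push_cast; ring

/-- The compatibility condition of a nonlinearity `f` with the parameters `T` and `Θ`. -/
def Compatible (f : ℝ → ℂ) (T Θ : ℝ → ℝ) (p : ℝ × ℝ) : Prop :=
  ((deriv Θ p.1 : ℝ) : ℂ) * (ratio f p.2 + 1) * ((deriv T p.1 : ℝ) : ℂ)
    + ((deriv (deriv T) p.1 : ℝ) : ℂ) = 0

/-- The logarithmic ρ-derivative of `HasForm.deriv_identity` relates the two ratios. Its left-hand
side does not depend on t, so the t-derivative of the right-hand side vanishes, and this is the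
compatibility condition. -/
theorem HasForm.ratio_eq_and_compatible (hr : r = ∞ ∨ r = ω) (h : HasForm r F z ε T X Θ Ψ)
    (hF : ContinuousAt F z) (hS : Splits r z S f V) (hS' : Splits r (F z) S' g V')
    (hm : ∀ᶠ w in 𝓝 z, S' (F w) = (formula ε T X Θ Ψ (w, S w)).2) :
    ∀ᶠ p : ℝ × ℝ in 𝓝 (z.1.1, ‖z.2‖),
      ratio g (Real.exp (Θ p.1) * p.2) = hatL (deriv T z.1.1) (ratio f p.2)
      ∧ Compatible f T Θ p := by
  have hid := h.deriv_identity hr hF hS hS' hm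
  obtain ⟨hz0, hf, -, hfne, -⟩ := hS
  obtain ⟨-, hg, -, -, -⟩ := hS'
  have hΘc : ContinuousAt Θ z.1.1 := (h.smooth_Θ.hasDerivAt hr).continuousAt
  have hg' : ∀ᶠ p : ℝ × ℝ in 𝓝 (z.1.1, ‖z.2‖), SmoothNear r g (Real.exp (Θ p.1) * p.2) := by
    rw [h.norm_snd] at hg
    have hc : ContinuousAt (fun p : ℝ × ℝ => Real.exp (Θ p.1) * p.2) (z.1.1, ‖z.2‖) :=
      (Real.continuous_exp.continuousAt.comp (ContinuousAt.comp (f := Prod.fst)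
        (x := (z.1.1, ‖z.2‖)) hΘc continuousAt_fst)).mul continuousAt_snd
    exact hc.eventually hg.eventually_nhds
  have hf' : ∀ᶠ p : ℝ × ℝ in 𝓝 (z.1.1, ‖z.2‖), SmoothNear r f p.2 ∧ deriv f p.2 ≠ 0 :=
    (hf.eventually_nhds.and hfne).prod_inr_nhds _
  have hT0 : ∀ᶠ p : ℝ × ℝ in 𝓝 (z.1.1, ‖z.2‖), deriv T p.1 ≠ 0 ∧ SmoothNear r T p.1
      ∧ SmoothNear r Θ p.1 :=
    (h.deriv_ne.and (h.smooth_T.eventually_nhds.and h.smooth_Θ.eventually_nhds)).prod_inl_nhds _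
  filter_upwards [hid.eventually_nhds, hg', hf', hT0] with p h1 h2 h3 h4
  obtain ⟨t, ρ⟩ := p
  obtain ⟨h3, h3'⟩ := h3
  obtain ⟨h4, hT, hΘ⟩ := h4
  simp only at h2 h3 h3' h4 hT hΘ ⊢
  have h10 := h1.self_of_nhds
  simp only at h10
  set c := hatL (deriv T z.1.1)
  set m := |deriv T t| with hm
  set E := Real.exp (Θ t)
  have hm0 : m ≠ 0 := (abs_pos.2 h4).ne'
  have hE0 : E ≠ 0 := (Real.exp_pos _).ne'
  have hmC : (m : ℂ) ≠ 0 := by exact_mod_cast hm0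
  have hEC : (E : ℂ) ≠ 0 := by exact_mod_cast hE0
  -- derivative with respect to `ρ`
  have h5 : HasDerivAt (fun ρ => ((m * E : ℝ) : ℂ) * deriv g (E * ρ))
      (((m * E : ℝ) : ℂ) * (E • deriv (deriv g) (E * ρ))) ρ :=
    (HasDerivAt.scomp (h := fun ρ : ℝ => E * ρ) ρ ((h2.deriv hr).hasDerivAt hr)
      (((hasDerivAt_id ρ).const_mul E).congr_deriv (mul_one _))).const_mul _
  have h6 := (hasDerivAt_hatL (σ := deriv T z.1.1) ((h3.deriv hr).hasDerivAt hr)).unique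
    (h5.congr_of_eventuallyEq (show ∀ᶠ ρ in 𝓝 ρ, _ from
      (show ContinuousAt (fun ρ : ℝ => (t, ρ)) ρ by fun_prop).eventually h1))
  -- derivative with respect to `t`
  have h7 : HasDerivAt (fun s => ((|deriv T s| * Real.exp (Θ s) : ℝ) : ℂ))
      ((Real.sign (deriv T t) * deriv (deriv T) t * E + m * (E * deriv Θ t) : ℝ) : ℂ) t :=
    ((hasDerivAt_abs_comp ((hT.deriv hr).hasDerivAt hr) h4).mul (hΘ.hasDerivAt hr).exp).ofReal_comp
  have h8 : HasDerivAt (fun s => deriv g (Real.exp (Θ s) * ρ))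
      ((E * deriv Θ t * ρ) • deriv (deriv g) (E * ρ)) t :=
    HasDerivAt.scomp (h := fun s : ℝ => Real.exp (Θ s) * ρ) t ((h2.deriv hr).hasDerivAt hr)
      ((hΘ.hasDerivAt hr).exp.mul_const ρ)
  have h9 := (hasDerivAt_const t (c (deriv f ρ))).unique
    ((h7.mul h8).congr_of_eventuallyEq (show ∀ᶠ s in 𝓝 t, _ from
      (show ContinuousAt (fun s : ℝ => (s, ρ)) t by fun_prop).eventually h1))
  change c (deriv (deriv f) ρ) = _ at h6
  rw [Complex.real_smul] at h6 h9
  change _ = _ * deriv g (E * ρ) + ((m * E : ℝ) : ℂ) * _ at h9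
  have hg0 : deriv g (E * ρ) ≠ 0 := by
    intro h0
    rw [h0, mul_zero, hatL_eq_zero_iff] at h10
    exact h3' h10
  have hcf0 : c (deriv f ρ) ≠ 0 := by rwa [Ne, hatL_eq_zero_iff]
  have hr1 : c (ratio f ρ) = ρ * c (deriv (deriv f) ρ) / c (deriv f ρ) := by
    rw [eq_div_iff hcf0, ← hatL_mul, ratio, div_mul_cancel₀ _ h3', hatL_mul, hatL_ofReal]
  have hr2 : ratio g (E * ρ) = c (ratio f ρ) := by
    rw [hr1, h6, h10, ratio]
    push_cast
    field_simp
  refine ⟨hr2, ?_⟩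
  have hr3 : ((E * ρ : ℝ) : ℂ) * deriv (deriv g) (E * ρ) = ratio g (E * ρ) * deriv g (E * ρ) := by
    rw [ratio, div_mul_cancel₀ _ hg0]
  have hTm : deriv T t = Real.sign (deriv T t) * m := (sign_mul_abs _).symm
  -- The t-derivative yields the condition for the ratio of `g`, the conjugate one if T_t < 0. Since
  -- T and Θ are real, the condition for `f` follows by undoing the conjugation.
  have e : c (((deriv Θ t : ℝ) : ℂ) * (ratio f ρ + 1) * ((deriv T t : ℝ) : ℂ)
      + ((deriv (deriv T) t : ℝ) : ℂ)) = 0 := by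
    simp only [map_add, hatL_mul, hatL_ofReal, hatL_one, c]
    change ((deriv Θ t : ℝ) : ℂ) * (c (ratio f ρ) + 1) * ((deriv T t : ℝ) : ℂ)
      + ((deriv (deriv T) t : ℝ) : ℂ) = 0
    rw [← hr2]
    refine mul_left_cancel₀ (mul_ne_zero hEC hg0) ?_
    rw [mul_zero]
    have hσ := sign_eq_of_ne h4
    generalize Real.sign (deriv T t) = σ at *
    rw [hTm]
    push_cast at h9 hr3 ⊢
    rcases hσ with rfl | rfl
    · push_cast at h9 ⊢
      linear_combination -h9 - m * E * ((deriv Θ t : ℝ) : ℂ) * hr3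
    · push_cast at h9 ⊢
      linear_combination h9 + m * E * ((deriv Θ t : ℝ) : ℂ) * hr3
  exact hatL_eq_zero_iff.1 e

theorem smoothNear_shift (hr : r = ∞ ∨ r = ω) (h : HasForm r F z ε T X Θ Ψ) :
    SmoothNear r (shift ε T X Θ Ψ) z.1 := by
  have hev : ∀ᶠ t in 𝓝 z.1.1, SmoothNear r T t ∧ SmoothNear r X t ∧ SmoothNear r Θ t ∧
      SmoothNear r Ψ t ∧ ∀ᶠ s in 𝓝 t, deriv T s ≠ 0 :=
    h.smooth_T.eventually_nhds.and (h.smooth_X.eventually_nhds.and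
      (h.smooth_Θ.eventually_nhds.and (h.smooth_Ψ.eventually_nhds.and
        h.deriv_ne.eventually_nhds)))
  filter_upwards [continuousAt_fst.eventually (f := fun q : ℝ × ℝ => q.1) hev]
    with q ⟨hT, hX, hΘ, hΨ, h0⟩
  have hne := h0.self_of_nhds
  have c1 : ∀ {u : ℝ → ℝ}, ContDiffAt ℝ r u q.1 → ContDiffAt ℝ r (fun q : ℝ × ℝ => u q.1) q :=
    fun hu => hu.comp q contDiffAt_fst
  have c2 : ∀ {u : ℝ × ℝ → ℝ}, ContDiffAt ℝ r u q → ContDiffAt ℝ r (fun q => (u q : ℂ)) q :=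
    fun hu => Complex.ofRealCLM.contDiff.contDiffAt.comp q hu
  have hT1 := (hT.deriv hr).self_of_nhds
  have hT2 := ((hT.deriv hr).deriv hr).self_of_nhds
  have hT3 := (((hT.deriv hr).deriv hr).deriv hr).self_of_nhds
  have hX1 := (hX.deriv hr).self_of_nhds
  have hs := contDiffAt_sign (r := r) hT1.continuousAt hne
  have hXd : ContDiffAt ℝ r (deriv fun s => deriv X s / deriv T s) q.1 := by
    have : SmoothNear r (fun s => deriv X s / deriv T s) q.1 := by
      filter_upwards [hX.deriv hr, hT.deriv hr, h0] with s h1 h2 h3 using h1.div h2 h3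
    exact (this.deriv hr).self_of_nhds
  have hsne : Real.sign (deriv T q.1) ≠ 0 := by
    rcases sign_eq_of_ne hne with h | h <;> rw [h] <;> norm_num
  have hTC : ((deriv T q.1 : ℝ) : ℂ) ≠ 0 := by exact_mod_cast hne
  refine ((c2 ?_).add (contDiffAt_complex_div ?_ (c2 (c1 hT1)) hTC)).sub
    (contDiffAt_complex_div ?_ ?_ (mul_ne_zero (by norm_num) (pow_ne_zero _ hTC)))
  · have h2 : ContDiffAt ℝ r (fun s => (2 * deriv (deriv (deriv T)) s * deriv T s
        - 3 * deriv (deriv T) s ^ 2) / (16 * Real.sign (deriv T s) * deriv T s ^ 3)) q.1 :=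
      (((contDiffAt_const.mul hT3).mul hT1).sub (contDiffAt_const.mul (hT2.pow 2))).div
        ((contDiffAt_const.mul hs).mul (hT1.pow 3))
        (mul_ne_zero (mul_ne_zero (by norm_num) hsne) (pow_ne_zero _ hne))
    have h1 : ContDiffAt ℝ r (fun s => ε * Real.sign (deriv T s) / (2 * √|deriv T s|)
        * deriv (fun s => deriv X s / deriv T s) s) q.1 :=
      ((contDiffAt_const.mul hs).div (contDiffAt_const.mul (contDiffAt_sqrt_abs hT1 hne))
        (mul_ne_zero two_ne_zero (Real.sqrt_pos.2 (abs_pos.2 hne)).ne')).mul hXd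
    exact ((c1 h2).mul (contDiffAt_snd.pow 2)).add ((c1 h1).mul contDiffAt_snd)
  · exact (c2 (c1 (hΨ.deriv hr).self_of_nhds)).sub
      (contDiffAt_const.mul (c2 (c1 (hΘ.deriv hr).self_of_nhds)))
  · exact ((c2 (c1 hX1)).pow 2).add (contDiffAt_const.mul (c2 (c1 hT2)))
  · exact contDiffAt_const.mul ((c2 (c1 hT1)).pow 2)

end
end NSE

/-! ### Sufficiency of the compatibility condition -/

namespace NSE

section
variable {r : WithTop ℕ∞} {z w : Vars} {ε : ℝ} {T X Θ Ψ : ℝ → ℝ}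
  {S S' : Vars → ℂ} {f : ℝ → ℂ} {V : ℝ × ℝ → ℂ}

/-- If the compatibility condition holds, then the image of an equation with a modular nonlinearity
has a modular nonlinearity. -/
theorem HasForm.exists_splits (hr : r = ∞ ∨ r = ω) {φ : PointTransf r Vars}
    (hz : z ∈ φ.toHomeo.source) (h : HasForm r φ.toHomeo z ε T X Θ Ψ) (hS : Splits r z S f V)
    (hm : ∀ᶠ w in 𝓝 z, S' (φ.toHomeo w) = (formula ε T X Θ Ψ (w, S w)).2)
    (hc : ∀ᶠ p : ℝ × ℝ in 𝓝 (z.1.1, ‖z.2‖), Compatible f T Θ p) :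
    ∃ g V', Splits r (φ.toHomeo z) S' g V' := by
  obtain ⟨hz0, hf, hV, hfne, hSe⟩ := hS
  set F := φ.toHomeo
  set c := hatL (deriv T z.1.1)
  set t₀ := z.1.1
  set R := Real.exp (Θ t₀) * ‖z.2‖ with hR
  have hFz : ‖(F z).2‖ = R := h.norm_snd
  have hΘc : ContinuousAt Θ t₀ := (h.smooth_Θ.hasDerivAt hr).continuousAt
  have hTne := h.deriv_ne.self_of_nhds
  have hFc : ContinuousAt F z := (φ.contDiffAt hz).continuousAt
  have hR0 : Real.exp (-Θ t₀) * R = ‖z.2‖ := by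
    rw [hR, ← mul_assoc, ← Real.exp_add]; simp
  -- the transformed nonlinearity
  let K : ℝ → ℝ → ℂ := fun t ρ => c (f (Real.exp (-Θ t) * ρ)) / (|deriv T t| : ℝ)
  let K₁ : ℝ → ℝ → ℂ := fun t ρ =>
    c (Real.exp (-Θ t) • deriv f (Real.exp (-Θ t) * ρ)) / (|deriv T t| : ℝ)
  have hpull : ∀ {Q : ℝ × ℝ → Prop}, (∀ᶠ p in 𝓝 (t₀, ‖z.2‖), Q p) →
      ∀ᶠ p : ℝ × ℝ in 𝓝 (t₀, R), Q (p.1, Real.exp (-Θ p.1) * p.2) := by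
    intro Q hQ
    have hc : ContinuousAt (fun p : ℝ × ℝ => (p.1, Real.exp (-Θ p.1) * p.2)) (t₀, R) :=
      continuousAt_fst.prodMk ((Real.continuous_exp.continuousAt.comp (ContinuousAt.comp
        (f := Prod.fst) (x := (t₀, R)) hΘc.neg continuousAt_fst)).mul continuousAt_snd)
    rw [ContinuousAt, hR0] at hc
    exact hc.eventually hQ
  have hK : ∀ᶠ p : ℝ × ℝ in 𝓝 (t₀, R), HasDerivAt (K p.1) (K₁ p.1 p.2) p.2 := by
    filter_upwards [hpull (hf.eventually_nhds.prod_inr_nhds t₀)] with p hp'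
    have hp : SmoothNear r f (Real.exp (-Θ p.1) * p.2) := hp'
    have h1 : HasDerivAt (fun ρ => f (Real.exp (-Θ p.1) * ρ))
        (Real.exp (-Θ p.1) • deriv f (Real.exp (-Θ p.1) * p.2)) p.2 :=
      HasDerivAt.scomp (h := fun ρ : ℝ => Real.exp (-Θ p.1) * ρ) p.2 (hp.hasDerivAt hr)
        (((hasDerivAt_id p.2).const_mul (Real.exp (-Θ p.1))).congr_deriv (mul_one _))
    exact (hasDerivAt_hatL h1).div_const _
  -- This is exactly compatibility. Consequently the dependence of `K` on t is an additive function
  -- of t, which can be moved into the potential.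
  have hK₁ : ∀ᶠ p : ℝ × ℝ in 𝓝 (t₀, R), HasDerivAt (fun t => K₁ t p.2) 0 p.1 := by
    filter_upwards [hpull (hf.eventually_nhds.prod_inr_nhds t₀), hpull hc,
      hpull (hfne.prod_inr_nhds t₀), (h.deriv_ne.and (h.smooth_T.eventually_nhds.and
        h.smooth_Θ.eventually_nhds)).prod_inl_nhds R] with p h1 h2 h3 ⟨h4, hT, hΘ⟩
    obtain ⟨t, ρ⟩ := p
    replace h1 : SmoothNear r f (Real.exp (-Θ t) * ρ) := h1
    replace hT : SmoothNear r T t := hT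
    replace hΘ : SmoothNear r Θ t := hΘ
    simp only at h2 h3 h4 ⊢
    have hd : HasDerivAt (fun s => Real.exp (-Θ s)) (Real.exp (-Θ t) * -deriv Θ t) t :=
      (hΘ.hasDerivAt hr).neg.exp
    have h5 : HasDerivAt (fun s => deriv f (Real.exp (-Θ s) * ρ)) _ t :=
      HasDerivAt.scomp (h := fun s : ℝ => Real.exp (-Θ s) * ρ) t ((h1.deriv hr).hasDerivAt hr)
        (hd.mul_const ρ)
    have hm0 : ((|deriv T t| : ℝ) : ℂ) ≠ 0 := by exact_mod_cast (abs_pos.2 h4).ne'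
    have h5' : HasDerivAt (fun s => Real.exp (-Θ s) • deriv f (Real.exp (-Θ s) * ρ)) _ t :=
      hd.smul h5
    have h6 := (hasDerivAt_hatL (σ := deriv T t₀) h5').div
      (hasDerivAt_abs_comp ((hT.deriv hr).hasDerivAt hr) h4).ofReal_comp hm0
    refine h6.congr_deriv ?_
    rw [div_eq_zero_iff]; left
    simp only [Complex.real_smul]
    set E := Real.exp (-Θ t)
    have hrf : ((E * ρ : ℝ) : ℂ) * deriv (deriv f) (E * ρ) = ratio f (E * ρ) * deriv f (E * ρ) := by
      rw [ratio, div_mul_cancel₀ _ h3]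
    have hrc := congrArg (hatL (deriv T t₀)) hrf
    have h2c := congrArg (hatL (deriv T t₀)) h2
    simp only at h2c
    have hTm : deriv T t = Real.sign (deriv T t) * |deriv T t| := (sign_mul_abs _).symm
    have hσ := sign_eq_of_ne h4
    rw [hTm] at h2c
    generalize Real.sign (deriv T t) = σ at *
    generalize |deriv T t| = m at *
    push_cast at h2c hrc ⊢
    simp only [map_add, hatL_mul, hatL_ofReal, hatL_one, map_neg, map_zero] at h2c hrc ⊢
    rcases hσ with rfl | rfl
    · push_cast at h2c ⊢
      linear_combination -E * hatL (deriv T t₀) (deriv f (E * ρ)) * h2c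
        - E * ((deriv Θ t : ℝ) : ℂ) * m * hrc
    · push_cast at h2c ⊢
      linear_combination E * hatL (deriv T t₀) (deriv f (E * ρ)) * h2c
        - E * ((deriv Θ t : ℝ) : ℂ) * m * hrc
  -- the transformed potential
  let W : ℝ × ℝ → ℂ := fun q => (K q.1 R - K t₀ R) + c (V q) / (|deriv T q.1| : ℝ)
    + shift ε T X Θ Ψ q
  have hKK : ∀ᶠ p : ℝ × ℝ in 𝓝 (t₀, R), K p.1 p.2 = K t₀ p.2 + (K p.1 R - K t₀ R) := by
    obtain ⟨d, hd, hball⟩ := Metric.eventually_nhds_iff_ball.1 (hK.and hK₁)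
    have hb : ∀ {t ρ : ℝ}, t ∈ Metric.ball t₀ d → ρ ∈ Metric.ball R d →
        (t, ρ) ∈ Metric.ball (t₀, R) d := fun h1 h2 => by
      rw [Metric.mem_ball, Prod.dist_eq, max_lt_iff]; exact ⟨h1, h2⟩
    have ht₀ : t₀ ∈ Metric.ball t₀ d := Metric.mem_ball_self hd
    filter_upwards [Metric.ball_mem_nhds _ hd] with p hp
    obtain ⟨t, ρ⟩ := p
    rw [Metric.mem_ball, Prod.dist_eq, max_lt_iff] at hp
    have hK₁c : ∀ s ∈ Metric.ball R d, K₁ t s = K₁ t₀ s := fun s hs =>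
      eq_of_fderiv_apply_eq_zero (g := fun t => K₁ t s) (convex_ball t₀ d) hp.1 ht₀
        (fun y hy => (hball _ (hb hy hs)).2.differentiableAt) (fun y hy => by
          rw [(hball _ (hb hy hs)).2.hasFDerivAt.fderiv]; simp)
    have hD : ∀ s ∈ Metric.ball R d, HasDerivAt (fun s => K t s - K t₀ s) 0 s := fun s hs =>
      ((hball _ (hb hp.1 hs)).1.sub (hball _ (hb ht₀ hs)).1).congr_deriv
        (sub_eq_zero.2 (hK₁c s hs))
    have h1 := eq_of_fderiv_apply_eq_zero (g := fun s => K t s - K t₀ s) (convex_ball R d)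
      hp.2 (Metric.mem_ball_self hd) (fun y hy => (hD y hy).differentiableAt) (fun y hy => by
        rw [(hD y hy).hasFDerivAt.fderiv]; simp)
    simp only at h1 ⊢
    linear_combination h1
  have hSK : ∀ᶠ w in 𝓝 z, S' (F w) = K t₀ ‖(F w).2‖ + W w.1 := by
    have hc : ContinuousAt (fun w : Vars => (w.1.1, ‖(F w).2‖)) z :=
      (continuousAt_fst.fst).prodMk hFc.snd.norm
    rw [ContinuousAt, hFz] at hc
    filter_upwards [hc.eventually hKK, hm, hSe, h.eventually, eventually_time (h.eventually_hat hr)]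
      with w h1 h2 h3 h4 h5
    have h6 : K w.1.1 ‖(F w).2‖ = c (f ‖w.2‖) / (|deriv T w.1.1| : ℝ) := by
      simp only [K]
      rw [h4.norm_snd, ← mul_assoc, ← Real.exp_add, neg_add_cancel, Real.exp_zero, one_mul]
    rw [h2, formula_snd, h5, h3, map_add]
    simp only [W]
    linear_combination h1 - h6
  have hmS : SmoothNear r (fun t => ((|deriv T t| : ℝ) : ℂ)) t₀ := by
    filter_upwards [(h.smooth_T.deriv hr).sqrt_abs h.deriv_ne] with s h1
    have h4 : (fun s => |deriv T s|) = fun s => √|deriv T s| ^ 2 := by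
      ext s; exact (Real.sq_sqrt (abs_nonneg _)).symm
    have h5 : ContDiffAt ℝ r (fun s => |deriv T s|) s := by rw [h4]; exact h1.pow 2
    exact Complex.ofRealCLM.contDiff.contDiffAt.comp s h5
  have hm0 : ∀ᶠ t in 𝓝 t₀, ((|deriv T t| : ℝ) : ℂ) ≠ 0 :=
    h.deriv_ne.mono fun t ht => by exact_mod_cast (abs_pos.2 ht).ne'
  have hcs : ∀ {E : Type} [NormedAddCommGroup E] [NormedSpace ℝ E] {u : E → ℂ} {a : E},
      ContDiffAt ℝ r u a → ContDiffAt ℝ r (fun y => c (u y)) a := fun hu =>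
    c.contDiff.contDiffAt.comp _ hu
  have hKs : SmoothNear r (fun t => K t R) t₀ := by
    have hl : Tendsto (fun t : ℝ => (t, R)) (𝓝 t₀) (𝓝 (t₀, R)) :=
      (show ContinuousAt (fun t : ℝ => (t, R)) t₀ by fun_prop)
    filter_upwards [hl.eventually (hpull (hf.prod_inr_nhds t₀)), h.smooth_Θ, hmS, hm0]
      with t h1 h2 h3 h4
    refine contDiffAt_complex_div (hcs (ContDiffAt.comp (g := f)
      (f := fun t => Real.exp (-Θ t) * R) t h1 (h2.neg.exp.mul contDiffAt_const))) h3 h4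
  have hWs : SmoothNear r W z.1 := by
    have hfst : ∀ {Q : ℝ → Prop}, (∀ᶠ t in 𝓝 t₀, Q t) → ∀ᶠ q : ℝ × ℝ in 𝓝 z.1, Q q.1 :=
      fun hQ => hQ.prod_inl_nhds z.1.2
    filter_upwards [hfst hKs, hV, smoothNear_shift hr h, hfst hmS, hfst hm0] with q h1 h2 h3 h4 h5
    exact (((h1.comp q contDiffAt_fst).sub contDiffAt_const).add
      (contDiffAt_complex_div (hcs h2) (h4.comp q contDiffAt_fst) h5)).add h3
  -- The inverse of the base map: (t, x) is recovered from (t̃, x̃) at any admissible ψ̃, so ψ̃ is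
  -- frozen at its value over `z`.
  let b : ℝ × ℝ → ℝ × ℝ := fun q => (F.symm (q, (F z).2)).1
  have hb : ∀ᶠ w in 𝓝 z, b (F w).1 = w.1 := by
    -- The point over the same (t, x) whose image has the frozen value of ψ̃.
    let v : Vars → Vars := fun w => (w.1, c ((F z).2 / amplitude ε T X Θ Ψ w.1))
    have hamp : ContinuousAt (amplitude ε T X Θ Ψ) z.1 := by
      have h2 := (smoothNear_phase₂ hr h.smooth_T h.deriv_ne).self_of_nhds.continuousAt
      have h1 := (smoothNear_phase₁ (ε := ε) hr h.smooth_T h.smooth_X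
        h.deriv_ne).self_of_nhds.continuousAt
      have h3 := h.smooth_Ψ.self_of_nhds.continuousAt
      have hf : ∀ {u : ℝ → ℝ}, ContinuousAt u z.1.1 → ContinuousAt (fun q : ℝ × ℝ => u q.1) z.1 :=
        fun hu => ContinuousAt.comp (f := Prod.fst) hu continuousAt_fst
      refine ContinuousAt.cexp (ContinuousAt.add (continuousAt_const.mul
        (Complex.continuous_ofReal.continuousAt.comp ?_))
        (Complex.continuous_ofReal.continuousAt.comp (hf hΘc)))
      exact (((hf h2).mul (continuousAt_snd.pow 2)).add ((hf h1).mul continuousAt_snd)).add (hf h3)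
    have hv : Tendsto v (𝓝 z) (𝓝 z) := by
      have h1 : ContinuousAt v z := continuousAt_fst.prodMk (c.continuous.continuousAt.comp
        (continuousAt_const.div (ContinuousAt.comp (f := Prod.fst) hamp continuousAt_fst)
          (amplitude_ne_zero _ _ _ _ _ _)))
      have h2 : v z = z := by
        refine Prod.ext rfl ?_
        simp only [v]
        rw [h.eq.self_of_nhds]
        simp only
        rw [mul_div_cancel_right₀ _ (amplitude_ne_zero _ _ _ _ _ _), hat_eq_hatL, hatL_hatL]
      rwa [ContinuousAt, h2] at h1
    filter_upwards [hv.eventually (F.open_source.mem_nhds hz), hv.eventually h.eq, h.eq,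
      eventually_time (h.eventually_hat hr)] with w h1 h2 h3 h4
    have h5 : F (v w) = ((F w).1, (F z).2) := by
      rw [h2, h3]
      refine Prod.ext rfl ?_
      simp only [v]
      rw [h4, hatL_hatL, div_mul_cancel₀ _ (amplitude_ne_zero _ _ _ _ _ _)]
    simp only [b]
    rw [← h5, F.left_inv h1]
  have hsymm : Tendsto F.symm (𝓝 (F z)) (𝓝 z) := by
    have := F.tendsto_symm hz; exact this
  have hRev : ∀ {Q : ℝ → Prop}, (∀ᶠ ρ in 𝓝 ‖z.2‖, Q ρ) →
      ∀ᶠ ρ in 𝓝 R, Q (Real.exp (-Θ t₀) * ρ) := fun hQ =>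
    (show ContinuousAt (fun ρ : ℝ => (t₀, ρ)) R by fun_prop).eventually
      (hpull (hQ.prod_inr_nhds t₀))
  refine ⟨K t₀, fun q => W (b q), ?_, ?_, ?_, ?_, ?_⟩
  · rw [← norm_ne_zero_iff, hFz, hR]
    exact mul_ne_zero (Real.exp_pos _).ne' (norm_ne_zero_iff.2 hz0)
  · rw [hFz]
    filter_upwards [hRev hf] with ρ hρ
    exact contDiffAt_complex_div (hcs (ContDiffAt.comp (g := f)
      (f := fun ρ => Real.exp (-Θ t₀) * ρ) ρ hρ (contDiffAt_const.mul contDiffAt_id)))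
      contDiffAt_const hm0.self_of_nhds
  · have hl : Tendsto (fun q : ℝ × ℝ => ((q, (F z).2) : Vars)) (𝓝 (F z).1) (𝓝 (F z)) :=
      (show ContinuousAt (fun q : ℝ × ℝ => ((q, (F z).2) : Vars)) (F z).1 by fun_prop)
    filter_upwards [hl.eventually (hsymm.eventually ((continuousAt_fst.eventually
      (f := fun w : Vars => w.1) hWs))), hl.eventually (F.open_target.mem_nhds (F.map_source hz))]
      with q h1 h2
    have h3 : ContDiffAt ℝ r b q := ((φ.contDiffAt_symm h2).comp q
      (contDiffAt_id.prodMk contDiffAt_const)).fst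
    exact ContDiffAt.comp (g := W) (f := b) q h1 h3
  · rw [hFz]
    have hl : ∀ᶠ ρ in 𝓝 R, HasDerivAt (K t₀) (K₁ t₀ ρ) ρ :=
      (show ContinuousAt (fun ρ : ℝ => (t₀, ρ)) R by fun_prop).eventually hK
    filter_upwards [hl, hRev hfne] with ρ h1 h2
    rw [h1.deriv]
    refine div_ne_zero ?_ hm0.self_of_nhds
    rw [Ne, hatL_eq_zero_iff, Complex.real_smul]
    exact mul_ne_zero (by exact_mod_cast (Real.exp_pos _).ne') h2
  · filter_upwards [hsymm.eventually hSK, hsymm.eventually hb,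
      F.open_target.mem_nhds (F.map_source hz)] with w' h1 h2 h3
    rw [F.right_inv h3] at h1 h2
    rw [h1, h2]

end
end NSE

/-! ### The subclasses and their invariance -/

namespace NSE

/-- The condition on `ρ f_ρρ / f_ρ` that determines the subclass. -/
def Kind : Option ℝ → (ℝ → ℂ) → ℝ → Prop
  | none, f, a => ¬ ∃ c : ℝ, ∀ᶠ ρ in 𝓝 a, ratio f ρ = (c : ℂ)
  | some γ, f, a => ∀ᶠ ρ in 𝓝 a, ratio f ρ = ((γ - 1 : ℝ) : ℂ)

/-- The condition on the parameters of the equivalence transformations of the subclass. -/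
def Params : Option ℝ → (ℝ → ℝ) → (ℝ → ℝ) → ℝ → Prop
  | none, T, Θ, t => deriv (deriv T) t = 0 ∧ deriv Θ t = 0
  | some γ, T, Θ, t => γ * deriv Θ t * deriv T t + deriv (deriv T) t = 0

section
variable {r : WithTop ℕ∞} {F : Vars → Vars} {z w : Vars} {ε : ℝ} {T X Θ Ψ : ℝ → ℝ}
  {S S' : Vars → ℂ} {f g : ℝ → ℂ} {V V' : ℝ × ℝ → ℂ} {i j : Option ℝ}

theorem subclass_iff : subclass r i z S ↔ ∃ f V, Splits r z S f V ∧ Kind i f ‖z.2‖ := by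
  cases i <;> rfl

theorem exists_kind (f : ℝ → ℂ) (a : ℝ) : ∃ i, Kind i f a := by
  by_cases h : ∃ c : ℝ, ∀ᶠ ρ in 𝓝 a, ratio f ρ = (c : ℂ)
  · obtain ⟨c, hc⟩ := h
    exact ⟨some (c + 1), by simpa [Kind] using hc⟩
  · exact ⟨none, h⟩

theorem Kind.unique {a : ℝ} (hi : Kind i f a) (hj : Kind j f a) : i = j := by
  cases i with
  | none => cases j with
    | none => rfl
    | some γ => exact absurd ⟨_, hj⟩ hi
  | some γ => cases j with
    | none => exact absurd ⟨_, hi⟩ hj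
    | some γ' =>
      obtain ⟨ρ, h1, h2⟩ := (hi.and hj).exists
      have h3 : γ - 1 = γ' - 1 := by exact_mod_cast h1.symm.trans h2
      rw [sub_left_inj.1 h3]

theorem Kind.congr {a b : ℝ} (h : ∀ c : ℝ, (∀ᶠ ρ in 𝓝 a, ratio f ρ = (c : ℂ)) ↔
    ∀ᶠ ρ in 𝓝 b, ratio g ρ = (c : ℂ)) : Kind i f a ↔ Kind i g b := by
  cases i with
  | none => exact not_congr (exists_congr h)
  | some γ => exact h _

theorem Splits.congr (h : Splits r z S f V) (hS : S' =ᶠ[𝓝 z] S) : Splits r z S' f V :=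
  ⟨h.1, h.2.1, h.2.2.1, h.2.2.2.1, by
    filter_upwards [h.2.2.2.2, hS] with w h1 h2 using h2.trans h1⟩

theorem tendsto_mul_direction (hz : z.2 ≠ 0) :
    Tendsto (fun ρ : ℝ => ((z.1, (ρ : ℂ) * (z.2 / ‖z.2‖)) : Vars)) (𝓝 ‖z.2‖) (𝓝 z) := by
  have h1 : ContinuousAt (fun ρ : ℝ => ((z.1, (ρ : ℂ) * (z.2 / ‖z.2‖)) : Vars)) ‖z.2‖ := by
    fun_prop
  have h2 : (‖z.2‖ : ℂ) ≠ 0 := by exact_mod_cast norm_ne_zero_iff.2 hz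
  rwa [ContinuousAt, mul_div_cancel₀ _ h2] at h1

/-- Comparing along a ray shows that two admissible functions `f` differ by a constant, so the
subclass of S does not depend on its decomposition. -/
theorem Splits.ratio_eq (h : Splits r z S f V) (h' : Splits r z S g V') :
    ∀ᶠ ρ in 𝓝 ‖z.2‖, ratio f ρ = ratio g ρ := by
  have hρ0 : 0 < ‖z.2‖ := norm_pos_iff.2 h.1
  have h1 : ∀ᶠ ρ in 𝓝 ‖z.2‖, f ρ = g ρ + (V' z.1 - V z.1) := by
    have hl := tendsto_mul_direction h.1
    filter_upwards [hl.eventually h.2.2.2.2, hl.eventually h'.2.2.2.2, lt_mem_nhds hρ0]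
      with ρ h1 h2 h3
    have h4 : ‖(ρ : ℂ) * (z.2 / ‖z.2‖)‖ = ρ := by
      rw [norm_mul, norm_div, Complex.norm_real, Complex.norm_real, norm_norm, div_self hρ0.ne',
        mul_one, Real.norm_of_nonneg (le_of_lt h3)]
    rw [h1] at h2
    simp only [h4] at h2
    linear_combination h2
  have h2 : ∀ᶠ ρ in 𝓝 ‖z.2‖, deriv f ρ = deriv g ρ := by
    filter_upwards [h1.eventually_nhds] with ρ hρ
    rw [EventuallyEq.deriv_eq hρ, deriv_add_const]
  filter_upwards [h2.eventually_nhds] with ρ hρ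
  rw [ratio, ratio, EventuallyEq.deriv_eq hρ, hρ.self_of_nhds]

theorem Splits.subclass_iff (h : Splits r z S f V) : subclass r i z S ↔ Kind i f ‖z.2‖ := by
  rw [NSE.subclass_iff]
  refine ⟨fun ⟨g, V', h1, h2⟩ => (Kind.congr fun c => ?_).1 h2, fun h1 => ⟨f, V, h, h1⟩⟩
  refine eventually_congr ?_
  filter_upwards [h1.ratio_eq h] with ρ hρ
  rw [hρ]

theorem classV_iff : classV r z S ↔ ∃ i, subclass r i z S := by
  constructor
  · rintro ⟨f, V, h⟩
    obtain ⟨i, hi⟩ := exists_kind f ‖z.2‖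
    exact ⟨i, h.subclass_iff.2 hi⟩
  · rintro ⟨i, h⟩
    obtain ⟨f, V, h, -⟩ := subclass_iff.1 h
    exact ⟨f, V, h⟩

theorem subclass_unique (hi : subclass r i z S) (hj : subclass r j z S) : i = j := by
  obtain ⟨f, V, h, h1⟩ := subclass_iff.1 hi
  exact h1.unique (h.subclass_iff.1 hj)

theorem ne_zero_of_classV (h : classV r z S) : z.2 ≠ 0 := h.choose_spec.choose_spec.1

/-- If Θ_t ≠ 0 at some t, the compatibility condition at that t makes the ratio equal to the real
constant -T_tt/(Θ_t T_t) - 1. For a ratio that is not such a constant, Θ_t and then T_tt must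
vanish; for ratio γ - 1 the condition no longer involves ρ. -/
theorem Kind.compatible_iff {t₀ ρ₀ : ℝ} (hi : Kind i f ρ₀) (hT : ∀ᶠ t in 𝓝 t₀, deriv T t ≠ 0) :
    (∀ᶠ p : ℝ × ℝ in 𝓝 (t₀, ρ₀), Compatible f T Θ p) ↔ ∀ᶠ t in 𝓝 t₀, Params i T Θ t := by
  cases i with
  | none =>
    constructor
    · intro h
      filter_upwards [h.curry_nhds, hT] with t h1 hTt
      have hTC : ((deriv T t : ℝ) : ℂ) ≠ 0 := by exact_mod_cast hTt
      have hΘ : deriv Θ t = 0 := by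
        by_contra h0
        have h0C : ((deriv Θ t : ℝ) : ℂ) ≠ 0 := by exact_mod_cast h0
        refine hi ⟨-(deriv (deriv T) t / (deriv Θ t * deriv T t)) - 1, ?_⟩
        filter_upwards [h1] with ρ hρ
        simp only [Compatible] at hρ
        push_cast
        field_simp
        linear_combination hρ
      have h2 := h1.self_of_nhds
      simp only [Compatible, hΘ] at h2
      refine ⟨?_, hΘ⟩
      simpa using h2
    · intro h
      filter_upwards [h.prod_inl_nhds ρ₀] with p ⟨h1, h2⟩
      simp [Compatible, h1, h2]
  | some γ =>
    have key : ∀ (t ρ : ℝ), ratio f ρ = ((γ - 1 : ℝ) : ℂ) →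
        (Compatible f T Θ (t, ρ) ↔ Params (some γ) T Θ t) := by
      intro t ρ h1
      simp only [Compatible, Params, h1]
      rw [← Complex.ofReal_eq_zero]
      push_cast
      ring_nf
    constructor
    · intro h
      filter_upwards [h.curry_nhds] with t h1
      obtain ⟨ρ, h2, h3⟩ := (h1.and hi).exists
      exact (key t ρ h3).1 h2
    · intro h
      filter_upwards [h.prod_inl_nhds ρ₀, hi.prod_inr_nhds t₀] with p h1 h2
      exact (key p.1 p.2 h2).2 h1

/-- The ratio changes by a rescaling of ρ and possibly conjugation, and both preserve equality to a
given real constant. This is where reality of the constant matters. -/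
theorem HasForm.kind_iff (hr : r = ∞ ∨ r = ω) (h : HasForm r F z ε T X Θ Ψ)
    (hF : ContinuousAt F z) (hS : Splits r z S f V) (hS' : Splits r (F z) S' g V')
    (hm : ∀ᶠ w in 𝓝 z, S' (F w) = (formula ε T X Θ Ψ (w, S w)).2) :
    Kind i f ‖z.2‖ ↔ Kind i g ‖(F z).2‖ := by
  have h1 : ∀ᶠ ρ in 𝓝 ‖z.2‖, ratio g (Real.exp (Θ z.1.1) * ρ)
      = hatL (deriv T z.1.1) (ratio f ρ) :=
    ((show ContinuousAt (fun ρ : ℝ => (z.1.1, ρ)) ‖z.2‖ by fun_prop).eventually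
      (h.ratio_eq_and_compatible hr hF hS hS' hm)).mono fun ρ hρ => hρ.1
  rw [h.norm_snd]
  refine Kind.congr fun c => ⟨fun hc => ?_, fun hc => ?_⟩
  · have hl : Tendsto (fun ρ => Real.exp (-Θ z.1.1) * ρ) (𝓝 (Real.exp (Θ z.1.1) * ‖z.2‖))
        (𝓝 ‖z.2‖) := by
      have := (continuous_const_mul (Real.exp (-Θ z.1.1))).tendsto (Real.exp (Θ z.1.1) * ‖z.2‖)
      rwa [← mul_assoc, ← Real.exp_add, neg_add_cancel, Real.exp_zero, one_mul] at this
    filter_upwards [hl.eventually (hc.and h1)] with ρ ⟨h2, h3⟩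
    rwa [h2, hatL_ofReal, ← mul_assoc, ← Real.exp_add, add_neg_cancel, Real.exp_zero, one_mul] at h3
  · have hl : Tendsto (fun ρ => Real.exp (Θ z.1.1) * ρ) (𝓝 ‖z.2‖)
        (𝓝 (Real.exp (Θ z.1.1) * ‖z.2‖)) := (continuous_const_mul _).tendsto _
    filter_upwards [hl.eventually hc, h1] with ρ h2 h3
    rw [← hatL_hatL (deriv T z.1.1) (ratio f ρ), ← h3, h2, hatL_ofReal]

/-- The criterion does not mention the particular S; this uniformity is the source of normalization.
-/
theorem HasForm.subclass_image_iff (hr : r = ∞ ∨ r = ω) {φ : PointTransf r Vars}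
    (hz : z ∈ φ.toHomeo.source) (h : HasForm r φ.toHomeo z ε T X Θ Ψ) (hS : subclass r i z S)
    (hm : ∀ᶠ w in 𝓝 z, S' (φ.toHomeo w) = (formula ε T X Θ Ψ (w, S w)).2) :
    subclass r i (φ.toHomeo z) S' ↔ ∀ᶠ t in 𝓝 z.1.1, Params i T Θ t := by
  obtain ⟨f, V, hf, hk⟩ := subclass_iff.1 hS
  have hF : ContinuousAt φ.toHomeo z := (φ.contDiffAt hz).continuousAt
  rw [← hk.compatible_iff h.deriv_ne]
  constructor
  · intro hS'
    obtain ⟨g, V', hg, -⟩ := subclass_iff.1 hS'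
    exact (h.ratio_eq_and_compatible hr hF hf hg hm).mono fun p hp => hp.2
  · intro hc
    obtain ⟨g, V', hg⟩ := h.exists_splits hr hz hf hm hc
    exact hg.subclass_iff.2 ((h.kind_iff hr hF hf hg hm).1 hk)

/-- A point transformation between two equations of the class. -/
theorem exists_hasForm_of_subclass (hr : r = ∞ ∨ r = ω) {φ : PointTransf r Vars}
    (hz : z ∈ φ.toHomeo.source) (hS : subclass r i z S) (hS' : subclass r j (φ.toHomeo z) S')
    (hM : MapsEquation φ.toHomeo S S' z) :
    i = j ∧ ∃ (ε : ℝ) (T X Θ Ψ : ℝ → ℝ), HasForm r φ.toHomeo z ε T X Θ Ψ ∧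
      (∀ᶠ t in 𝓝 z.1.1, Params i T Θ t) ∧
      ∀ᶠ w in 𝓝 z, S' (φ.toHomeo w) = (formula ε T X Θ Ψ (w, S w)).2 := by
  obtain ⟨f, V, hf, hi⟩ := subclass_iff.1 hS
  obtain ⟨g, V', hg, hj⟩ := subclass_iff.1 hS'
  obtain ⟨ε, T, X, Θ, Ψ, h⟩ := exists_hasForm hr hz hf hg hM
  have hm := (mapsEquation_iff hr hz h hf.1).1 hM
  have hij : i = j :=
    ((h.kind_iff hr (φ.contDiffAt hz).continuousAt hf hg hm).1 hi).unique hj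
  refine ⟨hij, ε, T, X, Θ, Ψ, h, ?_, hm⟩
  subst hij
  exact (h.subclass_image_iff hr hz hS hm).1 hS'

/-- T is read off from the time component and Θ from the change of the modulus. This shows later
that particular transformations are absent from a group. -/
theorem HasForm.parameters_unique {ε' : ℝ} {T' X' Θ' Ψ' : ℝ → ℝ} (h : HasForm r F z ε T X Θ Ψ)
    (h' : HasForm r F z ε' T' X' Θ' Ψ') (hz : z.2 ≠ 0) :
    T =ᶠ[𝓝 z.1.1] T' ∧ Θ =ᶠ[𝓝 z.1.1] Θ' := by
  have hl : Tendsto (fun t : ℝ => (((t, z.1.2), z.2) : Vars)) (𝓝 z.1.1) (𝓝 z) :=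
    (show ContinuousAt (fun t : ℝ => (((t, z.1.2), z.2) : Vars)) z.1.1 by fun_prop)
  constructor
  · filter_upwards [hl.eventually h.eq, hl.eventually h'.eq] with t h1 h2
    exact congrArg (fun w : Vars => w.1.1) (h1.symm.trans h2)
  · filter_upwards [hl.eventually h.eventually, hl.eventually h'.eventually] with t h1 h2
    have h3 := mul_right_cancel₀ (norm_ne_zero_iff.2 hz) (h1.norm_snd.symm.trans h2.norm_snd)
    exact Real.exp_injective h3

end
end NSE

/-! ### Extension to equivalence transformations and normalization -/

namespace NSE

section
variable {r : WithTop ℕ∞} {F : Vars → Vars} {z w : Vars} {ε : ℝ} {T X Θ Ψ : ℝ → ℝ}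

theorem HasForm.contDiffAt_abs_deriv (hr : r = ∞ ∨ r = ω) (h : HasForm r F z ε T X Θ Ψ) :
    ContDiffAt ℝ r (fun t => |deriv T t|) z.1.1 := by
  have h4 : (fun s => |deriv T s|) = fun s => √|deriv T s| ^ 2 := by
    ext s; exact (Real.sq_sqrt (abs_nonneg _)).symm
  rw [h4]
  exact (contDiffAt_sqrt_abs (h.smooth_T.deriv hr).self_of_nhds h.deriv_ne.self_of_nhds).pow 2

/-- A local diffeomorphism of the form `formula` is the projection of a local diffeomorphism of the
space of the variables `t`, `x`, `ψ` and `S`. -/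
theorem exists_extTransf (hr : r = ∞ ∨ r = ω) (φ : PointTransf r Vars)
    (hφ : ∀ w ∈ φ.toHomeo.source, w.2 ≠ 0 ∧ HasForm r φ.toHomeo w ε T X Θ Ψ) :
    ∃ Φ : ExtTransf r, Φ.base = φ ∧
      ∀ w ∈ φ.toHomeo.source, ∀ s, Φ.total.toHomeo (w, s) = formula ε T X Θ Ψ (w, s) := by
  set F := φ.toHomeo
  let G : Vars × ℂ → Vars × ℂ := fun p =>
    (F p.1, hat T p.1.1.1 p.2 / (|deriv T p.1.1.1| : ℝ) + shift ε T X Θ Ψ p.1.1)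
  -- The formula for S̃ solved for S, the conjugation being an involution.
  let H : Vars × ℂ → ℂ := fun p =>
    hat T p.1.1.1 ((p.2 - shift ε T X Θ Ψ p.1.1) * (|deriv T p.1.1.1| : ℝ))
  let G' : Vars × ℂ → Vars × ℂ := fun p => (F.symm p.1, H (F.symm p.1, p.2))
  have hne : ∀ w ∈ F.source, ((|deriv T w.1.1| : ℝ) : ℂ) ≠ 0 := fun w hw => by
    exact_mod_cast (abs_pos.2 (hφ w hw).2.deriv_ne.self_of_nhds).ne'
  have hms : ∀ p : Vars × ℂ, p.1 ∈ F.source →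
      ContDiffAt ℝ r (fun p : Vars × ℂ => ((|deriv T p.1.1.1| : ℝ) : ℂ)) p := fun p hp =>
    Complex.ofRealCLM.contDiff.contDiffAt.comp p
      (ContDiffAt.comp (g := fun t => |deriv T t|) (f := fun p : Vars × ℂ => p.1.1.1) p
        ((hφ _ hp).2.contDiffAt_abs_deriv hr) (by fun_prop))
  have hss : ∀ p : Vars × ℂ, p.1 ∈ F.source →
      ContDiffAt ℝ r (fun p : Vars × ℂ => shift ε T X Θ Ψ p.1.1) p := fun p hp =>
    ContDiffAt.comp (g := shift ε T X Θ Ψ) (f := fun p : Vars × ℂ => p.1.1) p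
      (smoothNear_shift hr (hφ _ hp).2).self_of_nhds (by fun_prop)
  have hhat : ∀ p : Vars × ℂ, p.1 ∈ F.source → ∀ᶠ q : Vars × ℂ in 𝓝 p, ∀ b,
      hat T q.1.1.1 b = hatL (deriv T p.1.1.1) b := fun p hp =>
    (show ContinuousAt (fun q : Vars × ℂ => q.1.1.1) p by fun_prop).eventually
      ((hφ _ hp).2.eventually_hat hr)
  have hG : ∀ p : Vars × ℂ, p.1 ∈ F.source → ContDiffAt ℝ r G p := by
    intro p hp
    refine ((φ.contDiffAt hp).comp p contDiffAt_fst).prodMk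
      ((contDiffAt_complex_div ?_ (hms p hp) (hne _ hp)).add (hss p hp))
    exact ((hatL (deriv T p.1.1.1)).contDiff.contDiffAt.comp p contDiffAt_snd).congr_of_eventuallyEq
      ((hhat p hp).mono fun q hq => hq q.2)
  have hH : ∀ p : Vars × ℂ, p.1 ∈ F.source → ContDiffAt ℝ r H p := by
    intro p hp
    have h1 : ContDiffAt ℝ r (fun p : Vars × ℂ =>
        (p.2 - shift ε T X Θ Ψ p.1.1) * (|deriv T p.1.1.1| : ℝ)) p :=
      (contDiffAt_snd.sub (hss p hp)).mul (hms p hp)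
    exact ((hatL (deriv T p.1.1.1)).contDiff.contDiffAt.comp p h1).congr_of_eventuallyEq
      ((hhat p hp).mono fun q hq => hq _)
  have hG' : ∀ p : Vars × ℂ, p.1 ∈ F.target → ContDiffAt ℝ r G' p := by
    intro p hp
    have h1 : ContDiffAt ℝ r (fun p : Vars × ℂ => F.symm p.1) p :=
      (φ.contDiffAt_symm hp).comp p contDiffAt_fst
    exact h1.prodMk (ContDiffAt.comp (g := H) (f := fun p : Vars × ℂ => (F.symm p.1, p.2)) p
      (hH _ (F.map_target hp)) (h1.prodMk contDiffAt_snd))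
  let total : PointTransf r (Vars × ℂ) :=
    { toHomeo :=
        { toFun := G
          invFun := G'
          source := F.source ×ˢ Set.univ
          target := F.target ×ˢ Set.univ
          map_source' := fun p hp => ⟨F.map_source hp.1, trivial⟩
          map_target' := fun p hp => ⟨F.map_target hp.1, trivial⟩
          left_inv' := by
            rintro ⟨w, s⟩ ⟨hp, -⟩
            simp only [G, G', H]
            rw [F.left_inv hp]
            refine Prod.ext rfl ?_
            simp only
            rw [add_sub_cancel_right, div_mul_cancel₀ _ (hne _ hp), hat_eq_hatL, hat_eq_hatL,
              hatL_hatL]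
          right_inv' := by
            rintro ⟨w, s⟩ ⟨hp, -⟩
            simp only [G, G', H]
            refine Prod.ext (F.right_inv hp) ?_
            simp only
            rw [hat_eq_hatL, hat_eq_hatL, hatL_hatL, mul_div_cancel_right₀ _ (hne _ (F.map_target hp)),
              sub_add_cancel]
          open_source := F.open_source.prod isOpen_univ
          open_target := F.open_target.prod isOpen_univ
          continuousOn_toFun := fun p hp => (hG p hp.1).continuousAt.continuousWithinAt
          continuousOn_invFun := fun p hp => (hG' p hp.1).continuousAt.continuousWithinAt }
      contDiffOn := fun p hp => (hG p hp.1).contDiffWithinAt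
      contDiffOn_symm := fun p hp => (hG' p hp.1).contDiffWithinAt }
  refine ⟨⟨total, φ, fun w hw => (hφ w hw).1, rfl, fun p _ => rfl⟩, rfl, fun w hw s => ?_⟩
  refine Prod.ext ?_ ?_
  · rw [formula_fst]; exact (hφ w hw).2.eq.self_of_nhds
  · rw [formula_snd]; rfl

/-- The restriction of a point transformation to an open set. -/
def PointTransf.restr {E : Type} [NormedAddCommGroup E] [NormedSpace ℝ E] (φ : PointTransf r E)
    (U : Set E) (hU : IsOpen U) : PointTransf r E where
  toHomeo := φ.toHomeo.restrOpen U hU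
  contDiffOn := φ.contDiffOn.mono (by
    rw [OpenPartialHomeomorph.restrOpen_source]; exact Set.inter_subset_left)
  contDiffOn_symm := φ.contDiffOn_symm.mono fun w hw => by
    have h1 := (φ.toHomeo.restrOpen U hU).map_target hw
    rw [OpenPartialHomeomorph.restrOpen_source] at h1
    have h2 := φ.toHomeo.map_source h1.1
    have h3 : φ.toHomeo ((φ.toHomeo.restrOpen U hU).symm w) = w :=
      (φ.toHomeo.restrOpen U hU).right_inv hw
    rwa [h3] at h2

theorem PointTransf.restr_source {E : Type} [NormedAddCommGroup E] [NormedSpace ℝ E]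
    (φ : PointTransf r E) (U : Set E) (hU : IsOpen U) :
    (φ.restr U hU).toHomeo.source = φ.toHomeo.source ∩ U :=
  φ.toHomeo.restrOpen_source U hU

variable {i : Option ℝ} {S S' : Vars → ℂ}

theorem ExtTransf.act_base (Φ : ExtTransf r) (S : Vars → ℂ) (hw : w ∈ Φ.base.toHomeo.source) :
    Φ.act S (Φ.base.toHomeo w) = (Φ.total.toHomeo (w, S w)).2 := by
  simp only [ExtTransf.act]
  rw [Φ.base.toHomeo.left_inv hw]

theorem ExtTransf.hasForm (Φ : ExtTransf r) (hz : z ∈ Φ.base.toHomeo.source)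
    (hε : ε = 1 ∨ ε = -1) (hT : SmoothNear r T z.1.1) (hX : SmoothNear r X z.1.1)
    (hΘ : SmoothNear r Θ z.1.1) (hΨ : SmoothNear r Ψ z.1.1) (h0 : ∀ᶠ t in 𝓝 z.1.1, deriv T t ≠ 0)
    (h : ∀ᶠ w in 𝓝 z, ∀ s : ℂ, Φ.total.toHomeo (w, s) = formula ε T X Θ Ψ (w, s)) :
    HasForm r Φ.base.toHomeo z ε T X Θ Ψ := by
  refine ⟨hε, hT, hX, hΘ, hΨ, h0, ?_⟩
  filter_upwards [h, Φ.base.toHomeo.open_source.mem_nhds hz] with w h1 h2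
  have h3 := Φ.proj (w, 0) (by rw [Φ.source_eq]; exact ⟨h2, trivial⟩)
  rw [← h3, h1, formula_fst]

theorem admissible_subclass (hr : r = ∞ ∨ r = ω) {Φ : ExtTransf r}
    (hz : z ∈ Φ.base.toHomeo.source) (h : HasForm r Φ.base.toHomeo z ε T X Θ Ψ)
    (hP : ∀ᶠ t in 𝓝 z.1.1, Params i T Θ t)
    (ht : ∀ᶠ w in 𝓝 z, ∀ s : ℂ, Φ.total.toHomeo (w, s) = formula ε T X Θ Ψ (w, s))
    (hS : subclass r i z S) : Admissible (subclass r i) z S (Φ.act S) Φ.base := by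
  have hm : ∀ᶠ w in 𝓝 z, Φ.act S (Φ.base.toHomeo w) = (formula ε T X Θ Ψ (w, S w)).2 := by
    filter_upwards [ht, Φ.base.toHomeo.open_source.mem_nhds hz] with w h1 h2
    rw [Φ.act_base S h2, h1]
  exact ⟨hz, hS, (h.subclass_image_iff hr hz hS hm).2 hP,
    (mapsEquation_iff hr hz h (Φ.source_ne z hz)).2 hm⟩

theorem mem_equivGroup_subclass (hr : r = ∞ ∨ r = ω) {Φ : ExtTransf r}
    (hΦ : ∀ w ∈ Φ.base.toHomeo.source, ∃ (ε : ℝ) (T X Θ Ψ : ℝ → ℝ),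
      HasForm r Φ.base.toHomeo w ε T X Θ Ψ ∧ (∀ᶠ t in 𝓝 w.1.1, Params i T Θ t) ∧
      ∀ᶠ w in 𝓝 w, ∀ s : ℂ, Φ.total.toHomeo (w, s) = formula ε T X Θ Ψ (w, s)) :
    Φ ∈ equivGroup r (subclass r i) := fun z hz S hS => by
  obtain ⟨ε, T, X, Θ, Ψ, h, hP, ht⟩ := hΦ z hz
  exact admissible_subclass hr hz h hP ht hS

/-- Extension of a point transformation of the form `formula` to an equivalence transformation. -/
theorem exists_mem_equivGroup (hr : r = ∞ ∨ r = ω) {φ : PointTransf r Vars}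
    (hz : z ∈ φ.toHomeo.source) (hz0 : z.2 ≠ 0) (h : HasForm r φ.toHomeo z ε T X Θ Ψ)
    (hP : ∀ᶠ t in 𝓝 z.1.1, Params i T Θ t) :
    ∃ Φ ∈ equivGroup r (subclass r i), z ∈ Φ.base.toHomeo.source ∧
      φ.toHomeo =ᶠ[𝓝 z] Φ.base.toHomeo ∧
      ∀ᶠ w in 𝓝 z, w ∈ Φ.base.toHomeo.source ∧
        ∀ s : ℂ, Φ.total.toHomeo (w, s) = formula ε T X Θ Ψ (w, s) := by
  -- Membership in the equivalence group concerns every point of the domain, so the domain is shrunk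
  -- to an open set on which all requirements hold.
  let Q : Vars → Prop := fun w => w.2 ≠ 0 ∧ HasForm r φ.toHomeo w ε T X Θ Ψ ∧
    ∀ᶠ t in 𝓝 w.1.1, Params i T Θ t
  have hQ : ∀ᶠ w in 𝓝 z, Q w :=
    (continuous_snd.continuousAt.eventually_ne hz0).and
      (h.eventually.and (eventually_time hP.eventually_nhds))
  let U : Set Vars := interior {w | Q w}
  have hU : IsOpen U := isOpen_interior
  have hzU : z ∈ U := mem_interior_iff_mem_nhds.2 hQ
  have hUQ : ∀ w ∈ (φ.restr U hU).toHomeo.source, Q w := fun w hw => by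
    rw [φ.restr_source] at hw
    exact interior_subset (s := {w | Q w}) hw.2
  obtain ⟨Φ, hb, ht⟩ := exists_extTransf hr (φ.restr U hU) (ε := ε) (T := T) (X := X) (Θ := Θ)
    (Ψ := Ψ) fun w hw => ⟨(hUQ w hw).1, (hUQ w hw).2.1⟩
  have hsrc : Φ.base.toHomeo.source = φ.toHomeo.source ∩ U := by rw [hb, φ.restr_source]
  have hbφ : ∀ w, Φ.base.toHomeo w = φ.toHomeo w := fun w => by rw [hb]; rfl
  have hev : ∀ w ∈ Φ.base.toHomeo.source, ∀ᶠ w in 𝓝 w, w ∈ Φ.base.toHomeo.source ∧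
      ∀ s : ℂ, Φ.total.toHomeo (w, s) = formula ε T X Θ Ψ (w, s) := fun w hw => by
    filter_upwards [Φ.base.toHomeo.open_source.mem_nhds hw] with y hy
    exact ⟨hy, ht y (by rwa [hb] at hy)⟩
  have hzs : z ∈ Φ.base.toHomeo.source := by rw [hsrc]; exact ⟨hz, hzU⟩
  refine ⟨Φ, mem_equivGroup_subclass hr fun w hw => ?_, hzs,
    Eventually.of_forall fun w => (hbφ w).symm, hev z hzs⟩
  have hq := hUQ w (by rwa [hb] at hw)
  exact ⟨ε, T, X, Θ, Ψ, hq.2.1.congr (Eventually.of_forall hbφ), hq.2.2,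
    (hev w hw).mono fun y hy => hy.2⟩

/-- The parameters found from one admissible transformation satisfy the condition of the subclass,
so the same formula acts on all its elements; its value on the given S is S' by `mapsEquation_iff`.
-/
theorem normalized_subclass (hr : r = ∞ ∨ r = ω) (i : Option ℝ) :
    Normalized r (subclass r i) := by
  rintro z S S' φ ⟨hz, hS, hS', hM⟩
  obtain ⟨-, ε, T, X, Θ, Ψ, h, hP, hm⟩ := exists_hasForm_of_subclass hr hz hS hS' hM
  obtain ⟨Φ, hΦ, hzΦ, hφ, ht⟩ :=
    exists_mem_equivGroup hr hz (ne_zero_of_classV (classV_iff.2 ⟨i, hS⟩)) h hP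
  refine ⟨Φ, hΦ, hzΦ, hφ, ?_⟩
  have hsymm : Tendsto φ.toHomeo.symm (𝓝 (φ.toHomeo z)) (𝓝 z) := φ.toHomeo.tendsto_symm hz
  filter_upwards [hsymm.eventually hm, hsymm.eventually hφ, hsymm.eventually ht,
    φ.toHomeo.open_target.mem_nhds (φ.toHomeo.map_source hz)] with w h1 h2 h3 h4
  rw [← φ.toHomeo.right_inv h4, h1]
  nth_rw 1 [h2]
  rw [Φ.act_base S h3.1, h3.2]

theorem Induced.admissible_classV (hr : r = ∞ ∨ r = ω) {Φ : ExtTransf r} {φ : PointTransf r Vars}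
    (hΦ : Φ ∈ equivGroup r (subclass r i)) (hz : z ∈ φ.toHomeo.source) (hS : subclass r i z S)
    (hi : Induced Φ z S S' φ) : Admissible (classV r) z S S' φ := by
  obtain ⟨hzΦ, hφ, hact⟩ := hi
  obtain ⟨-, -, hS', hM⟩ := hΦ z hzΦ S hS
  obtain ⟨-, ε, T, X, Θ, Ψ, h, hP, hm⟩ := exists_hasForm_of_subclass hr hzΦ hS hS' hM
  have h' : HasForm r φ.toHomeo z ε T X Θ Ψ := h.congr hφ
  have hcV : classV r z S := classV_iff.2 ⟨i, hS⟩
  refine ⟨hz, hcV, ?_, ?_⟩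
  · obtain ⟨g, V', hg⟩ := classV_iff.2 ⟨i, hS'⟩
    rw [← hφ.self_of_nhds] at hg
    exact ⟨g, V', hg.congr hact⟩
  · refine (mapsEquation_iff hr hz h' (ne_zero_of_classV hcV)).2 ?_
    have hc : Tendsto φ.toHomeo (𝓝 z) (𝓝 (φ.toHomeo z)) := (φ.contDiffAt hz).continuousAt
    filter_upwards [hc.eventually hact, hφ, hm] with w h1 h2 h3
    rw [h1, h2, h3]

end
end NSE

/-! ### Equivalence groups of 𝒱 and 𝒱', and the explicit form of 𝒫_γ -/

namespace NSE

section
variable {r : WithTop ℕ∞} {z w : Vars} {S : Vars → ℂ}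

theorem HasDerivAt.ofReal_mul_const {L : ℝ → ℝ} {L' ρ : ℝ} (σ : ℂ) (h : HasDerivAt L L' ρ) :
    HasDerivAt (fun ρ => σ * ((L ρ : ℝ) : ℂ)) (σ * ((L' : ℝ) : ℂ)) ρ :=
  h.ofReal_comp.const_mul σ

/-- For f = e^ρ the ratio equals ρ, which is not constant. The free constant allows S to take any
prescribed value at a point. -/
theorem subclass_none_exp (hz : z.2 ≠ 0) (k : ℂ) :
    subclass r none z fun w => ((Real.exp ‖w.2‖ : ℝ) : ℂ) + k := by
  have hd : deriv (fun ρ : ℝ => ((Real.exp ρ : ℝ) : ℂ)) = fun ρ => ((Real.exp ρ : ℝ) : ℂ) :=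
    funext fun ρ => (Real.hasDerivAt_exp ρ).ofReal_comp.deriv
  have hne : ∀ ρ : ℝ, ((Real.exp ρ : ℝ) : ℂ) ≠ 0 := fun ρ => by
    exact_mod_cast (Real.exp_pos ρ).ne'
  refine ⟨fun ρ => ((Real.exp ρ : ℝ) : ℂ), fun _ => k, ⟨hz, ?_, ?_, ?_, ?_⟩, ?_⟩
  · exact Eventually.of_forall fun ρ =>
      Complex.ofRealCLM.contDiff.contDiffAt.comp ρ Real.contDiff_exp.contDiffAt
  · exact Eventually.of_forall fun ρ => contDiffAt_const
  · rw [hd]; exact Eventually.of_forall hne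
  · exact Eventually.of_forall fun w => rfl
  · rintro ⟨c, hc⟩
    have h1 : ∀ᶠ ρ in 𝓝 ‖z.2‖, id ρ = c := hc.mono fun ρ h => by
      rw [ratio, hd, hd, mul_div_cancel_right₀ _ (hne _)] at h
      exact_mod_cast h
    have h2 : HasDerivAt (fun _ : ℝ => c) 1 ‖z.2‖ :=
      (hasDerivAt_id ‖z.2‖).congr_of_eventuallyEq (h1.mono fun ρ h => h.symm)
    exact one_ne_zero (h2.unique (hasDerivAt_const _ _))

theorem HasFormV.exists_form {Φ : ExtTransf r} (h : HasFormV Φ) (hz : z ∈ Φ.base.toHomeo.source)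
    (i : Option ℝ) : ∃ (ε : ℝ) (T X Θ Ψ : ℝ → ℝ), HasForm r Φ.base.toHomeo z ε T X Θ Ψ ∧
      (∀ᶠ t in 𝓝 z.1.1, Params i T Θ t) ∧
      ∀ᶠ w in 𝓝 z, ∀ s : ℂ, Φ.total.toHomeo (w, s) = formula ε T X Θ Ψ (w, s) := by
  obtain ⟨ε, T, X, Θ, Ψ, hε, hT, hX, hΘ, hΨ, h0, ht⟩ := h z hz
  refine ⟨ε, T, X, Θ, Ψ, Φ.hasForm hz hε hT hX hΘ hΨ (h0.mono fun t h => h.1) ht, ?_, ht⟩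
  filter_upwards [h0] with t ⟨_, h1, h2⟩
  cases i with
  | none => exact ⟨h1, h2⟩
  | some γ => simp [Params, h1, h2]

theorem HasFormV.mem_equivGroup (hr : r = ∞ ∨ r = ω) {Φ : ExtTransf r} (h : HasFormV Φ)
    (i : Option ℝ) : Φ ∈ equivGroup r (subclass r i) :=
  mem_equivGroup_subclass hr fun _ hw => h.exists_form hw i

theorem admissible_classV_of_subclass {S' : Vars → ℂ} {φ : PointTransf r Vars} {i : Option ℝ}
    (h : Admissible (subclass r i) z S S' φ) : Admissible (classV r) z S S' φ :=
  ⟨h.1, classV_iff.2 ⟨i, h.2.1⟩, classV_iff.2 ⟨i, h.2.2.1⟩, h.2.2.2⟩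

/-- The hypothesis only asks that elements of 𝒱' go to elements of 𝒱, so it follows from membership
in either group. One element gives the base map and Θ_t = T_tt = 0; varying its constant gives the
action on all values of S. -/
theorem hasFormV_of_forall_admissible (hr : r = ∞ ∨ r = ω) {Φ : ExtTransf r}
    (hΦ : ∀ z ∈ Φ.base.toHomeo.source, ∀ S, subclass r none z S →
      Admissible (classV r) z S (Φ.act S) Φ.base) : HasFormV Φ := by
  intro z hz
  have hne := Φ.source_ne
  have hS := subclass_none_exp (r := r) (hne z hz) 0
  obtain ⟨-, -, hS', hM⟩ := hΦ z hz _ hS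
  obtain ⟨j, hj⟩ := classV_iff.1 hS'
  obtain ⟨-, ε, T, X, Θ, Ψ, h, hP, -⟩ := exists_hasForm_of_subclass hr hz hS hj hM
  refine ⟨ε, T, X, Θ, Ψ, h.eps, h.smooth_T, h.smooth_X, h.smooth_Θ, h.smooth_Ψ, ?_, ?_⟩
  · filter_upwards [h.deriv_ne, hP] with t h1 h2 using ⟨h1, h2.1, h2.2⟩
  · filter_upwards [h.eventually, Φ.base.toHomeo.open_source.mem_nhds hz] with w hw hws s
    -- The constant is chosen so that this element has the value `s` at `w`.
    have hSw := subclass_none_exp (r := r) (hne w hws) (s - ((Real.exp ‖w.2‖ : ℝ) : ℂ))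
    have h1 := ((mapsEquation_iff hr hws hw (hne w hws)).1 (hΦ w hws _ hSw).2.2.2).self_of_nhds
    rw [Φ.act_base _ hws, add_sub_cancel] at h1
    refine Prod.ext ?_ h1
    rw [Φ.proj (w, s) (by rw [Φ.source_eq]; exact ⟨hws, trivial⟩), hw.eq.self_of_nhds, formula_fst]

theorem mem_equivGroup_classV_iff (hr : r = ∞ ∨ r = ω) (Φ : ExtTransf r) :
    Φ ∈ equivGroup r (classV r) ↔ HasFormV Φ := by
  refine ⟨fun h => hasFormV_of_forall_admissible hr fun z hz S hS =>
    h z hz S (classV_iff.2 ⟨none, hS⟩), fun h z hz S hS => ?_⟩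
  obtain ⟨i, hi⟩ := classV_iff.1 hS
  exact admissible_classV_of_subclass (h.mem_equivGroup hr i z hz S hi)

theorem mem_equivGroup_classV'_iff (hr : r = ∞ ∨ r = ω) (Φ : ExtTransf r) :
    Φ ∈ equivGroup r (classV' r) ↔ HasFormV Φ :=
  ⟨fun h => hasFormV_of_forall_admissible hr fun z hz S hS =>
    admissible_classV_of_subclass (i := none) (h z hz S hS), fun h => h.mem_equivGroup hr none⟩

/-- The subclass `𝒫_γ` in terms of a function `L` with the derivative proportional to `ρ^(γ-1)`. -/
theorem classP_iff (hr : r = ∞ ∨ r = ω) {γ k : ℝ} {L : ℝ → ℝ} (hk : k ≠ 0)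
    (hL : ∀ ρ, 0 < ρ → ContDiffAt ℝ r L ρ)
    (hL' : ∀ ρ, 0 < ρ → HasDerivAt L (k * ρ ^ (γ - 1)) ρ) :
    classP r γ z S ↔ z.2 ≠ 0 ∧ ∃ (σ : ℂ) (V : ℝ × ℝ → ℂ), σ ≠ 0 ∧ SmoothNear r V z.1 ∧
      ∀ᶠ w in 𝓝 z, S w = σ * ((L ‖w.2‖ : ℝ) : ℂ) + V w.1 := by
  have hpow : ∀ ρ : ℝ, 0 < ρ → ((ρ ^ (γ - 1) : ℝ) : ℂ) ≠ 0 := fun ρ h => by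
    exact_mod_cast (Real.rpow_pos_of_pos h _).ne'
  have hkC : (k : ℂ) ≠ 0 := by exact_mod_cast hk
  constructor
  · rintro ⟨f, V, ⟨hz, hf, hV, hf0, hS⟩, hγ⟩
    refine ⟨hz, ?_⟩
    set a := ‖z.2‖ with ha
    have ha0 : 0 < a := norm_pos_iff.2 hz
    obtain ⟨d, hd, hball⟩ := Metric.eventually_nhds_iff_ball.1
      ((hf.eventually_nhds.and (hf0.and hγ)).and (lt_mem_nhds ha0))
    -- The ratio condition is a linear equation for f_ρ, with integrating factor ρ^(1-γ).
    have hh : ∀ ρ ∈ Metric.ball a d,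
        HasDerivAt (fun ρ => deriv f ρ * ((ρ ^ (1 - γ) : ℝ) : ℂ)) 0 ρ := by
      intro ρ hρ
      obtain ⟨⟨h1, h2, h3⟩, h4⟩ := hball ρ hρ
      replace h1 : SmoothNear r f ρ := h1
      replace h4 : 0 < ρ := h4
      have h5 := ((h1.deriv hr).hasDerivAt hr).mul
        (Real.hasDerivAt_rpow_const (p := 1 - γ) (Or.inl h4.ne')).ofReal_comp
      refine h5.congr_deriv ?_
      have h6 : (ρ : ℂ) ≠ 0 := by exact_mod_cast h4.ne'
      rw [ratio, div_eq_iff h2] at h3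
      rw [Real.rpow_sub_one h4.ne']
      push_cast at h3 ⊢
      field_simp
      linear_combination ((ρ ^ (1 - γ) : ℝ) : ℂ) * h3
    have hconst : ∀ ρ ∈ Metric.ball a d,
        deriv f ρ = deriv f a * ((a ^ (1 - γ) : ℝ) : ℂ) * ((ρ ^ (γ - 1) : ℝ) : ℂ) := by
      intro ρ hρ
      have h1 := eq_of_fderiv_apply_eq_zero
        (g := fun ρ => deriv f ρ * ((ρ ^ (1 - γ) : ℝ) : ℂ)) (convex_ball a d) hρ
        (Metric.mem_ball_self hd) (fun y hy => (hh y hy).differentiableAt) (fun y hy => by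
          rw [(hh y hy).hasFDerivAt.fderiv]; simp)
      have h4 : 0 < ρ := (hball ρ hρ).2
      have h5 : ((ρ ^ (1 - γ) : ℝ) : ℂ) * ((ρ ^ (γ - 1) : ℝ) : ℂ) = 1 := by
        rw [← Complex.ofReal_mul, ← Real.rpow_add h4]; simp
      rw [← h1, mul_assoc, h5, mul_one]
    set σ : ℂ := deriv f a * ((a ^ (1 - γ) : ℝ) : ℂ) / k with hσ
    have hσ0 : σ ≠ 0 := div_ne_zero (mul_ne_zero hf0.self_of_nhds
      (by exact_mod_cast (Real.rpow_pos_of_pos ha0 _).ne')) hkC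
    have hfL : ∀ ρ ∈ Metric.ball a d, f ρ = σ * ((L ρ : ℝ) : ℂ) + (f a - σ * ((L a : ℝ) : ℂ)) := by
      intro ρ hρ
      have hdiff : ∀ y ∈ Metric.ball a d,
          HasDerivAt (fun y => f y - σ * ((L y : ℝ) : ℂ)) 0 y := by
        intro y hy
        obtain ⟨⟨h1, -⟩, h4⟩ := hball y hy
        replace h1 : SmoothNear r f y := h1
        refine ((h1.hasDerivAt hr).sub
          (HasDerivAt.ofReal_mul_const σ (hL' y h4))).congr_deriv ?_
        rw [hconst y hy, hσ]
        push_cast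
        field_simp
        ring
      have h1 := eq_of_fderiv_apply_eq_zero (g := fun y => f y - σ * ((L y : ℝ) : ℂ))
        (convex_ball a d) hρ (Metric.mem_ball_self hd)
        (fun y hy => (hdiff y hy).differentiableAt) (fun y hy => by
          rw [(hdiff y hy).hasFDerivAt.fderiv]; simp)
      linear_combination h1
    refine ⟨σ, fun q => V q + (f a - σ * ((L a : ℝ) : ℂ)), hσ0,
      hV.mono fun q hq => hq.add contDiffAt_const, ?_⟩
    have hn : Tendsto (fun w : Vars => ‖w.2‖) (𝓝 z) (𝓝 a) :=
      (show ContinuousAt (fun w : Vars => ‖w.2‖) z by fun_prop)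
    filter_upwards [hS, hn.eventually (Metric.ball_mem_nhds a hd)] with w h1 h2
    rw [h1, hfL _ h2]
    ring
  · rintro ⟨hz, σ, V, hσ, hV, hS⟩
    have ha0 : 0 < ‖z.2‖ := norm_pos_iff.2 hz
    have hpos : ∀ᶠ ρ in 𝓝 ‖z.2‖, 0 < ρ := lt_mem_nhds ha0
    have hd : ∀ ρ, 0 < ρ → deriv (fun ρ => σ * ((L ρ : ℝ) : ℂ)) ρ
        = σ * ((k * ρ ^ (γ - 1) : ℝ) : ℂ) := fun ρ h =>
      (HasDerivAt.ofReal_mul_const σ (hL' ρ h)).deriv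
    have hd0 : ∀ ρ : ℝ, 0 < ρ → σ * ((k * ρ ^ (γ - 1) : ℝ) : ℂ) ≠ 0 := fun ρ h =>
      mul_ne_zero hσ (by rw [Complex.ofReal_mul]; exact mul_ne_zero hkC (hpow ρ h))
    refine ⟨fun ρ => σ * ((L ρ : ℝ) : ℂ), V, ⟨hz, ?_, hV, ?_, hS⟩, ?_⟩
    · filter_upwards [hpos] with ρ hρ
      exact contDiffAt_const.mul (Complex.ofRealCLM.contDiff.contDiffAt.comp ρ (hL ρ hρ))
    · filter_upwards [hpos] with ρ hρ
      rw [hd ρ hρ]; exact hd0 ρ hρ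
    · filter_upwards [hpos] with ρ hρ
      have h1 : deriv (fun ρ => σ * ((L ρ : ℝ) : ℂ)) =ᶠ[𝓝 ρ]
          fun ρ => σ * ((k * ρ ^ (γ - 1) : ℝ) : ℂ) := (lt_mem_nhds hρ).mono hd
      have h2 := HasDerivAt.ofReal_mul_const σ
        ((Real.hasDerivAt_rpow_const (p := γ - 1) (Or.inl hρ.ne')).const_mul k)
      rw [ratio, h1.deriv_eq, h2.deriv, hd ρ hρ, div_eq_iff (hd0 ρ hρ), Real.rpow_sub_one hρ.ne']
      have h6 : (ρ : ℂ) ≠ 0 := by exact_mod_cast hρ.ne'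
      push_cast
      field_simp

theorem classP_zero_iff (hr : r = ∞ ∨ r = ω) :
    classP r 0 z S ↔ z.2 ≠ 0 ∧ ∃ (σ : ℂ) (V : ℝ × ℝ → ℂ), σ ≠ 0 ∧ SmoothNear r V z.1 ∧
      ∀ᶠ w in 𝓝 z, S w = σ * (Real.log ‖w.2‖ : ℂ) + V w.1 :=
  classP_iff hr (L := Real.log) one_ne_zero (fun ρ h => Real.contDiffAt_log.2 h.ne') fun ρ h => by
    refine (Real.hasDerivAt_log h.ne').congr_deriv ?_
    rw [zero_sub, Real.rpow_neg_one, one_mul]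

theorem classP_ne_zero_iff (hr : r = ∞ ∨ r = ω) {γ : ℝ} (hγ : γ ≠ 0) :
    classP r γ z S ↔ z.2 ≠ 0 ∧ ∃ (σ : ℂ) (V : ℝ × ℝ → ℂ), σ ≠ 0 ∧ SmoothNear r V z.1 ∧
      ∀ᶠ w in 𝓝 z, S w = σ * ((‖w.2‖ ^ γ : ℝ) : ℂ) + V w.1 :=
  classP_iff hr (L := fun ρ => ρ ^ γ) hγ (fun _ h => Real.contDiffAt_rpow_const_of_ne h.ne')
    fun _ h => Real.hasDerivAt_rpow_const (Or.inl h.ne')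

theorem exists_classP (hr : r = ∞ ∨ r = ω) (γ : ℝ) (hz : z.2 ≠ 0) : ∃ S, classP r γ z S := by
  have hV : SmoothNear r (fun _ : ℝ × ℝ => (0 : ℂ)) z.1 :=
    Eventually.of_forall fun _ => contDiffAt_const
  rcases eq_or_ne γ 0 with rfl | hγ
  · exact ⟨_, (classP_zero_iff hr).2 ⟨hz, 1, fun _ => 0, one_ne_zero, hV,
      Eventually.of_forall fun w => rfl⟩⟩
  · exact ⟨_, (classP_ne_zero_iff hr hγ).2 ⟨hz, 1, fun _ => 0, one_ne_zero, hV,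
      Eventually.of_forall fun w => rfl⟩⟩

end
end NSE

/-! ### Additional equivalence transformations of 𝒫_γ -/

namespace NSE

section
variable {r : WithTop ℕ∞} {F : Vars → Vars} {z : Vars} {S S' : Vars → ℂ}

/-- T is an antiderivative of e^(-γt) with an explicit smooth inverse; γ = 0 is separate because the
antiderivative is then linear. -/
theorem exists_time_change (r : WithTop ℕ∞) (γ : ℝ) : ∃ (T τ : ℝ → ℝ) (U : Set ℝ), IsOpen U ∧
    (∀ t, T t ∈ U) ∧ (∀ t, τ (T t) = t) ∧ (∀ s ∈ U, T (τ s) = s) ∧ ContDiff ℝ r T ∧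
    (∀ s ∈ U, ContDiffAt ℝ r τ s) ∧ ∀ t, HasDerivAt T (Real.exp (-γ * t)) t := by
  rcases eq_or_ne γ 0 with rfl | hγ
  · exact ⟨id, id, Set.univ, isOpen_univ, fun _ => trivial, fun _ => rfl, fun _ _ => rfl,
      contDiff_id, fun _ _ => contDiffAt_id, fun t => by simpa using hasDerivAt_id t⟩
  · refine ⟨fun t => -(Real.exp (-γ * t)) / γ, fun s => -Real.log (-γ * s) / γ,
      {s | 0 < -γ * s}, isOpen_lt continuous_const (by fun_prop), fun t => ?_, fun t => ?_,
      fun s hs => ?_, ?_, fun s hs => ?_, fun t => ?_⟩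
    · have : -γ * (-(Real.exp (-γ * t)) / γ) = Real.exp (-γ * t) := by field_simp
      change 0 < -γ * (-(Real.exp (-γ * t)) / γ)
      rw [this]; exact Real.exp_pos _
    · have : -γ * (-(Real.exp (-γ * t)) / γ) = Real.exp (-γ * t) := by field_simp
      simp only
      rw [this, Real.log_exp]; field_simp
    · have h1 : -γ * (-Real.log (-γ * s) / γ) = Real.log (-γ * s) := by field_simp
      simp only
      rw [h1, Real.exp_log hs]; field_simp
    · exact (Real.contDiff_exp.comp (contDiff_const.mul contDiff_id)).neg.div_const _
    · have h1 : ContDiffAt ℝ r (fun s => -γ * s) s := contDiffAt_const.mul contDiffAt_id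
      exact (h1.log (ne_of_gt hs)).neg.div_const _
    · have h1 := (((hasDerivAt_id t).const_mul (-γ)).exp.neg).div_const γ
      refine h1.congr_deriv ?_
      simp only [id]
      field_simp

/-- With Θ = t the condition of 𝒫_γ becomes γ T_t + T_tt = 0, solved by T_t = e^(-γt). The phase
then has the constant coefficient -γ/8 at x². -/
theorem exists_hasForm_exponential (r : WithTop ℕ∞) (γ : ℝ) :
    ∃ (φ : PointTransf r Vars) (T : ℝ → ℝ), φ.toHomeo.source = Set.univ ∧
      (∀ z, HasForm r φ.toHomeo z 1 T (fun _ => 0) (fun t => t) fun _ => 0) ∧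
      ∀ t, Params (some γ) T (fun t => t) t := by
  obtain ⟨T, τ, U, hU, hTU, hτT, hTτ, hT, hτ, hT'⟩ := exists_time_change r γ
  let a : ℝ → ℝ := fun t => Real.exp (-γ * t / 2)
  let A : ℝ × ℝ → ℂ := fun q => Complex.exp (Complex.I * (-γ / 8 * q.2 ^ 2 : ℝ) + (q.1 : ℂ))
  have ha : ContDiff ℝ r a :=
    Real.contDiff_exp.comp ((contDiff_const.mul contDiff_id).div_const _)
  have hA : ContDiff ℝ r A := by
    have h1 : ContDiff ℝ r fun q : ℝ × ℝ => ((-γ / 8 * q.2 ^ 2 : ℝ) : ℂ) :=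
      Complex.ofRealCLM.contDiff.comp (contDiff_const.mul (contDiff_snd.pow 2))
    have h2 : ContDiff ℝ r fun q : ℝ × ℝ => (q.1 : ℂ) :=
      Complex.ofRealCLM.contDiff.comp contDiff_fst
    exact ((contDiff_const.mul h1).add h2).cexp
  have ha0 : ∀ t, a t ≠ 0 := fun t => (Real.exp_pos _).ne'
  have hA0 : ∀ q, A q ≠ 0 := fun q => Complex.exp_ne_zero _
  let F : Vars → Vars := fun w => ((T w.1.1, w.1.2 * a w.1.1), w.2 * A w.1)
  let B : Vars → ℝ × ℝ := fun w => (τ w.1.1, w.1.2 / a (τ w.1.1))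
  let F' : Vars → Vars := fun w => (B w, w.2 / A (B w))
  have hF : ContDiff ℝ r F :=
    (((hT.comp (contDiff_fst.comp contDiff_fst)).prodMk ((contDiff_snd.comp contDiff_fst).mul
      (ha.comp (contDiff_fst.comp contDiff_fst)))).prodMk (contDiff_snd.mul (hA.comp contDiff_fst)))
  have hF' : ∀ w : Vars, w.1.1 ∈ U → ContDiffAt ℝ r F' w := by
    intro w hw
    have h1 : ContDiffAt ℝ r (fun w : Vars => τ w.1.1) w :=
      ContDiffAt.comp (g := τ) (f := fun w : Vars => w.1.1) w (hτ _ hw) (by fun_prop)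
    have h2 : ContDiffAt ℝ r (fun w : Vars => a (τ w.1.1)) w := ha.contDiffAt.comp w h1
    have h3 : ContDiffAt ℝ r (fun w : Vars => w.1.2) w := by fun_prop
    have h4 : ContDiffAt ℝ r B w := h1.prodMk (h3.div h2 (ha0 _))
    exact h4.prodMk (contDiffAt_complex_div contDiffAt_snd (hA.contDiffAt.comp w h4) (hA0 _))
  let φ : PointTransf r Vars :=
    { toHomeo :=
        { toFun := F
          invFun := F'
          source := Set.univ
          target := {w | w.1.1 ∈ U}
          map_source' := fun w _ => hTU _
          map_target' := fun _ _ => trivial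
          left_inv' := by
            rintro ⟨⟨t, x⟩, ψ⟩ -
            simp only [F, F', B, hτT, mul_div_cancel_right₀ _ (ha0 _),
              mul_div_cancel_right₀ _ (hA0 _)]
          right_inv' := by
            rintro ⟨⟨t, x⟩, ψ⟩ hw
            simp only [F, F', B, hTτ t hw, div_mul_cancel₀ _ (ha0 _), div_mul_cancel₀ _ (hA0 _)]
          open_source := isOpen_univ
          open_target := hU.preimage (continuous_fst.comp continuous_fst)
          continuousOn_toFun := hF.continuous.continuousOn
          continuousOn_invFun := fun w hw => (hF' w hw).continuousAt.continuousWithinAt }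
      contDiffOn := hF.contDiffOn
      contDiffOn_symm := fun w hw => (hF' w hw).contDiffWithinAt }
  have hd : deriv T = fun t => Real.exp (-γ * t) := funext fun t => (hT' t).deriv
  have hdd : ∀ t, deriv (deriv T) t = -γ * Real.exp (-γ * t) := fun t => by
    rw [hd]
    have := ((hasDerivAt_id t).const_mul (-γ)).exp.deriv
    simp only [id] at this
    rw [this]; ring
  have hpos : ∀ t, 0 < deriv T t := fun t => by rw [hd]; exact Real.exp_pos _
  refine ⟨φ, T, rfl, fun z => ⟨Or.inl rfl, Eventually.of_forall fun t => hT.contDiffAt,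
    Eventually.of_forall fun t => contDiffAt_const, Eventually.of_forall fun t => contDiffAt_id,
    Eventually.of_forall fun t => contDiffAt_const,
    Eventually.of_forall fun t => (hpos t).ne', Eventually.of_forall fun w => ?_⟩, fun t => ?_⟩
  · change F w = _
    have h1 : √|deriv T w.1.1| = a w.1.1 := by
      rw [abs_of_pos (hpos _), hd, ← Real.exp_half]
    have h2 : hat T w.1.1 w.2 = w.2 := if_pos (hpos _)
    have h3 : phase₂ T w.1.1 = -γ / 8 := by
      rw [phase₂, abs_of_pos (hpos _), hdd, hd, mul_div_cancel_right₀ _ (Real.exp_pos _).ne']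
      ring
    have h4 : phase₁ 1 T (fun _ => 0) w.1.1 = 0 := by simp [phase₁]
    have h5 : amplitude 1 T (fun _ => 0) (fun t => t) (fun _ => 0) w.1 = A w.1 := by
      simp only [amplitude, h3, h4, A, zero_mul, add_zero]
    rw [h1, h2, h5, one_mul, add_zero]
  · simp only [Params, hdd, deriv_id'']
    rw [hd]
    ring

theorem exists_additional_equivalence (hr : r = ∞ ∨ r = ω) (γ : ℝ) :
    ∃ Φ ∈ equivGroup r (classP r γ), ∃ z ∈ Φ.base.toHomeo.source, ∃ (T : ℝ → ℝ),
      HasForm r Φ.base.toHomeo z 1 T (fun _ => 0) (fun t => t) fun _ => 0 := by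
  obtain ⟨φ, T, hs, h, hP⟩ := exists_hasForm_exponential r γ
  let z : Vars := ((0, 0), 1)
  obtain ⟨Φ, hΦ, hz, hφ, -⟩ := exists_mem_equivGroup hr (z := z) (i := some γ)
    (by rw [hs]; trivial) one_ne_zero (h z) (Eventually.of_forall hP)
  exact ⟨Φ, hΦ, z, hz, T, (h z).congr hφ.symm⟩

/-- In the group of 𝒱 the parameter Θ has zero derivative, and Θ is determined by the base map. -/
theorem HasFormV.not_hasForm {Φ : ExtTransf r} (hΦ : HasFormV Φ) (hz : z ∈ Φ.base.toHomeo.source)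
    {ε : ℝ} {T X Ψ : ℝ → ℝ} (h : HasForm r Φ.base.toHomeo z ε T X (fun t => t) Ψ) : False := by
  obtain ⟨ε', T', X', Θ', Ψ', h', hP, -⟩ := hΦ.exists_form hz none
  have h1 := (h.parameters_unique h' (Φ.source_ne z hz)).2.deriv_eq
  rw [hP.self_of_nhds.2] at h1
  simp at h1

theorem not_normalized_classV (hr : r = ∞ ∨ r = ω) : ¬ Normalized r (classV r) := by
  intro hN
  obtain ⟨Φ, hΦ, z, hz, T, h⟩ := exists_additional_equivalence hr 0
  obtain ⟨S, hS⟩ := exists_classP hr 0 (Φ.source_ne z hz)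
  obtain ⟨Φ', hΦ', hz', hb, -⟩ := hN z S (Φ.act S) Φ.base
    (admissible_classV_of_subclass (i := some 0) (hΦ z hz S hS))
  exact ((mem_equivGroup_classV_iff hr Φ').1 hΦ').not_hasForm hz' (h.congr hb.symm)

theorem equivGroup_classP_not_subset (hr : r = ∞ ∨ r = ω) (γ : ℝ) :
    ¬ equivGroup r (classP r γ) ⊆ equivGroup r (classV r) := by
  intro hsub
  obtain ⟨Φ, hΦ, z, hz, T, h⟩ := exists_additional_equivalence hr γ
  exact ((mem_equivGroup_classV_iff hr Φ).1 (hsub hΦ)).not_hasForm hz h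

/-- A transformation with Θ = t in both groups would satisfy T_tt = 0 and γ T_t + T_tt = 0,
contradicting T_t ≠ 0. -/
theorem equivGroup_classP_zero_ne (hr : r = ∞ ∨ r = ω) {γ : ℝ} (hγ : γ ≠ 0) :
    equivGroup r (classP r 0) ≠ equivGroup r (classP r γ) := by
  intro heq
  obtain ⟨Φ, hΦ, z, hz, T, h⟩ := exists_additional_equivalence hr 0
  have hz0 := Φ.source_ne z hz
  have key : ∀ δ, Φ ∈ equivGroup r (classP r δ) →
      δ * deriv T z.1.1 + deriv (deriv T) z.1.1 = 0 := by
    intro δ hδ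
    obtain ⟨S, hS⟩ := exists_classP hr δ hz0
    obtain ⟨-, -, hS', hM⟩ := hδ z hz S hS
    obtain ⟨-, ε', T', X', Θ', Ψ', h', hP, -⟩ :=
      exists_hasForm_of_subclass hr (i := some δ) (j := some δ) hz hS hS' hM
    obtain ⟨hT, hΘ⟩ := h.parameters_unique h' hz0
    have h1 := hP.self_of_nhds
    have hΘ' : deriv (fun t : ℝ => t) z.1.1 = 1 := deriv_id _
    simp only [Params] at h1
    rw [← hΘ.deriv_eq, ← hT.deriv_eq, ← hT.deriv.deriv_eq, hΘ', mul_one] at h1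
    exact h1
  have h1 := key 0 hΦ
  have h2 := key γ (heq ▸ hΦ)
  have h3 : γ * deriv T z.1.1 = 0 := by linarith
  exact (mul_ne_zero hγ h.deriv_ne.self_of_nhds) h3

end
end NSE

/-! ### Assembly of the theorem -/

theorem mainTheorem4 (r : WithTop ℕ∞) (hr : r = ∞ ∨ r = ω) :
    -- the equivalence group of `𝒱`
    (∀ Φ : NSE.ExtTransf r, Φ ∈ NSE.equivGroup r (NSE.classV r) ↔ NSE.HasFormV Φ) ∧
    -- `𝒱` is not normalized
    ¬ NSE.Normalized r (NSE.classV r) ∧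
    -- `𝒱'` has the same equivalence group and is normalized
    NSE.equivGroup r (NSE.classV' r) = NSE.equivGroup r (NSE.classV r) ∧
    NSE.Normalized r (NSE.classV' r) ∧
    -- `𝒫_0` consists of the equations with logarithmic nonlinearities
    (∀ (z : NSE.Vars) (S : NSE.Vars → ℂ), NSE.classP r 0 z S ↔
      z.2 ≠ 0 ∧ ∃ (σ : ℂ) (V : ℝ × ℝ → ℂ), σ ≠ 0 ∧ NSE.SmoothNear r V z.1 ∧
        ∀ᶠ w in 𝓝 z, S w = σ * (Real.log ‖w.2‖ : ℂ) + V w.1) ∧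
    -- `𝒫_γ`, `γ ≠ 0`, consists of the equations with power nonlinearities
    (∀ γ : ℝ, γ ≠ 0 → ∀ (z : NSE.Vars) (S : NSE.Vars → ℂ), NSE.classP r γ z S ↔
      z.2 ≠ 0 ∧ ∃ (σ : ℂ) (V : ℝ × ℝ → ℂ), σ ≠ 0 ∧ NSE.SmoothNear r V z.1 ∧
        ∀ᶠ w in 𝓝 z, S w = σ * ((‖w.2‖ ^ γ : ℝ) : ℂ) + V w.1) ∧
    -- in both cases there are additional equivalence transformations, and the cases are different
    (∀ γ : ℝ, ¬ NSE.equivGroup r (NSE.classP r γ) ⊆ NSE.equivGroup r (NSE.classV r)) ∧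
    (∀ γ : ℝ, γ ≠ 0 →
      NSE.equivGroup r (NSE.classP r 0) ≠ NSE.equivGroup r (NSE.classP r γ)) ∧
    -- each admissible transformation of `𝒱` that is not induced by the equivalence group of `𝒱`
    -- acts within one of these cases
    (∀ (z : NSE.Vars) (S S' : NSE.Vars → ℂ) (φ : NSE.PointTransf r NSE.Vars),
      NSE.Admissible (NSE.classV r) z S S' φ →
      (¬ ∃ Φ ∈ NSE.equivGroup r (NSE.classV r), NSE.Induced Φ z S S' φ) →
      ∃ γ : ℝ, NSE.Admissible (NSE.classP r γ) z S S' φ) ∧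
    -- each `𝒫_γ` is normalized
    (∀ γ : ℝ, NSE.Normalized r (NSE.classP r γ)) ∧
    -- `𝒱` is the disjoint union of `𝒱'` and the `𝒫_γ`
    (∀ (z : NSE.Vars) (S : NSE.Vars → ℂ),
      NSE.classV r z S ↔ ∃ i, NSE.subclass r i z S) ∧
    (∀ i j, i ≠ j → ∀ (z : NSE.Vars) (S : NSE.Vars → ℂ),
      ¬ (NSE.subclass r i z S ∧ NSE.subclass r j z S)) ∧
    -- no point transformations between equations from different subclasses
    (∀ i j, i ≠ j → ∀ (z : NSE.Vars) (S S' : NSE.Vars → ℂ) (φ : NSE.PointTransf r NSE.Vars),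
      z ∈ φ.toHomeo.source → NSE.subclass r i z S → NSE.subclass r j (φ.toHomeo z) S' →
      ¬ NSE.MapsEquation φ.toHomeo S S' z) ∧
    -- description of all admissible transformations of `𝒱`
    (∀ (z : NSE.Vars) (S S' : NSE.Vars → ℂ) (φ : NSE.PointTransf r NSE.Vars),
      z ∈ φ.toHomeo.source →
      (NSE.Admissible (NSE.classV r) z S S' φ ↔
        ∃ i, NSE.subclass r i z S ∧
          ∃ Φ ∈ NSE.equivGroup r (NSE.subclass r i), NSE.Induced Φ z S S' φ)) := by
  refine ⟨NSE.mem_equivGroup_classV_iff hr, NSE.not_normalized_classV hr, ?_,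
    NSE.normalized_subclass hr none, fun z S => NSE.classP_zero_iff hr,
    fun γ hγ z S => NSE.classP_ne_zero_iff hr hγ, NSE.equivGroup_classP_not_subset hr,
    fun γ hγ => NSE.equivGroup_classP_zero_ne hr hγ, ?_,
    fun γ => NSE.normalized_subclass hr (some γ), fun z S => NSE.classV_iff,
    fun i j hij z S h => hij (NSE.subclass_unique h.1 h.2),
    fun i j hij z S S' φ hz hS hS' hM =>
      hij (NSE.exists_hasForm_of_subclass hr hz hS hS' hM).1, ?_⟩
  · ext Φ
    rw [NSE.mem_equivGroup_classV_iff hr, NSE.mem_equivGroup_classV'_iff hr]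
  · rintro z S S' φ ⟨hz, hS, hS', hM⟩ hno
    obtain ⟨i, hi⟩ := NSE.classV_iff.1 hS
    obtain ⟨j, hj⟩ := NSE.classV_iff.1 hS'
    obtain rfl := (NSE.exists_hasForm_of_subclass hr hz hi hj hM).1
    cases i with
    | some γ => exact ⟨γ, hz, hi, hj, hM⟩
    -- In 𝒱' the transformation would be induced by the group of 𝒱', which is that of 𝒱, contrary to
    -- the assumption.
    | none =>
      obtain ⟨Φ, hΦ, hind⟩ := NSE.normalized_subclass hr none z S S' φ ⟨hz, hi, hj, hM⟩
      exact absurd ⟨Φ, (NSE.mem_equivGroup_classV_iff hr Φ).2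
        ((NSE.mem_equivGroup_classV'_iff hr Φ).1 hΦ), hind⟩ hno
  · intro z S S' φ hz
    constructor
    · rintro ⟨-, hS, hS', hM⟩
      obtain ⟨i, hi⟩ := NSE.classV_iff.1 hS
      obtain ⟨j, hj⟩ := NSE.classV_iff.1 hS'
      obtain rfl := (NSE.exists_hasForm_of_subclass hr hz hi hj hM).1
      exact ⟨i, hi, NSE.normalized_subclass hr i z S S' φ ⟨hz, hi, hj, hM⟩⟩
    · rintro ⟨i, hi, Φ, hΦ, hind⟩
      exact hind.admissible_classV hr hΦ hz hi
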